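/- Let $r\ge 2$ and $n$ be integers. For a sequence $T$ of $r$ distinct elements of $[n]$ and a positive semidefinite matrix $M\in\mathbb C^{2^r\times 2^r}$, let $M_T=M|_T\otimes \mathrm{Id}_{[n]\setminus T}$ denote the operator on $n$ qubits that acts as $M$ on the qubits of $T$. An $r$-local Hamiltonian with $m$ terms is a family $\mathcal H=\{(T_i,M_i): i\in[m]\}$ of such pairs. Its energy at $\psi\in\mathbb C^{2^n}$ is $\mathcal E_{\mathcal H}(\psi)=\sum_i\langle\psi,(M_i)_{T_i}\psi\rangle$. An $\varepsilon$-sparsifier of $\mathcal H$ is a weight function $w:[m]\to\mathbb R_{\ge0}$ such that for all $\psi\in\mathbb C^{2^n}$ $$(1-\varepsilon)\,\mathcal E_{\mathcal H}(\psi)\ \le\ \sum_i w(i)\,\langle\psi,(M_i)_{T_i}\psi\rangle\ \le\ (1+\varepsilon)\,\mathcal E_{\mathcal H}(\psi),$$ and its size is $|\{i: w(i)>0\}|$. For $C\in(0,\infty)$ and $\ell_0\in\mathbb N$, the family $\{M_i\}_{i\in[m]}$ is called $(C,\ell_0)$-bounded if all $M_i$ are non-zero, $\lambda_{\max}(M_i)\le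 C$ for all $i$, and for every non-empty $S\subseteq[m]$ with $|S|\le\ell_0$, every $k$ and every assignment to the $i\in S$ of distinct hyperedges $e_i$ (sequences of $r$ distinct elements of $[k]$), every non-zero eigenvalue of $\sum_{i\in S}(M_i)_{e_i}$ is at least $1/C$. (If $\mathcal H$ itself has several terms on the same sequence of qubits, then parallel hyperedges $e_i=e_j$ are also admitted when $T_i=T_j$.) **Theorem.** For every $r\ge2$ and every $c\in\mathbb N$ there are a randomized algorithm (a program for a unit-cost real RAM with fair coin tosses) and constants $A,a,B,b$ that depend only on $r$ and $c$, such that the following holds for all $n$, $m$, $C$, every $\varepsilon>0$ and every $r$-local Hamiltonian $\mathcal H=\{(T_i,M_i):i\in[m]\}$ on $n$ qubits in which every $M_i$ has nullity at most $1$ and for which $\{M_i\}_{i\in[m]}$ is $(C,2r)$-bounded. Given $n,m,C,\varepsilon$ and $\mathcal H$, the algorithm halts after at most $A(n+m+1)^a$ steps, whatever the coin tosses are, and outputs a weight function $w:[m]\to\mathbb R_{\ge0}$; with probability at least $1-n^{-c}$, $w$ is an $\varepsilon$-sparsifier of $\mathcal H$ of size at most $B(\log n)^b\,\varepsilon^{-2}C^2n^2$,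 that is, of size $\widetilde O_r(\varepsilon^{-2}C^2n^2)$. -/

import Mathlib

/-! ## Randomized real-RAM programs

While programs over a unit-cost real RAM: finitely many integer and real variables, integer and real
arrays with indirect access, exact real arithmetic `+ - * /` and order tests on real numbers, addition and
truncated subtraction on natural numbers, and fair coin tosses.  There is no rounding operation and
there are no real constants except natural numbers. -/

namespace RealRAM

/-- A memory state.  Variables and arrays are named by natural numbers.  `coins` is the sequence of the
coin tosses that have not been used yet. -/
structure State where
  natVar : ℕ → ℕ
  realVar : ℕ → ℝ
  natArr : ℕ → ℕ → ℕ
  realArr : ℕ → ℕ → ℝ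
  coins : ℕ → Bool

/-- Elementary instructions; the first argument is always the name of the target. -/
inductive Instr where
  /-- `x := k` -/
  | natConst (x k : ℕ)
  /-- `x := y + z` -/
  | natAdd (x y z : ℕ)
  /-- `x := y - z` (truncated at `0`) -/
  | natSub (x y z : ℕ)
  /-- `x := A[i]`, where `i` is an integer variable -/
  | natLoad (x A i : ℕ)
  /-- `A[i] := x`, where `i` is an integer variable -/
  | natStore (A i x : ℕ)
  /-- `x := k`, a real variable -/
  | realConst (x k : ℕ)
  | realAdd (x y z : ℕ)
  | realSub (x y z : ℕ)
  | realMul (x y z : ℕ)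
  /-- `x := y / z`, where division by `0` gives `0` -/
  | realDiv (x y z : ℕ)
  /-- `x := A[i]`, for a real array `A` and an integer variable `i` -/
  | realLoad (x A i : ℕ)
  /-- `A[i] := x`, for a real array `A` and an integer variable `i` -/
  | realStore (A i x : ℕ)
  /-- toss a fair coin and store the outcome (`0` or `1`) in the integer variable `x` -/
  | flip (x : ℕ)

/-- The effect of an elementary instruction. -/
noncomputable def Instr.apply : Instr → State → State
  | natConst x k, s => { s with natVar := Function.update s.natVar x k }
  | natAdd x y z, s => { s with natVar := Function.update s.natVar x (s.natVar y + s.natVar z) }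
  | natSub x y z, s => { s with natVar := Function.update s.natVar x (s.natVar y - s.natVar z) }
  | natLoad x A i, s => { s with natVar := Function.update s.natVar x (s.natArr A (s.natVar i)) }
  | natStore A i x, s =>
      { s with natArr := Function.update s.natArr A
                 (Function.update (s.natArr A) (s.natVar i) (s.natVar x)) }
  | realConst x k, s => { s with realVar := Function.update s.realVar x (k : ℝ) }
  | realAdd x y z, s => { s with realVar := Function.update s.realVar x (s.realVar y + s.realVar z) }
  | realSub x y z, s => { s with realVar := Function.update s.realVar x (s.realVar y - s.realVar z) }
  | realMul x y z, s => { s with realVar := Function.update s.realVar x (s.realVar y * s.realVar z) }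
  | realDiv x y z, s => { s with realVar := Function.update s.realVar x (s.realVar y / s.realVar z) }
  | realLoad x A i, s => { s with realVar := Function.update s.realVar x (s.realArr A (s.natVar i)) }
  | realStore A i x, s =>
      { s with realArr := Function.update s.realArr A
                 (Function.update (s.realArr A) (s.natVar i) (s.realVar x)) }
  | flip x, s =>
      { s with natVar := Function.update s.natVar x (if s.coins 0 then 1 else 0)
               coins := fun k => s.coins (k + 1) }

/-- Tests `x < y` between two integer variables or between two real variables. -/
inductive Test where
  | natLt (x y : ℕ)
  | realLt (x y : ℕ)

/-- The outcome of a test. -/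
def Test.Holds : Test → State → Prop
  | natLt x y, s => s.natVar x < s.natVar y
  | realLt x y, s => s.realVar x < s.realVar y

/-- While programs. -/
inductive Program where
  | skip
  | instr (i : Instr)
  | seq (p q : Program)
  | ite (b : Test) (p q : Program)
  | loop (b : Test) (p : Program)

/-- `Exec p s s' t`: started in the state `s`, the program `p` halts in the state `s'` after exactly `t`
steps.  Every elementary instruction and every evaluation of a test is one step. -/
inductive Exec : Program → State → State → ℕ → Prop where
  | skip (s : State) : Exec .skip s s 1
  | instr (i : Instr) (s : State) : Exec (.instr i) s (i.apply s) 1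
  | seq {p q : Program} {s s' s'' : State} {t t' : ℕ} :
      Exec p s s' t → Exec q s' s'' t' → Exec (.seq p q) s s'' (t + t')
  | iteTrue {b : Test} {p q : Program} {s s' : State} {t : ℕ} :
      b.Holds s → Exec p s s' t → Exec (.ite b p q) s s' (t + 1)
  | iteFalse {b : Test} {p q : Program} {s s' : State} {t : ℕ} :
      ¬ b.Holds s → Exec q s s' t → Exec (.ite b p q) s s' (t + 1)
  | loopTrue {b : Test} {p : Program} {s s' s'' : State} {t t' : ℕ} :
      b.Holds s → Exec p s s' t → Exec (.loop b p) s' s'' t' → Exec (.loop b p) s s'' (t + t' + 1)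
  | loopFalse {b : Test} {p : Program} {s : State} :
      ¬ b.Holds s → Exec (.loop b p) s s 1

/-- The law of an infinite sequence of independent fair coin tosses. -/
noncomputable def coinLaw : MeasureTheory.Measure (ℕ → Bool) :=
  MeasureTheory.Measure.infinitePi fun _ => (PMF.uniformOfFintype Bool).toMeasure

end RealRAM

/-! ## Local Hamiltonians on qubits -/

namespace QHam

open scoped ComplexOrder

/-- The basis states `{0,1}^n`; a state of `n` qubits is a function `Bits n → ℂ`. -/
abbrev Bits (n : ℕ) : Type := Fin n → Fin 2

/-- The operator `M_T = M|_T ⊗ Id` on `n` qubits, for a sequence `T` of `r` distinct qubits: its entry at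
`(x, y)` is `M (x|_T) (y|_T)` if `x` and `y` agree outside `T`, and `0` otherwise. -/
def localOp {r n : ℕ} (T : Fin r ↪ Fin n) (M : Matrix (Bits r) (Bits r) ℂ) :
    Matrix (Bits n) (Bits n) ℂ :=
  fun x y => if ∀ q, (∀ j, T j ≠ q) → x q = y q then M (fun j => x (T j)) (fun j => y (T j)) else 0

/-- The energy `⟨ψ, M_T ψ⟩` (a real number if `M` is Hermitian). -/
def energy {r n : ℕ} (T : Fin r ↪ Fin n) (M : Matrix (Bits r) (Bits r) ℂ) (ψ : Bits n → ℂ) : ℝ :=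
  (star ψ ⬝ᵥ (localOp T M).mulVec ψ).re

/-- An `r`-local Hamiltonian `{(T_i, M_i) : i ∈ [m]}` on `n` qubits with `m` terms. -/
structure Hamiltonian (r n m : ℕ) where
  /-- `T_i`, a sequence of `r` distinct qubits -/
  tuple : Fin m → (Fin r ↪ Fin n)
  /-- `M_i`, a positive semidefinite matrix of size `2^r` -/
  op : Fin m → Matrix (Bits r) (Bits r) ℂ
  psd : ∀ i, (op i).PosSemidef

variable {r n m : ℕ}

/-- Every matrix `M_i` has nullity at most `1`. -/
def Hamiltonian.NullityLeOne (H : Hamiltonian r n m) : Prop :=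
  ∀ i, Module.finrank ℂ (LinearMap.ker (H.op i).mulVecLin) ≤ 1

/-- The family `{M_i}` is `(C, ℓ₀)`-bounded: `0 < C < ∞`, the matrices are non-zero, no eigenvalue of
a matrix `M_i` exceeds `C`, and whenever at least one and at most `ℓ₀` members of the family are placed
on the hyperedges of some `r`-uniform hypergraph, one on each, no non-zero eigenvalue of the sum of the
resulting operators is smaller than `1 / C`.  Hyperedges are sequences of `r` distinct vertices
of `{0, …, k - 1}`.  Two members are placed on different hyperedges, except that parallel hyperedges are
admitted for two members that already act on one and the same sequence of qubits in `H`. -/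
def Hamiltonian.IsBounded (H : Hamiltonian r n m) (C : ℝ) (ℓ₀ : ℕ) : Prop :=
  0 < C ∧ (∀ i, H.op i ≠ 0) ∧
  (∀ i, ∀ μ ∈ spectrum ℝ (H.op i), μ ≤ C) ∧
  ∀ S : Finset (Fin m), S.Nonempty → S.card ≤ ℓ₀ →
    ∀ (k : ℕ) (e : Fin m → (Fin r ↪ Fin k)),
      (∀ i ∈ S, ∀ j ∈ S, e i = e j → H.tuple i = H.tuple j) →
      ∀ μ ∈ spectrum ℝ (∑ i ∈ S, localOp (e i) (H.op i)), μ ≠ 0 → 1 / C ≤ μ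

/-- `w` is an `ε`-sparsifier of `H`. -/
def Hamiltonian.IsSparsifier (H : Hamiltonian r n m) (ε : ℝ) (w : Fin m → ℝ) : Prop :=
  (∀ i, 0 ≤ w i) ∧ ∀ ψ : Bits n → ℂ,
    (1 - ε) * ∑ i, energy (H.tuple i) (H.op i) ψ ≤ ∑ i, w i * energy (H.tuple i) (H.op i) ψ ∧
    ∑ i, w i * energy (H.tuple i) (H.op i) ψ ≤ (1 + ε) * ∑ i, energy (H.tuple i) (H.op i) ψ

/-- The size of a weight function: the cardinality of its support. -/
noncomputable def size (w : Fin m → ℝ) : ℕ := {i | 0 < w i}.ncard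

/-- The qubit sequences as an integer array: `T_i(j)` stands at position `i * r + j`. -/
def Hamiltonian.tupleArray (H : Hamiltonian r n m) (p : ℕ) : ℕ :=
  if h : p < m * r then
    let q := finProdFinEquiv.symm ⟨p, h⟩
    (H.tuple q.1 q.2 : ℕ)
  else 0

/-- The matrices as an array: the entry of `M_i` in row `a` and column `b` (rows and columns numbered
from `0` to `2^r - 1` in binary, the bit of qubit `j` having weight `2^j`) stands at position `i * (2^r * 2^r) + a * 2^r + b`. -/
def Hamiltonian.entryArray (H : Hamiltonian r n m) (p : ℕ) : ℂ :=
  if h : p < m * (2 ^ r * 2 ^ r) then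
    let q := finProdFinEquiv.symm ⟨p, h⟩
    let ab := finProdFinEquiv.symm q.2
    H.op q.1 (finFunctionFinEquiv.symm ab.1) (finFunctionFinEquiv.symm ab.2)
  else 0

/-- The initial state of a program: the integer variables `0, 1` hold `n, m`, the real variables `0, 1` hold
`C, ε`, the integer array `0` holds the qubit sequences, the real arrays `0, 1` hold the real and
the imaginary parts of the matrix entries, and everything else is `0`. -/
noncomputable def Hamiltonian.input (H : Hamiltonian r n m) (C ε : ℝ) (ω : ℕ → Bool) :
    RealRAM.State where
  natVar x := if x = 0 then n else if x = 1 then m else 0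
  realVar x := if x = 0 then C else if x = 1 then ε else 0
  natArr A p := if A = 0 then H.tupleArray p else 0
  realArr A p := if A = 0 then (H.entryArray p).re else if A = 1 then (H.entryArray p).im else 0
  coins := ω

/-- The output of a program: the first `m` entries of the real array `2`. -/
def output (m : ℕ) (s : RealRAM.State) : Fin m → ℝ := fun i => s.realArr 2 i

end QHam

/-! ## The Lie–Trotter formula and the Golden–Thompson inequality -/

namespace NormedSpace

open Filter Topology

/-- A telescoping bound for the difference of two powers. -/
theorem norm_pow_sub_pow_le {R : Type*} [NormedRing R] [NormOneClass R] {x y : R} {b : ℝ}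
    (hx : ‖x‖ ≤ b) (hy : ‖y‖ ≤ b) (hb : 1 ≤ b) (N : ℕ) :
    ‖x ^ N - y ^ N‖ ≤ N * ‖x - y‖ * b ^ N := by
  induction N with
  | zero => simp
  | succ N ih =>
    have hb0 : 0 ≤ b := zero_le_one.trans hb
    have h : x ^ (N + 1) - y ^ (N + 1) = (x ^ N - y ^ N) * x + y ^ N * (x - y) := by
      rw [pow_succ, pow_succ]; noncomm_ring
    have h1 : ‖y ^ N‖ ≤ b ^ N := (norm_pow_le y N).trans (pow_le_pow_left₀ (norm_nonneg _) hy N)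
    calc ‖x ^ (N + 1) - y ^ (N + 1)‖ ≤ ‖x ^ N - y ^ N‖ * ‖x‖ + ‖y ^ N‖ * ‖x - y‖ := by
          rw [h]; exact (norm_add_le _ _).trans (add_le_add (norm_mul_le _ _) (norm_mul_le _ _))
      _ ≤ (N * ‖x - y‖ * b ^ N) * b + b ^ (N + 1) * ‖x - y‖ := by
          gcongr
          exact h1.trans (pow_le_pow_right₀ hb (Nat.le_succ N))
      _ = _ := by push_cast; ring

/-- The Lie–Trotter product formula. -/
theorem tendsto_exp_mul_exp_pow {𝔸 : Type*} [NormedRing 𝔸] [NormOneClass 𝔸] [NormedAlgebra ℝ 𝔸]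
    [NormedAlgebra ℚ 𝔸] [CompleteSpace 𝔸] (A B : 𝔸) :
    Tendsto (fun N : ℕ => (exp ((N : ℝ)⁻¹ • A) * exp ((N : ℝ)⁻¹ • B)) ^ N) atTop
      (𝓝 (exp (A + B))) := by
  have hA := hasDerivAt_exp_smul_const A (0 : ℝ)
  have hB := hasDerivAt_exp_smul_const B (0 : ℝ)
  have hX := hA.mul hB
  have hY := hasDerivAt_exp_smul_const (A + B) (0 : ℝ)
  have hf := hX.sub hY
  have hN : Tendsto (fun N : ℕ => (N : ℝ)⁻¹) atTop (𝓝 0) := tendsto_inv_atTop_nhds_zero_nat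
  have bound : ∀ {f : ℝ → 𝔸} {f' : 𝔸}, HasDerivAt f f' 0 → f 0 = 1 →
      ∃ c : ℝ, 0 ≤ c ∧ ∀ᶠ N : ℕ in atTop, ‖f (N : ℝ)⁻¹‖ ≤ 1 + c * (N : ℝ)⁻¹ := by
    intro f f' hd h0
    obtain ⟨c, hc, hO⟩ := hd.isBigO_sub.exists_pos
    refine ⟨c, hc.le, ?_⟩
    filter_upwards [hN.eventually hO.bound] with N h
    rw [h0] at h
    have h2 : ‖f (N : ℝ)⁻¹‖ ≤ ‖(1 : 𝔸)‖ + ‖f (N : ℝ)⁻¹ - 1‖ := norm_le_insert' _ _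
    have h3 : ‖(N : ℝ)⁻¹ - 0‖ = (N : ℝ)⁻¹ := by
      rw [sub_zero, Real.norm_of_nonneg (by positivity)]
    rw [h3] at h
    rw [norm_one] at h2
    linarith
  obtain ⟨c₁, hc₁, h₁⟩ := bound hX (by simp)
  obtain ⟨c₂, hc₂, h₂⟩ := bound hY (by simp)
  have hsmall : Tendsto (fun N : ℕ => (N : ℝ) *
      ‖exp ((N : ℝ)⁻¹ • A) * exp ((N : ℝ)⁻¹ • B) - exp ((N : ℝ)⁻¹ • (A + B))‖) atTop (𝓝 0) := by
    have hl : (fun t : ℝ => exp (t • A) * exp (t • B) - exp (t • (A + B))) =o[𝓝 0] fun t => t := by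
      have := hf.isLittleO
      simpa using this
    have h2 := (hl.comp_tendsto hN).norm_left.tendsto_div_nhds_zero
    refine h2.congr fun N => ?_
    simp only [Function.comp, div_inv_eq_mul]
    ring
  have hpow : ∀ᶠ N : ℕ in atTop, exp ((N : ℝ)⁻¹ • (A + B)) ^ N = exp (A + B) := by
    filter_upwards [eventually_gt_atTop 0] with N hN0
    rw [← exp_nsmul, ← Nat.cast_smul_eq_nsmul ℝ, smul_smul,
      mul_inv_cancel₀ (by positivity), one_smul]
  rw [tendsto_iff_norm_sub_tendsto_zero]
  have hlim := hsmall.mul_const (Real.exp (max c₁ c₂))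
  rw [zero_mul] at hlim
  refine squeeze_zero' (Eventually.of_forall fun _ => norm_nonneg _) ?_ hlim
  filter_upwards [h₁, h₂, hpow, eventually_gt_atTop 0] with N e₁ e₂ e₃ hN0
  rw [← e₃]
  have hNpos : (0 : ℝ) < N := by exact_mod_cast hN0
  have hle : ∀ c, c ≤ max c₁ c₂ → 1 + c * (N : ℝ)⁻¹ ≤ Real.exp (max c₁ c₂ * (N : ℝ)⁻¹) := by
    intro c hc
    have := Real.add_one_le_exp (max c₁ c₂ * (N : ℝ)⁻¹)
    have h4 : c * (N : ℝ)⁻¹ ≤ max c₁ c₂ * (N : ℝ)⁻¹ := by gcongr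
    linarith
  have hb := norm_pow_sub_pow_le (e₁.trans (hle _ (le_max_left _ _)))
    (e₂.trans (hle _ (le_max_right _ _))) (Real.one_le_exp (by positivity)) N
  have h5 : Real.exp (max c₁ c₂ * (N : ℝ)⁻¹) ^ N = Real.exp (max c₁ c₂) := by
    rw [← Real.exp_nat_mul]; congr 1; field_simp
  rwa [h5] at hb

end NormedSpace

namespace Matrix

open Filter Topology NormedSpace

variable {d : Type*} [Fintype d] [DecidableEq d]

theorem norm_trace_mul_le (A B : Matrix d d ℂ) :
    ‖(A * B).trace‖ ≤ ((A * Aᴴ).trace.re + (Bᴴ * B).trace.re) / 2 := by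
  have hA : (A * Aᴴ).trace.re = ∑ i, ∑ j, ‖A i j‖ ^ 2 := by
    simp only [trace, diag, mul_apply, conjTranspose_apply, Complex.re_sum]
    refine Finset.sum_congr rfl fun i _ => Finset.sum_congr rfl fun j _ => ?_
    rw [Complex.star_def, Complex.mul_conj, Complex.ofReal_re, Complex.normSq_eq_norm_sq]
  have hB : (Bᴴ * B).trace.re = ∑ i, ∑ j, ‖B j i‖ ^ 2 := by
    simp only [trace, diag, mul_apply, conjTranspose_apply, Complex.re_sum]
    refine Finset.sum_congr rfl fun i _ => Finset.sum_congr rfl fun j _ => ?_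
    rw [Complex.star_def, mul_comm, Complex.mul_conj, Complex.ofReal_re, Complex.normSq_eq_norm_sq]
  rw [hA, hB, ← Finset.sum_add_distrib, Finset.sum_div]
  simp only [trace, diag, mul_apply]
  refine (norm_sum_le _ _).trans (Finset.sum_le_sum fun i _ => ?_)
  rw [← Finset.sum_add_distrib, Finset.sum_div]
  refine (norm_sum_le _ _).trans (Finset.sum_le_sum fun j _ => ?_)
  rw [norm_mul]
  nlinarith [sq_nonneg (‖A i j‖ - ‖B j i‖)]

theorem mul_pow_succ_eq (A B : Matrix d d ℂ) (m : ℕ) : (A * B) ^ (m + 1) = A * (B * A) ^ m * B := by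
  induction m with
  | zero => simp
  | succ m ih => rw [pow_succ, ih, pow_succ (B * A)]; simp only [Matrix.mul_assoc]

theorem trace_mul_pow_comm (A B : Matrix d d ℂ) (m : ℕ) :
    ((A * B) ^ m).trace = ((B * A) ^ m).trace := by
  cases m with
  | zero => simp
  | succ m => rw [mul_pow_succ_eq, Matrix.mul_assoc, trace_mul_comm, Matrix.mul_assoc, ← pow_succ]

theorem trace_pow_two_pow_aux (k : ℕ) :
    (∀ X : Matrix d d ℂ, ‖(X ^ 2 ^ (k + 1)).trace‖ ≤ ((X * Xᴴ) ^ 2 ^ k).trace.re) ∧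
    (∀ P Q : Matrix d d ℂ, P.IsHermitian → Q.IsHermitian →
      ‖((P * Q) ^ 2 ^ k).trace‖ ≤ ‖(P ^ 2 ^ k * Q ^ 2 ^ k).trace‖) := by
  induction k with
  | zero =>
    refine ⟨fun X => ?_, fun P Q _ _ => by simp⟩
    have h := norm_trace_mul_le X X
    rw [trace_mul_comm Xᴴ X] at h
    simp only [zero_add, pow_one, pow_zero, pow_two]
    linarith
  | succ k ih =>
    obtain ⟨ha, hb⟩ := ih
    refine ⟨fun X => ?_, fun P Q hP hQ => ?_⟩
    · have h1 : (X * Xᴴ).IsHermitian := isHermitian_mul_conjTranspose_self X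
      have h2 : (Xᴴ * X).IsHermitian := isHermitian_conjTranspose_mul_self X
      have e1 : X ^ 2 ^ (k + 1 + 1) = (X ^ 2) ^ 2 ^ (k + 1) := by
        rw [← pow_mul, pow_succ 2 (k + 1), mul_comm]
      have e2 : ((X ^ 2 * (X ^ 2)ᴴ) ^ 2 ^ k).trace = (((X * Xᴴ) * (Xᴴ * X)) ^ 2 ^ k).trace := by
        have : X ^ 2 * (X ^ 2)ᴴ = X * (X * Xᴴ * Xᴴ) := by
          rw [pow_two, conjTranspose_mul]; simp only [Matrix.mul_assoc]
        rw [this, trace_mul_pow_comm]; simp only [Matrix.mul_assoc]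
      have e3 := norm_trace_mul_le ((X * Xᴴ) ^ 2 ^ k) ((Xᴴ * X) ^ 2 ^ k)
      rw [(h1.pow _).eq, (h2.pow _).eq, ← pow_add, ← pow_add, ← two_mul, ← pow_succ',
        trace_mul_pow_comm Xᴴ X] at e3
      rw [e1]
      refine (ha (X ^ 2)).trans ?_
      rw [e2]
      refine (Complex.re_le_norm _).trans ((hb _ _ h1 h2).trans (e3.trans ?_))
      linarith
    · refine (ha (P * Q)).trans ((Complex.re_le_norm _).trans ?_)
      have e : (((P * Q) * (P * Q)ᴴ) ^ 2 ^ k).trace = ((P ^ 2 * Q ^ 2) ^ 2 ^ k).trace := by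
        have : (P * Q) * (P * Q)ᴴ = P * (Q * Q * P) := by
          rw [conjTranspose_mul, hP.eq, hQ.eq]; simp only [Matrix.mul_assoc]
        rw [this, trace_mul_pow_comm, pow_two P, pow_two Q, trace_mul_pow_comm (P * P)]
        simp only [Matrix.mul_assoc]
      rw [e]
      have := hb (P ^ 2) (Q ^ 2) (hP.pow 2) (hQ.pow 2)
      rwa [← pow_mul, ← pow_mul, ← pow_succ'] at this

attribute [local instance] Matrix.linftyOpNormedRing Matrix.linftyOpNormedAlgebra

/-- The Golden–Thompson inequality. -/
theorem norm_trace_exp_add_le [Nonempty d] {A B : Matrix d d ℂ} (hA : A.IsHermitian)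
    (hB : B.IsHermitian) : ‖(exp (A + B)).trace‖ ≤ ‖(exp A * exp B).trace‖ := by
  have : NormOneClass (Matrix d d ℂ) := Matrix.linfty_opNormOneClass
  have ht := (tendsto_exp_mul_exp_pow A B).comp (tendsto_pow_atTop_atTop_of_one_lt one_lt_two)
  have hc : Continuous fun M : Matrix d d ℂ => ‖M.trace‖ := by fun_prop
  refine le_of_tendsto ((hc.tendsto _).comp ht) (Eventually.of_forall fun k => ?_)
  have hs : ∀ {M : Matrix d d ℂ}, M.IsHermitian →
      (exp ((((2 ^ k : ℕ) : ℝ))⁻¹ • M)).IsHermitian ∧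
      exp ((((2 ^ k : ℕ) : ℝ))⁻¹ • M) ^ 2 ^ k = exp M := by
    intro M hM
    refine ⟨IsHermitian.exp (hM.smul (by rw [isSelfAdjoint_iff]; simp)), ?_⟩
    rw [← Matrix.exp_nsmul, ← Nat.cast_smul_eq_nsmul ℝ, smul_smul,
      mul_inv_cancel₀ (by positivity), one_smul]
  have h := (trace_pow_two_pow_aux k).2 _ _ (hs hA).1 (hs hB).1
  rw [(hs hA).2, (hs hB).2] at h
  exact h

end Matrix

/-! ## Quadratic forms and the spectral theorem -/

namespace Matrix


open scoped ComplexOrder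

section QuadForm

variable {d : Type*} [Fintype d]

/-- The real quadratic form `⟨ψ, A ψ⟩`. -/
noncomputable def quadForm (A : Matrix d d ℂ) (ψ : d → ℂ) : ℝ := (star ψ ⬝ᵥ A.mulVec ψ).re

theorem quadForm_add (A B : Matrix d d ℂ) (ψ : d → ℂ) :
    quadForm (A + B) ψ = quadForm A ψ + quadForm B ψ := by
  simp [quadForm, add_mulVec, dotProduct_add]

theorem quadForm_sub (A B : Matrix d d ℂ) (ψ : d → ℂ) :
    quadForm (A - B) ψ = quadForm A ψ - quadForm B ψ := by
  simp [quadForm, sub_mulVec, dotProduct_sub]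

theorem quadForm_smul (c : ℝ) (A : Matrix d d ℂ) (ψ : d → ℂ) :
    quadForm (c • A) ψ = c * quadForm A ψ := by
  simp [quadForm, smul_mulVec, dotProduct_smul]

theorem quadForm_sum {ι : Type*} (s : Finset ι) (A : ι → Matrix d d ℂ) (ψ : d → ℂ) :
    quadForm (∑ i ∈ s, A i) ψ = ∑ i ∈ s, quadForm (A i) ψ := by
  simp [quadForm, sum_mulVec, dotProduct_sum]

theorem quadForm_zero (ψ : d → ℂ) : quadForm (0 : Matrix d d ℂ) ψ = 0 := by
  simp [quadForm]

theorem quadForm_conj (A C : Matrix d d ℂ) (ψ : d → ℂ) :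
    quadForm (Cᴴ * A * C) ψ = quadForm A (C *ᵥ ψ) := by
  simp only [quadForm, star_mulVec, ← mulVec_mulVec, dotProduct_mulVec, vecMul_vecMul]

theorem PosSemidef.quadForm_nonneg {A : Matrix d d ℂ} (hA : A.PosSemidef) (ψ : d → ℂ) :
    0 ≤ quadForm A ψ :=
  hA.re_dotProduct_nonneg ψ

theorem IsHermitian.posSemidef_of_quadForm {A : Matrix d d ℂ} (hA : A.IsHermitian)
    (h : ∀ ψ, 0 ≤ quadForm A ψ) : A.PosSemidef :=
  .of_dotProduct_mulVec_nonneg hA fun ψ => by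
    rw [Complex.nonneg_iff]
    exact ⟨h ψ, (hA.im_star_dotProduct_mulVec_self ψ).symm⟩

theorem IsHermitian.real_smul {A : Matrix d d ℂ} (hA : A.IsHermitian) (c : ℝ) :
    (c • A).IsHermitian :=
  hA.smul (by rw [isSelfAdjoint_iff]; simp)

theorem PosSemidef.real_smul {A : Matrix d d ℂ} (hA : A.PosSemidef) {c : ℝ} (hc : 0 ≤ c) :
    (c • A).PosSemidef :=
  (hA.1.real_smul c).posSemidef_of_quadForm fun ψ => by
    rw [quadForm_smul]; exact mul_nonneg hc (hA.quadForm_nonneg ψ)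

variable [DecidableEq d]

theorem quadForm_one (ψ : d → ℂ) : quadForm 1 ψ = ∑ i, ‖ψ i‖ ^ 2 := by
  simp only [quadForm, one_mulVec, dotProduct, Complex.re_sum, Pi.star_apply]
  refine Finset.sum_congr rfl fun i _ => ?_
  rw [Complex.star_def, mul_comm, Complex.mul_conj, Complex.ofReal_re, Complex.normSq_eq_norm_sq]

theorem quadForm_one_nonneg (ψ : d → ℂ) : 0 ≤ quadForm 1 ψ := by
  rw [quadForm_one]; positivity

/-- `f(A)` for a Hermitian matrix `A`. -/
noncomputable def IsHermitian.fn {A : Matrix d d ℂ} (hA : A.IsHermitian) (f : ℝ → ℝ) :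
    Matrix d d ℂ :=
  hA.eigenvectorUnitary.1 * diagonal (fun i => (f (hA.eigenvalues i) : ℂ)) *
    hA.eigenvectorUnitary.1ᴴ

namespace IsHermitian

variable {A : Matrix d d ℂ} (hA : A.IsHermitian)

theorem eigenvectorUnitary_mul_conjTranspose :
    hA.eigenvectorUnitary.1 * hA.eigenvectorUnitary.1ᴴ = 1 :=
  Unitary.mul_star_self_of_mem hA.eigenvectorUnitary.2

theorem conjTranspose_mul_eigenvectorUnitary :
    hA.eigenvectorUnitary.1ᴴ * hA.eigenvectorUnitary.1 = 1 :=
  Unitary.star_mul_self_of_mem hA.eigenvectorUnitary.2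

theorem fn_id : hA.fn (fun x => x) = A := by
  conv_rhs => rw [hA.spectral_theorem]
  rw [Unitary.conjStarAlgAut_apply]
  rfl

theorem fn_one : hA.fn (fun _ => 1) = 1 := by
  simp [fn, eigenvectorUnitary_mul_conjTranspose]

theorem fn_add (f g : ℝ → ℝ) : hA.fn (fun x => f x + g x) = hA.fn f + hA.fn g := by
  simp only [fn, Complex.ofReal_add, ← diagonal_add, Matrix.mul_add, Matrix.add_mul]

theorem fn_sub (f g : ℝ → ℝ) : hA.fn (fun x => f x - g x) = hA.fn f - hA.fn g := by
  simp only [fn, Complex.ofReal_sub, ← diagonal_sub, Matrix.mul_sub, Matrix.sub_mul]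

theorem fn_smul (c : ℝ) (f : ℝ → ℝ) : hA.fn (fun x => c * f x) = c • hA.fn f := by
  have : diagonal (fun i => ((c * f (hA.eigenvalues i) : ℝ) : ℂ)) =
      c • diagonal (fun i => (f (hA.eigenvalues i) : ℂ)) := by
    rw [← diagonal_smul]; congr 1; ext i; simp
  simp only [fn, this, Matrix.mul_smul, Matrix.smul_mul]

theorem fn_mul (f g : ℝ → ℝ) : hA.fn (fun x => f x * g x) = hA.fn f * hA.fn g := by
  have h := hA.conjTranspose_mul_eigenvectorUnitary
  simp only [fn]
  rw [show ∀ U D E V : Matrix d d ℂ, U * D * V * (U * E * V) = U * (D * (V * U) * E) * V by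
    intros; simp only [Matrix.mul_assoc], h, Matrix.mul_one, diagonal_mul_diagonal]
  simp

attribute [local instance] Matrix.linftyOpNormedRing Matrix.linftyOpNormedAlgebra in
theorem fn_exp : hA.fn Real.exp = NormedSpace.exp A := by
  have h1 := hA.conjTranspose_mul_eigenvectorUnitary
  have hinv : hA.eigenvectorUnitary.1⁻¹ = hA.eigenvectorUnitary.1ᴴ := inv_eq_left_inv h1
  have hu : IsUnit hA.eigenvectorUnitary.1 :=
    (isUnit_iff_isUnit_det _).2 (isUnit_det_of_left_inverse h1)
  conv_rhs => rw [← hA.fn_id]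
  simp only [fn]
  rw [← hinv, Matrix.exp_conj _ _ hu, Matrix.exp_diagonal]
  congr 3
  funext i
  rw [Pi.coe_exp, Complex.ofReal_exp, Complex.exp_eq_exp_ℂ]

theorem fn_posSemidef {f : ℝ → ℝ} (hf : ∀ i, 0 ≤ f (hA.eigenvalues i)) :
    (hA.fn f).PosSemidef := by
  refine PosSemidef.mul_mul_conjTranspose_same (PosSemidef.diagonal fun i => ?_) _
  simpa using hf i

theorem trace_fn (f : ℝ → ℝ) : (hA.fn f).trace.re = ∑ i, f (hA.eigenvalues i) := by
  rw [fn, trace_mul_comm, ← Matrix.mul_assoc, conjTranspose_mul_eigenvectorUnitary, Matrix.one_mul,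
    trace_diagonal, ← Complex.ofReal_sum, Complex.ofReal_re]

theorem exists_quadForm_eq_eigenvalue (i : d) :
    ∃ ψ : d → ℂ, quadForm 1 ψ = 1 ∧ quadForm A ψ = hA.eigenvalues i := by
  refine ⟨⇑(hA.eigenvectorBasis i), ?_, (hA.eigenvalues_eq i).symm⟩
  rw [quadForm_one, ← EuclideanSpace.norm_sq_eq, hA.eigenvectorBasis.orthonormal.1 i, one_pow]

theorem eigenvalues_le {b : ℝ} (h : ∀ ψ, quadForm A ψ ≤ b * quadForm 1 ψ) (i : d) :
    hA.eigenvalues i ≤ b := by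
  obtain ⟨ψ, h1, h2⟩ := hA.exists_quadForm_eq_eigenvalue i
  simpa [h1, h2] using h ψ

theorem le_eigenvalues {b : ℝ} (h : ∀ ψ, b * quadForm 1 ψ ≤ quadForm A ψ) (i : d) :
    b ≤ hA.eigenvalues i := by
  obtain ⟨ψ, h1, h2⟩ := hA.exists_quadForm_eq_eigenvalue i
  simpa [h1, h2] using h ψ

theorem quadForm_le_of_eigenvalues {b : ℝ} (h : ∀ i, hA.eigenvalues i ≤ b) (ψ : d → ℂ) :
    quadForm A ψ ≤ b * quadForm 1 ψ := by
  have := (hA.fn_posSemidef (f := fun x => b * 1 - x) fun i => by linarith [h i]).quadForm_nonneg ψ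
  rw [hA.fn_sub, hA.fn_smul, fn_one, fn_id, quadForm_sub, quadForm_smul] at this
  linarith

end IsHermitian

theorem IsHermitian.exp_posSemidef {A : Matrix d d ℂ} (hA : A.IsHermitian) :
    (NormedSpace.exp A).PosSemidef := by
  rw [← hA.fn_exp]; exact hA.fn_posSemidef fun i => (Real.exp_pos _).le

/-- The trace of `exp A` dominates the exponential of every value of the Rayleigh quotient. -/
theorem IsHermitian.exp_le_trace_exp {A : Matrix d d ℂ} (hA : A.IsHermitian) {b : ℝ}
    (h : ∃ ψ, b * quadForm 1 ψ < quadForm A ψ) : Real.exp b ≤ (NormedSpace.exp A).trace.re := by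
  obtain ⟨ψ, hψ⟩ := h
  have : ∃ i, b < hA.eigenvalues i := by
    by_contra! hc
    exact absurd (hA.quadForm_le_of_eigenvalues hc ψ) (not_le.2 hψ)
  obtain ⟨i, hi⟩ := this
  rw [← hA.fn_exp, hA.trace_fn]
  exact (Real.exp_le_exp.2 hi.le).trans
    (Finset.single_le_sum (f := fun i => Real.exp (hA.eigenvalues i))
      (fun _ _ => (Real.exp_pos _).le) (Finset.mem_univ i))

theorem IsHermitian.exp_le_quadratic {Y : Matrix d d ℂ} (hY : Y.IsHermitian)
    (hu : ∀ ψ, quadForm Y ψ ≤ quadForm 1 ψ) (hl : ∀ ψ, -quadForm 1 ψ ≤ quadForm Y ψ) (ψ : d → ℂ) :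
    quadForm (NormedSpace.exp Y) ψ ≤ quadForm 1 ψ + quadForm Y ψ + quadForm (Y * Y) ψ := by
  have h := (hY.fn_posSemidef (f := fun x => 1 + x + x * x - Real.exp x) fun i => by
    have h1 := hY.eigenvalues_le (b := 1) (by simpa using hu) i
    have h2 := hY.le_eigenvalues (b := -1) (by simpa using hl) i
    have h3 := abs_le.1 (Real.abs_exp_sub_one_sub_id_le (abs_le.2 ⟨h2, h1⟩))
    nlinarith [h3.2]).quadForm_nonneg ψ
  rw [hY.fn_sub, hY.fn_exp, hY.fn_add, hY.fn_mul, hY.fn_add, hY.fn_one, hY.fn_id, quadForm_sub,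
    quadForm_add, quadForm_add] at h
  linarith

theorem PosSemidef.quadForm_mul_self_le {X : Matrix d d ℂ} (hX : X.PosSemidef) {P : ℝ}
    (hu : ∀ ψ, quadForm X ψ ≤ P * quadForm 1 ψ) (ψ : d → ℂ) :
    quadForm (X * X) ψ ≤ P * quadForm X ψ := by
  have h := (hX.1.fn_posSemidef (f := fun x => P * x - x * x) fun i => by
    have h1 := hX.1.eigenvalues_le hu i
    nlinarith [hX.eigenvalues_nonneg i]).quadForm_nonneg ψ
  rw [hX.1.fn_sub, hX.1.fn_smul P (fun x => x), hX.1.fn_mul, hX.1.fn_id, quadForm_sub, quadForm_smul] at h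
  linarith

theorem PosSemidef.exists_eq_conjTranspose_mul_self {A : Matrix d d ℂ} (hA : A.PosSemidef) :
    ∃ B : Matrix d d ℂ, A = Bᴴ * B := by
  open scoped MatrixOrder in
  obtain ⟨y, h⟩ := CStarAlgebra.nonneg_iff_eq_star_mul_self.mp hA.nonneg
  exact ⟨y, h⟩

theorem PosSemidef.trace_mul_nonneg {A B : Matrix d d ℂ} (hA : A.PosSemidef) (hB : B.PosSemidef) :
    0 ≤ (A * B).trace := by
  obtain ⟨C, rfl⟩ := hA.exists_eq_conjTranspose_mul_self
  rw [Matrix.mul_assoc, trace_mul_comm]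
  exact (hB.mul_mul_conjTranspose_same C).trace_nonneg

end QuadForm

end Matrix

/-! ## Concentration of sums of independent random matrices -/

namespace Matrix

open scoped ComplexOrder

variable {d α : Type*} [Fintype d] [DecidableEq d] [Fintype α]

theorem isHermitian_sum {ι : Type*} (s : Finset ι) {Y : ι → Matrix d d ℂ}
    (hY : ∀ i, (Y i).IsHermitian) : (∑ i ∈ s, Y i).IsHermitian := by
  rw [IsHermitian, conjTranspose_sum]
  exact Finset.sum_congr rfl fun i _ => hY i

theorem PosSemidef.trace_re_nonneg {A : Matrix d d ℂ} (hA : A.PosSemidef) : 0 ≤ A.trace.re :=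
  (Complex.nonneg_iff.1 hA.trace_nonneg).1

theorem sum_trace_exp_le [Nonempty d] {Y : α → Matrix d d ℂ} (hY : ∀ u, (Y u).IsHermitian)
    (hu : ∀ u ψ, quadForm (Y u) ψ ≤ quadForm 1 ψ) (hl : ∀ u ψ, -quadForm 1 ψ ≤ quadForm (Y u) ψ)
    (h0 : ∑ u, Y u = 0) {ρ : ℝ}
    (h2 : ∀ ψ, ∑ u, quadForm (Y u * Y u) ψ ≤ Fintype.card α * (ρ * quadForm 1 ψ)) (N : ℕ)
    (hρ : 0 ≤ ρ) :
    ∑ f : Fin N → α, (NormedSpace.exp (∑ k, Y (f k))).trace.re ≤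
      Fintype.card d * (Fintype.card α * (1 + ρ)) ^ N := by
  induction N with
  | zero => simp
  | succ N ih =>
    have key : ∀ S : Matrix d d ℂ, S.IsHermitian →
        ∑ u, (NormedSpace.exp (Y u + S)).trace.re ≤
          (Fintype.card α * (1 + ρ)) * (NormedSpace.exp S).trace.re := by
      intro S hS
      have hE := hS.exp_posSemidef
      have h1 : ∀ u, (NormedSpace.exp (Y u + S)).trace.re ≤
          (NormedSpace.exp S * NormedSpace.exp (Y u)).trace.re := by
        intro u
        have hn := hE.trace_mul_nonneg (hY u).exp_posSemidef
        rw [add_comm]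
        refine (Complex.re_le_norm _).trans ((norm_trace_exp_add_le hS (hY u)).trans ?_)
        exact (congrArg Complex.re (Complex.norm_of_nonneg' hn)).le
      refine (Finset.sum_le_sum fun u _ => h1 u).trans ?_
      have hP : ((Fintype.card α * (1 + ρ) : ℝ) • (1 : Matrix d d ℂ) -
          ∑ u, NormedSpace.exp (Y u)).PosSemidef := by
        refine IsHermitian.posSemidef_of_quadForm ((isHermitian_one.real_smul _).sub
          (isHermitian_sum _ fun u => (hY u).exp)) fun ψ => ?_
        rw [quadForm_sub, quadForm_smul, quadForm_sum]
        have h3 := Finset.sum_le_sum fun u (_ : u ∈ Finset.univ) =>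
          (hY u).exp_le_quadratic (hu u) (hl u) ψ
        rw [Finset.sum_add_distrib, Finset.sum_add_distrib, ← quadForm_sum _ Y, h0,
          quadForm_zero, Finset.sum_const, Finset.card_univ, nsmul_eq_mul] at h3
        linarith [h2 ψ]
      have h4 := (Complex.nonneg_iff.1 (hE.trace_mul_nonneg hP)).1
      rw [Matrix.mul_sub, Matrix.mul_smul, Matrix.mul_one, trace_sub, trace_smul, Complex.sub_re,
        Complex.smul_re, Finset.mul_sum, trace_sum, Complex.re_sum, smul_eq_mul] at h4
      linarith
    rw [← (Fin.consEquiv fun _ => α).sum_comp, Fintype.sum_prod_type_right]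
    simp only [Fin.consEquiv_apply, Fin.sum_univ_succ, Fin.cons_zero, Fin.cons_succ]
    calc ∑ f : Fin N → α, ∑ u, (NormedSpace.exp (Y u + ∑ k, Y (f k))).trace.re
        ≤ ∑ f : Fin N → α, (Fintype.card α * (1 + ρ)) *
            (NormedSpace.exp (∑ k, Y (f k))).trace.re :=
          Finset.sum_le_sum fun f _ => key _ (isHermitian_sum _ fun k => hY _)
      _ ≤ (Fintype.card α * (1 + ρ)) * (Fintype.card d * (Fintype.card α * (1 + ρ)) ^ N) := by
          rw [← Finset.mul_sum]; gcongr
      _ = _ := by ring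

theorem card_filter_mul_le {β : Type*} [Fintype β] {p : β → Prop} [DecidablePred p] {g : β → ℝ}
    {c : ℝ} (hp : ∀ f, p f → c ≤ g f) (hg : ∀ f, 0 ≤ g f) :
    (Finset.card {f : β | p f} : ℝ) * c ≤ ∑ f, g f := by
  rw [← nsmul_eq_mul, ← Finset.sum_const]
  exact (Finset.sum_le_sum fun f hf => hp f (Finset.mem_filter.1 hf).2).trans
    (Finset.sum_le_sum_of_subset_of_nonneg (Finset.filter_subset _ _) fun f _ _ => hg f)

open Classical in
/-- The upper tail of a sum of independent random matrices. -/
theorem card_upper_tail_le [Nonempty d] {Y : α → Matrix d d ℂ} (hY : ∀ u, (Y u).IsHermitian)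
    {P ε : ℝ} (hP : 1 ≤ P) (hε : 0 < ε) (hε1 : ε ≤ 1)
    (hu : ∀ u ψ, quadForm (Y u) ψ ≤ P * quadForm 1 ψ)
    (hl : ∀ u ψ, -(P * quadForm 1 ψ) ≤ quadForm (Y u) ψ) (h0 : ∑ u, Y u = 0)
    (h2 : ∀ ψ, ∑ u, quadForm (Y u * Y u) ψ ≤ Fintype.card α * (P * quadForm 1 ψ)) (N : ℕ) :
    (Finset.card {f : Fin N → α | ∃ ψ, N * ε * quadForm 1 ψ < quadForm (∑ k, Y (f k)) ψ} : ℝ) ≤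
      Fintype.card d * Fintype.card α ^ N * Real.exp (-(N * ε ^ 2 / (4 * P))) := by
  have hP0 : 0 < P := by linarith
  set θ : ℝ := ε / (2 * P) with hθ
  have hθ0 : 0 < θ := by positivity
  have hθP : θ * P ≤ 1 := by
    rw [hθ, div_mul_eq_mul_div, div_le_one (by positivity)]; nlinarith
  have hs : ∀ f : Fin N → α, ∑ k, θ • Y (f k) = θ • ∑ k, Y (f k) := fun f =>
    Finset.smul_sum.symm
  have hE := sum_trace_exp_le (Y := fun u => θ • Y u) (fun u => (hY u).real_smul θ)
    (fun u ψ => by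
      rw [quadForm_smul]
      calc θ * quadForm (Y u) ψ ≤ θ * (P * quadForm 1 ψ) := by gcongr; exact hu u ψ
        _ = (θ * P) * quadForm 1 ψ := by ring
        _ ≤ _ := mul_le_of_le_one_left (quadForm_one_nonneg ψ) hθP)
    (fun u ψ => by
      rw [quadForm_smul]
      have h1 : θ * -(P * quadForm 1 ψ) ≤ θ * quadForm (Y u) ψ := by gcongr; exact hl u ψ
      have h3 : (θ * P) * quadForm 1 ψ ≤ quadForm 1 ψ :=
        mul_le_of_le_one_left (quadForm_one_nonneg ψ) hθP
      linarith)
    (by rw [← Finset.smul_sum, h0, smul_zero]) (ρ := θ ^ 2 * P)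
    (fun ψ => by
      simp only [smul_mul_smul_comm, quadForm_smul, ← Finset.mul_sum]
      calc θ * θ * ∑ u, quadForm (Y u * Y u) ψ
          ≤ θ * θ * (Fintype.card α * (P * quadForm 1 ψ)) := by gcongr; exact h2 ψ
        _ = _ := by ring) N (by positivity)
  simp only [hs] at hE
  have hbad : (Finset.card {f : Fin N → α | ∃ ψ, N * ε * quadForm 1 ψ <
      quadForm (∑ k, Y (f k)) ψ} : ℝ) * Real.exp (θ * (N * ε)) ≤
      ∑ f : Fin N → α, (NormedSpace.exp (θ • ∑ k, Y (f k))).trace.re := by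
    refine card_filter_mul_le (fun f ⟨ψ, hψ⟩ => ?_) fun f => ?_
    · refine ((isHermitian_sum _ fun k => hY (f k)).real_smul θ).exp_le_trace_exp ⟨ψ, ?_⟩
      rw [quadForm_smul, mul_assoc]
      exact mul_lt_mul_of_pos_left hψ hθ0
    · have hf := (isHermitian_sum Finset.univ fun k => hY (f k)).real_smul θ
      exact hf.exp_posSemidef.trace_re_nonneg
  have h3 : (Fintype.card α * (1 + θ ^ 2 * P) : ℝ) ^ N ≤
      Fintype.card α ^ N * Real.exp (N * (θ ^ 2 * P)) := by
    rw [mul_pow, Real.exp_nat_mul]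
    gcongr
    linarith [Real.add_one_le_exp (θ ^ 2 * P)]
  have h4 : Real.exp (N * (θ ^ 2 * P)) =
      Real.exp (-(N * ε ^ 2 / (4 * P))) * Real.exp (θ * (N * ε)) := by
    rw [← Real.exp_add]; congr 1; rw [hθ]; field_simp; ring
  have h5 := hbad.trans (hE.trans (mul_le_mul_of_nonneg_left h3 (Nat.cast_nonneg _)))
  rw [h4] at h5
  refine le_of_mul_le_mul_right ?_ (Real.exp_pos (θ * (N * ε)))
  linarith

open Classical in
theorem card_deviation_le_of_posDef [Nonempty d] {M : α → Matrix d d ℂ}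
    (hM : ∀ u, (M u).PosSemidef) {H : Matrix d d ℂ} (hH : H.PosDef)
    (hsum : ∑ u, M u = (Fintype.card α : ℝ) • H) {P ε : ℝ} (hP : 1 ≤ P) (hε : 0 < ε) (hε1 : ε ≤ 1)
    (hMH : ∀ u ψ, quadForm (M u) ψ ≤ P * quadForm H ψ) (N : ℕ) :
    (Finset.card {f : Fin N → α | ∃ ψ, N * ε * quadForm H ψ <
        |∑ k, quadForm (M (f k)) ψ - N * quadForm H ψ|} : ℝ) ≤
      2 * (Fintype.card d * Fintype.card α ^ N * Real.exp (-(N * ε ^ 2 / (4 * P)))) := by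
  obtain ⟨B, hB⟩ := hH.posSemidef.exists_eq_conjTranspose_mul_self
  have hBu : IsUnit B.det := by
    have := (isUnit_iff_isUnit_det _).1 hH.isUnit
    rw [hB, det_mul] at this
    exact isUnit_of_mul_isUnit_right this
  set C := B⁻¹ with hC
  have hBC : B * C = 1 := mul_nonsing_inv B hBu
  have hCB : C * B = 1 := nonsing_inv_mul B hBu
  have hCHC : Cᴴ * H * C = 1 := by
    rw [hB, ← Matrix.mul_assoc, ← conjTranspose_mul, hBC, Matrix.mul_assoc, hBC]; simp
  have hHone : ∀ ψ, quadForm H ψ = quadForm 1 (B *ᵥ ψ) := fun ψ => by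
    rw [← quadForm_conj, Matrix.mul_one, ← hB]
  set X : α → Matrix d d ℂ := fun u => Cᴴ * M u * C with hX
  have hXpsd : ∀ u, (X u).PosSemidef := fun u => (hM u).conjTranspose_mul_mul_same C
  have hXB : ∀ u ψ, quadForm (X u) (B *ᵥ ψ) = quadForm (M u) ψ := fun u ψ => by
    rw [hX, quadForm_conj, mulVec_mulVec, hCB, one_mulVec]
  have hXle : ∀ u φ, quadForm (X u) φ ≤ P * quadForm 1 φ := fun u φ => by
    rw [hX, quadForm_conj, ← hCHC, quadForm_conj]; exact hMH u _
  have hXsum : ∑ u, X u = (Fintype.card α : ℝ) • (1 : Matrix d d ℂ) := by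
    rw [hX, ← hCHC]
    simp only [← Finset.sum_mul, ← Finset.mul_sum, hsum, Matrix.mul_smul, Matrix.smul_mul]
  set Y : α → Matrix d d ℂ := fun u => X u - 1 with hY
  have hYh : ∀ u, (Y u).IsHermitian := fun u => (hXpsd u).1.sub isHermitian_one
  have hYsum : ∑ u, Y u = 0 := by
    rw [hY, Finset.sum_sub_distrib, hXsum, Finset.sum_const, Finset.card_univ,
      ← Nat.cast_smul_eq_nsmul ℝ, sub_self]
  have hYu : ∀ u φ, quadForm (Y u) φ ≤ P * quadForm 1 φ := fun u φ => by
    rw [hY, quadForm_sub]; linarith [hXle u φ, quadForm_one_nonneg φ]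
  have hYl : ∀ u φ, -(P * quadForm 1 φ) ≤ quadForm (Y u) φ := fun u φ => by
    rw [hY, quadForm_sub]
    nlinarith [(hXpsd u).quadForm_nonneg φ, quadForm_one_nonneg φ]
  have hY2 : ∀ φ, ∑ u, quadForm (Y u * Y u) φ ≤ Fintype.card α * (P * quadForm 1 φ) := by
    intro φ
    have h1 : ∀ u, quadForm (Y u * Y u) φ ≤ P * quadForm (X u) φ - 2 * quadForm (X u) φ +
        quadForm 1 φ := by
      intro u
      have : Y u * Y u = X u * X u - (2 : ℝ) • X u + 1 := by
        rw [hY, two_smul]; noncomm_ring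
      rw [this, quadForm_add, quadForm_sub, quadForm_smul]
      linarith [(hXpsd u).quadForm_mul_self_le (hXle u) φ]
    refine (Finset.sum_le_sum fun u _ => h1 u).trans ?_
    rw [Finset.sum_add_distrib, Finset.sum_sub_distrib, ← Finset.mul_sum, ← Finset.mul_sum,
      ← quadForm_sum, hXsum, quadForm_smul, Finset.sum_const, Finset.card_univ, nsmul_eq_mul]
    have : 0 ≤ (Fintype.card α : ℝ) * quadForm 1 φ :=
      mul_nonneg (Nat.cast_nonneg _) (quadForm_one_nonneg φ)
    linarith
  have hup := card_upper_tail_le hYh hP hε hε1 hYu hYl hYsum hY2 N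
  have hlo := card_upper_tail_le (Y := fun u => -Y u) (fun u => (hYh u).neg) hP hε hε1
    (fun u φ => by
      have := quadForm_smul (-1) (Y u) φ
      rw [neg_one_smul] at this; linarith [hYl u φ])
    (fun u φ => by
      have := quadForm_smul (-1) (Y u) φ
      rw [neg_one_smul] at this; linarith [hYu u φ])
    (by rw [Finset.sum_neg_distrib, hYsum, neg_zero])
    (fun φ => by simpa using hY2 φ) N
  have hdev : ∀ (f : Fin N → α) (ψ : d → ℂ), quadForm (∑ k, Y (f k)) (B *ᵥ ψ) =
      ∑ k, quadForm (M (f k)) ψ - N * quadForm H ψ := by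
    intro f ψ
    rw [quadForm_sum]
    simp only [hY, quadForm_sub, hXB, Finset.sum_sub_distrib, ← hHone, Finset.sum_const,
      Finset.card_univ, Fintype.card_fin, nsmul_eq_mul]
  have hsub : (Finset.univ.filter fun f : Fin N → α => ∃ ψ, N * ε * quadForm H ψ <
        |∑ k, quadForm (M (f k)) ψ - N * quadForm H ψ|) ⊆
      (Finset.univ.filter fun f : Fin N → α => ∃ φ, N * ε * quadForm 1 φ <
        quadForm (∑ k, Y (f k)) φ) ∪
      (Finset.univ.filter fun f : Fin N → α => ∃ φ, N * ε * quadForm 1 φ <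
        quadForm (∑ k, -Y (f k)) φ) := by
    intro f hf
    obtain ⟨ψ, hψ⟩ := (Finset.mem_filter.1 hf).2
    rw [← hdev, hHone, lt_abs] at hψ
    rw [Finset.mem_union]
    refine hψ.imp (fun h => ?_) fun h => ?_
    · exact Finset.mem_filter.2 ⟨Finset.mem_univ _, _, h⟩
    · refine Finset.mem_filter.2 ⟨Finset.mem_univ _, B *ᵥ ψ, ?_⟩
      have := quadForm_smul (-1) (∑ k, Y (f k)) (B *ᵥ ψ)
      rw [neg_one_smul] at this
      rw [Finset.sum_neg_distrib, this]; linarith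
  have hc := (Finset.card_le_card hsub).trans (Finset.card_union_le _ _)
  have hc' : (Finset.card {f : Fin N → α | ∃ ψ, N * ε * quadForm H ψ <
        |∑ k, quadForm (M (f k)) ψ - N * quadForm H ψ|} : ℝ) ≤ _ := Nat.cast_le.2 hc
  push_cast at hc'
  linarith

open Classical in
/-- Sampling with replacement: if positive semidefinite matrices `M u` have the average `H` and each
of them is at most `P • H`, then the average of `N` independent samples approximates `H`. -/
theorem card_deviation_le [Nonempty d] {M : α → Matrix d d ℂ}
    (hM : ∀ u, (M u).PosSemidef) {H : Matrix d d ℂ} (hH : H.PosSemidef)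
    (hsum : ∑ u, M u = (Fintype.card α : ℝ) • H) {P ε : ℝ} (hP : 1 ≤ P) (hε : 0 < ε) (hε1 : ε ≤ 1)
    (hMH : ∀ u ψ, quadForm (M u) ψ ≤ P * quadForm H ψ) (N : ℕ) :
    (Finset.card {f : Fin N → α | ∃ ψ, N * ε * quadForm H ψ <
        |∑ k, quadForm (M (f k)) ψ - N * quadForm H ψ|} : ℝ) ≤
      2 * (Fintype.card d * Fintype.card α ^ N * Real.exp (-(N * ε ^ 2 / (4 * P)))) := by
  set bad : Finset (Fin N → α) := {f : Fin N → α | ∃ ψ, N * ε * quadForm H ψ <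
    |∑ k, quadForm (M (f k)) ψ - N * quadForm H ψ|} with hbad
  have hex : ∀ f : Fin N → α, ∃ δ : ℝ, 0 < δ ∧ (f ∈ bad → ∀ η, 0 < η → η ≤ δ →
      ∃ ψ, N * ε * (quadForm H ψ + η * quadForm 1 ψ) <
        |∑ k, quadForm (M (f k)) ψ - N * quadForm H ψ|) := by
    intro f
    by_cases hf : f ∈ bad
    · obtain ⟨ψ, hψ⟩ := (Finset.mem_filter.1 hf).2
      set gap := |∑ k, quadForm (M (f k)) ψ - N * quadForm H ψ| - N * ε * quadForm H ψ with hgap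
      have hgap0 : 0 < gap := by linarith
      have h1 := quadForm_one_nonneg ψ
      refine ⟨gap / (N * ε * quadForm 1 ψ + 1), by positivity, fun _ η hη hle => ⟨ψ, ?_⟩⟩
      rw [le_div_iff₀ (by positivity)] at hle
      have : η * (N * ε * quadForm 1 ψ) < gap := by linarith
      linarith
    · exact ⟨1, one_pos, fun h => absurd h hf⟩
  choose δ hδ0 hδ using hex
  obtain ⟨η, hη0, hη⟩ : ∃ η : ℝ, 0 < η ∧ ∀ f ∈ bad, η ≤ δ f := by
    rcases bad.eq_empty_or_nonempty with h | h
    · exact ⟨1, one_pos, by simp [h]⟩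
    · exact ⟨bad.inf' h δ, (Finset.lt_inf'_iff h).2 fun f _ => hδ0 f, fun f hf =>
        Finset.inf'_le δ hf⟩
  have hone : ∀ c : ℝ, 0 < c → (c • (1 : Matrix d d ℂ)).PosDef := fun c hc => by
    have := (PosDef.one (n := d) (R := ℂ)).smul hc
    exact this
  have hpd := card_deviation_le_of_posDef (M := fun u => M u + η • (1 : Matrix d d ℂ))
    (fun u => (hM u).add (PosSemidef.one.real_smul hη0.le)) (H := H + η • 1)
    (PosDef.posSemidef_add hH (hone η hη0))
    (by rw [Finset.sum_add_distrib, hsum, Finset.sum_const, Finset.card_univ, smul_add,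
          ← Nat.cast_smul_eq_nsmul ℝ]) hP hε hε1
    (fun u ψ => by
      rw [quadForm_add, quadForm_add, quadForm_smul]
      have : 0 ≤ η * quadForm 1 ψ := mul_nonneg hη0.le (quadForm_one_nonneg ψ)
      nlinarith [hMH u ψ]) N
  refine le_trans (Nat.cast_le.2 (Finset.card_le_card fun f hf => ?_)) hpd
  obtain ⟨ψ, hψ⟩ := hδ f hf η hη0 (hη f hf)
  refine Finset.mem_filter.2 ⟨Finset.mem_univ _, ψ, ?_⟩
  simp only [quadForm_add, quadForm_smul, Finset.sum_add_distrib, Finset.sum_const,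
    Finset.card_univ, Fintype.card_fin, nsmul_eq_mul]
  rwa [mul_add (N : ℝ), add_sub_add_right_eq_sub]

end Matrix

/-! ## Local operators and their kernels -/

namespace Matrix

open scoped ComplexOrder

variable {d : Type*} [Fintype d] [DecidableEq d]

theorem PosSemidef.mulVec_eq_zero_of_quadForm {A : Matrix d d ℂ} (hA : A.PosSemidef) {ψ : d → ℂ}
    (h : quadForm A ψ = 0) : A *ᵥ ψ = 0 :=
  (hA.dotProduct_mulVec_zero_iff ψ).1 (Complex.ext h (hA.1.im_star_dotProduct_mulVec_self ψ))

theorem quadForm_of_mulVec_eq_zero {A : Matrix d d ℂ} {ψ : d → ℂ} (h : A *ᵥ ψ = 0) :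
    quadForm A ψ = 0 := by
  simp [quadForm, h]

theorem sum_mulVec_eq_zero {ι : Type*} {s : Finset ι} {A : ι → Matrix d d ℂ}
    (hA : ∀ i, (A i).PosSemidef) {ψ : d → ℂ} (h : (∑ i ∈ s, A i) *ᵥ ψ = 0) {i : ι} (hi : i ∈ s) :
    A i *ᵥ ψ = 0 := by
  have h1 := quadForm_of_mulVec_eq_zero h
  rw [quadForm_sum] at h1
  exact (hA i).mulVec_eq_zero_of_quadForm
    ((Finset.sum_eq_zero_iff_of_nonneg fun j _ => (hA j).quadForm_nonneg ψ).1 h1 i hi)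

/-- If the non-zero eigenvalues of `A` are at least `1 / C` and the kernel of `A` is contained in the
kernel of `B ≤ b`, then `B ≤ b C A`. -/
theorem quadForm_le_of_spectral_gap {A B : Matrix d d ℂ} (hA : A.PosSemidef) (hB : B.PosSemidef)
    {C b : ℝ} (hC : 0 < C) (hb : 0 ≤ b) (hBb : ∀ ψ, quadForm B ψ ≤ b * quadForm 1 ψ)
    (hgap : ∀ μ ∈ spectrum ℝ A, μ ≠ 0 → 1 / C ≤ μ)
    (hker : ∀ ψ, A *ᵥ ψ = 0 → B *ᵥ ψ = 0) (ψ : d → ℂ) :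
    quadForm B ψ ≤ b * C * quadForm A ψ := by
  set f : ℝ → ℝ := fun x => if x = 0 then 0 else 1 with hf
  set E := hA.1.fn f with hE
  have hEherm : E.IsHermitian := (hA.1.fn_posSemidef (f := f) fun i => by
    simp only [hf]; split_ifs <;> norm_num).1
  have hEE : E * E = E := by
    rw [hE, ← hA.1.fn_mul]; congr 1; funext x; simp only [hf]; split_ifs <;> norm_num
  have hAE : A * (1 - E) = 0 := by
    have h1 : hA.1.fn (fun x => x * (1 - f x)) = A * (1 - E) := by
      rw [hA.1.fn_mul (fun x => x), hA.1.fn_id, hA.1.fn_sub (fun _ => 1), hA.1.fn_one]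
    rw [← h1]
    have : (fun x : ℝ => x * (1 - f x)) = fun x => 0 * (1 : ℝ) := by
      funext x; simp only [hf]; split_ifs with h <;> simp [h]
    rw [this, hA.1.fn_smul, zero_smul]
  have hBψ : B *ᵥ ψ = B *ᵥ (E *ᵥ ψ) := by
    have h1 : A *ᵥ ((1 - E) *ᵥ ψ) = 0 := by rw [mulVec_mulVec, hAE, zero_mulVec]
    have h2 := hker _ h1
    rw [sub_mulVec, one_mulVec, mulVec_sub, sub_eq_zero] at h2
    exact h2
  have hqB : quadForm B ψ = quadForm B (E *ᵥ ψ) := by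
    have e1 : star (E *ᵥ ψ) ⬝ᵥ (B *ᵥ ψ) = star ψ ⬝ᵥ (B *ᵥ (E *ᵥ ψ)) := by
      have h1 : star (B *ᵥ ψ) = star (B *ᵥ (E *ᵥ ψ)) := by rw [hBψ]
      have h2 : star ψ ᵥ* B = star (E *ᵥ ψ) ᵥ* B := by
        rw [star_mulVec, hB.1.eq] at h1
        rw [h1, star_mulVec, hB.1.eq]
      rw [dotProduct_mulVec, ← h2, ← dotProduct_mulVec, hBψ]
    have e2 : star (E *ᵥ ψ) ⬝ᵥ (B *ᵥ ψ) = star (E *ᵥ ψ) ⬝ᵥ (B *ᵥ (E *ᵥ ψ)) := by rw [← hBψ]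
    simp only [quadForm]
    rw [← e2, e1, ← hBψ]
  have hq1 : quadForm 1 (E *ᵥ ψ) = quadForm E ψ := by
    rw [← quadForm_conj, hEherm.eq, Matrix.mul_one, hEE]
  have hEA : quadForm E ψ ≤ C * quadForm A ψ := by
    have h := (hA.1.fn_posSemidef (f := fun x => C * x - f x) fun i => by
      simp only [hf]
      split_ifs with h0
      · simp [h0]
      · have := hgap _ (hA.1.eigenvalues_mem_spectrum_real i) h0
        rw [div_le_iff₀ hC] at this
        linarith).quadForm_nonneg ψ
    rw [hA.1.fn_sub (fun x => C * x), hA.1.fn_smul C (fun x => x), hA.1.fn_id, quadForm_sub,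
      quadForm_smul] at h
    linarith
  rw [hqB]
  calc quadForm B (E *ᵥ ψ) ≤ b * quadForm 1 (E *ᵥ ψ) := hBb _
    _ ≤ b * (C * quadForm A ψ) := by rw [hq1]; gcongr
    _ = _ := by ring

end Matrix

namespace QHam

open scoped ComplexOrder
open Matrix

section LocalOp

variable {r n : ℕ} (T : Fin r ↪ Fin n)

theorem extend_comp (x : Bits n) : Function.extend T (fun j => x (T j)) x = x := by
  funext q
  by_cases h : ∃ j, T j = q
  · obtain ⟨j, rfl⟩ := h; rw [T.injective.extend_apply]
  · rw [Function.extend_apply' _ _ _ h]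

theorem extend_extend (z z' : Bits r) (x : Bits n) :
    Function.extend T z (Function.extend T z' x) = Function.extend T z x := by
  funext q
  by_cases h : ∃ j, T j = q
  · obtain ⟨j, rfl⟩ := h; rw [T.injective.extend_apply, T.injective.extend_apply]
  · rw [Function.extend_apply' _ _ _ h, Function.extend_apply' _ _ _ h,
      Function.extend_apply' _ _ _ h]

theorem extend_apply_tuple (z : Bits r) (x : Bits n) (j : Fin r) :
    Function.extend T z x (T j) = z j :=
  T.injective.extend_apply _ _ _

theorem localOp_mulVec (M : Matrix (Bits r) (Bits r) ℂ) (ψ : Bits n → ℂ) (x : Bits n) :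
    (localOp T M *ᵥ ψ) x = ∑ z, M (fun j => x (T j)) z * ψ (Function.extend T z x) := by
  simp only [mulVec, dotProduct, localOp, ite_mul, zero_mul]
  rw [← Finset.sum_filter]
  refine Finset.sum_nbij' (fun y j => y (T j)) (fun z => Function.extend T z x) ?_ ?_ ?_ ?_ ?_
  · intro y _; exact Finset.mem_univ _
  · intro z _
    refine Finset.mem_filter.2 ⟨Finset.mem_univ _, fun q hq => ?_⟩
    rw [Function.extend_apply' _ _ _ (by rintro ⟨j, hj⟩; exact hq j hj)]
  · intro y hy
    funext q
    by_cases h : ∃ j, T j = q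
    · obtain ⟨j, rfl⟩ := h; rw [T.injective.extend_apply]
    · rw [Function.extend_apply' _ _ _ h]
      exact (Finset.mem_filter.1 hy).2 q fun j hj => h ⟨j, hj⟩
  · intro z _; funext j; exact extend_apply_tuple T z x j
  · intro y hy
    have : Function.extend T (fun j => y (T j)) x = y := by
      funext q
      by_cases h : ∃ j, T j = q
      · obtain ⟨j, rfl⟩ := h; rw [T.injective.extend_apply]
      · rw [Function.extend_apply' _ _ _ h]
        exact (Finset.mem_filter.1 hy).2 q fun j hj => h ⟨j, hj⟩
    rw [this]

theorem localOp_ext {k : ℕ} {A B : Matrix (Bits k) (Bits k) ℂ}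
    (h : ∀ ψ x, (A *ᵥ ψ) x = (B *ᵥ ψ) x) : A = B :=
  Matrix.ext_of_mulVec_single fun _ => funext fun x => h _ x

theorem localOp_one : localOp T (1 : Matrix (Bits r) (Bits r) ℂ) = 1 := by
  refine localOp_ext fun ψ x => ?_
  rw [localOp_mulVec, one_mulVec, Finset.sum_eq_single (fun j => x (T j))]
  · rw [one_apply_eq, one_mul, extend_comp]
  · intro z _ hz; rw [one_apply_ne hz.symm, zero_mul]
  · intro h; exact absurd (Finset.mem_univ _) h

theorem localOp_mul (A B : Matrix (Bits r) (Bits r) ℂ) :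
    localOp T (A * B) = localOp T A * localOp T B := by
  refine localOp_ext fun ψ x => ?_
  rw [← mulVec_mulVec, localOp_mulVec, localOp_mulVec]
  simp only [localOp_mulVec, extend_apply_tuple, extend_extend, mul_apply, Finset.sum_mul,
    Finset.mul_sum, mul_assoc]
  exact Finset.sum_comm

theorem localOp_conjTranspose (A : Matrix (Bits r) (Bits r) ℂ) :
    localOp T Aᴴ = (localOp T A)ᴴ := by
  ext x y
  simp only [localOp, conjTranspose_apply]
  have : (∀ q, (∀ j, T j ≠ q) → x q = y q) ↔ ∀ q, (∀ j, T j ≠ q) → y q = x q :=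
    forall₂_congr fun _ _ => eq_comm
  simp only [this]
  split_ifs <;> simp

theorem localOp_sub (A B : Matrix (Bits r) (Bits r) ℂ) :
    localOp T (A - B) = localOp T A - localOp T B := by
  ext x y
  simp only [localOp, Matrix.sub_apply]
  split_ifs <;> simp

theorem localOp_smul (c : ℝ) (A : Matrix (Bits r) (Bits r) ℂ) :
    localOp T (c • A) = c • localOp T A := by
  ext x y
  simp only [localOp, Matrix.smul_apply]
  split_ifs <;> simp

theorem localOp_posSemidef {M : Matrix (Bits r) (Bits r) ℂ} (hM : M.PosSemidef) :
    (localOp T M).PosSemidef := by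
  obtain ⟨B, rfl⟩ := hM.exists_eq_conjTranspose_mul_self
  rw [localOp_mul, localOp_conjTranspose]
  exact posSemidef_conjTranspose_mul_self _

theorem quadForm_localOp_le {M : Matrix (Bits r) (Bits r) ℂ} (hM : M.PosSemidef) {C : ℝ}
    (hC : ∀ μ ∈ spectrum ℝ M, μ ≤ C) (ψ : Bits n → ℂ) :
    quadForm (localOp T M) ψ ≤ C * quadForm 1 ψ := by
  have h : (C • (1 : Matrix (Bits r) (Bits r) ℂ) - M).PosSemidef :=
    ((isHermitian_one.real_smul C).sub hM.1).posSemidef_of_quadForm fun φ => by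
      rw [quadForm_sub, quadForm_smul]
      linarith [hM.1.quadForm_le_of_eigenvalues
        (fun i => hC _ (hM.1.eigenvalues_mem_spectrum_real i)) φ]
  have h2 := (localOp_posSemidef T h).quadForm_nonneg ψ
  rw [localOp_sub, localOp_smul, localOp_one, quadForm_sub, quadForm_smul] at h2
  linarith

theorem localOp_mulVec_eq_zero_iff (M : Matrix (Bits r) (Bits r) ℂ) (ψ : Bits n → ℂ) :
    localOp T M *ᵥ ψ = 0 ↔ ∀ x, M *ᵥ (fun z => ψ (Function.extend T z x)) = 0 := by
  constructor
  · intro h x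
    funext z
    have := congrFun h (Function.extend T z x)
    rw [localOp_mulVec] at this
    simp only [extend_apply_tuple, extend_extend] at this
    exact this
  · intro h
    funext x
    rw [localOp_mulVec]
    exact congrFun (h x) _

theorem localOp_eq_zero {M : Matrix (Bits r) (Bits r) ℂ} (h : localOp T M = 0) : M = 0 := by
  have hx : ∀ x : Bits n, ∀ a b, M a b = 0 := by
    intro x a b
    have := congrFun (congrFun h (Function.extend T a x)) (Function.extend T b x)
    simp only [localOp, extend_apply_tuple, Matrix.zero_apply] at this
    rwa [if_pos] at this
    intro q hq
    have hq' : ¬∃ j, T j = q := fun ⟨j, hj⟩ => hq j hj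
    rw [Function.extend_apply' _ _ _ hq', Function.extend_apply' _ _ _ hq']
  ext a b
  exact hx 0 a b

/-- Pulling a kernel vector back along a map of assignments that is compatible with the tuples. -/
theorem localOp_comp_eq_zero {k : ℕ} (e : Fin r ↪ Fin k) {g : Bits k → Bits n}
    (hg : ∀ z w, g (Function.extend e z w) = Function.extend T z (g w))
    {M : Matrix (Bits r) (Bits r) ℂ} {ψ : Bits n → ℂ} (h : localOp T M *ᵥ ψ = 0) :
    localOp e M *ᵥ (ψ ∘ g) = 0 := by
  rw [localOp_mulVec_eq_zero_iff] at h ⊢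
  intro w
  simpa only [Function.comp, hg] using h (g w)

theorem mul_eq_mul_of_finrank_ker_le_one {M : Matrix (Bits r) (Bits r) ℂ}
    (hM : Module.finrank ℂ (LinearMap.ker M.mulVecLin) ≤ 1) {u v : Bits r → ℂ}
    (hu : M *ᵥ u = 0) (hv : M *ᵥ v = 0) (z z' : Bits r) : u z * v z' = u z' * v z := by
  obtain ⟨w, hw⟩ := finrank_le_one_iff.1 hM
  obtain ⟨c, hc⟩ := hw ⟨u, by simpa using hu⟩
  obtain ⟨c', hc'⟩ := hw ⟨v, by simpa using hv⟩
  have h1 : u = c • (w : Bits r → ℂ) := (congrArg Subtype.val hc).symm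
  have h2 : v = c' • (w : Bits r → ℂ) := (congrArg Subtype.val hc').symm
  simp only [h1, h2, Pi.smul_apply, smul_eq_mul]
  ring

end LocalOp

section Product

variable {n : ℕ}

open Classical in
/-- The assignment that agrees with `x` on `U` and with `y` elsewhere. -/
noncomputable def mix (U : Set (Fin n)) (x y : Bits n) : Bits n := fun q => if q ∈ U then x q else y q

theorem mix_of_mem {U : Set (Fin n)} {q : Fin n} (h : q ∈ U) (x y : Bits n) : mix U x y q = x q :=
  if_pos h

theorem mix_of_notMem {U : Set (Fin n)} {q : Fin n} (h : q ∉ U) (x y : Bits n) :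
    mix U x y q = y q :=
  if_neg h

theorem mix_self (U : Set (Fin n)) (x : Bits n) : mix U x x = x := by
  funext q; by_cases h : q ∈ U
  · rw [mix_of_mem h]
  · rw [mix_of_notMem h]

theorem extend_eq_mix {r : ℕ} (T : Fin r ↪ Fin n) (x y : Bits n) :
    Function.extend T (fun j => x (T j)) y = mix (Set.range T) x y := by
  funext q
  by_cases h : ∃ j, T j = q
  · obtain ⟨j, rfl⟩ := h
    rw [T.injective.extend_apply, mix_of_mem (Set.mem_range_self j)]
  · rw [Function.extend_apply' _ _ _ h, mix_of_notMem h]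

/-- `α` and `ψ` have a common factor that depends only on the coordinates in `U`, with cofactors that
do not depend on these coordinates. -/
def CommonFactor (U : Set (Fin n)) (α ψ : Bits n → ℂ) : Prop :=
  ∃ σ β φ : Bits n → ℂ, (∀ x y, (∀ q ∈ U, x q = y q) → σ x = σ y) ∧
    (∀ x y, (∀ q, q ∉ U → x q = y q) → β x = β y) ∧
    (∀ x y, (∀ q, q ∉ U → x q = y q) → φ x = φ y) ∧
    (∀ x, α x = σ x * β x) ∧ ∀ x, ψ x = σ x * φ x

theorem CommonFactor.cross_mul_eq {ι : Type*} [Fintype ι] {U : ι → Set (Fin n)} {α ψ : Bits n → ℂ}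
    (h : ∀ v, CommonFactor (U v) α ψ) {x x₀ : Bits n} (hx₀ : α x₀ ≠ 0)
    (hx : ∀ q, (∀ v, q ∉ U v) → x q = x₀ q) : ψ x * α x₀ = α x * ψ x₀ := by
  classical
  choose σ β φ hσ hβ hφ hα hψ using h
  have key : ∀ s : Finset ι, (∃ v ∈ s, σ v x = 0) ∨
      (α (mix (⋃ v ∈ s, U v) x x₀) ≠ 0 ∧
        ψ (mix (⋃ v ∈ s, U v) x x₀) * α x₀ = α (mix (⋃ v ∈ s, U v) x x₀) * ψ x₀) := by
    intro s
    induction s using Finset.induction_on with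
    | empty =>
      right
      have : mix (⋃ v ∈ (∅ : Finset ι), U v) x x₀ = x₀ := by
        funext q; rw [mix_of_notMem (by simp)]
      rw [this]
      exact ⟨hx₀, mul_comm _ _⟩
    | insert v s _ ih =>
      rcases ih with ⟨w, hw, h0⟩ | ⟨hne, heq⟩
      · exact Or.inl ⟨w, Finset.mem_insert_of_mem hw, h0⟩
      by_cases h0 : σ v x = 0
      · exact Or.inl ⟨v, Finset.mem_insert_self _ _, h0⟩
      right
      set y := mix (⋃ w ∈ s, U w) x x₀ with hy
      set y' := mix (⋃ w ∈ insert v s, U w) x x₀ with hy'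
      have hmem : ∀ q, q ∈ (⋃ w ∈ insert v s, U w) ↔ q ∈ U v ∨ q ∈ ⋃ w ∈ s, U w := by
        intro q; simp
      have e1 : σ v y' = σ v x := hσ v _ _ fun q hq => by
        rw [hy', mix_of_mem ((hmem q).2 (Or.inl hq))]
      have hoff : ∀ q, q ∉ U v → y' q = y q := by
        intro q hq
        by_cases hs : q ∈ ⋃ w ∈ s, U w
        · rw [hy', hy, mix_of_mem hs, mix_of_mem ((hmem q).2 (Or.inr hs))]
        · rw [hy', hy, mix_of_notMem hs, mix_of_notMem]
          rw [hmem]; tauto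
      have e2 := hβ v _ _ hoff
      have e3 := hφ v _ _ hoff
      rw [hα v y] at hne heq
      rw [hψ v y] at heq
      have hσy : σ v y ≠ 0 := left_ne_zero_of_mul hne
      have hβy : β v y ≠ 0 := right_ne_zero_of_mul hne
      have hc : φ v y * α x₀ = β v y * ψ x₀ :=
        mul_left_cancel₀ hσy (by rw [← mul_assoc, heq, mul_assoc])
      rw [hα v y', hψ v y', e1, e2, e3]
      exact ⟨mul_ne_zero h0 hβy, by rw [mul_assoc, hc, mul_assoc]⟩
  rcases key Finset.univ with ⟨v, _, h0⟩ | ⟨_, heq⟩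
  · rw [hα v x, hψ v x, h0]; ring
  · have : mix (⋃ v ∈ (Finset.univ : Finset ι), U v) x x₀ = x := by
      funext q
      by_cases hq : q ∈ ⋃ v ∈ (Finset.univ : Finset ι), U v
      · rw [mix_of_mem hq]
      · rw [mix_of_notMem hq, hx]
        simpa using hq
    rwa [this] at heq

/-- The cross-multiplication property of two functions whose restrictions to the coordinates in `R` are
always proportional to each other. -/
def Proportional (R : Set (Fin n)) (ψ χ : Bits n → ℂ) : Prop :=
  ∀ x x' y y', ψ (mix R x y) * χ (mix R x' y') = ψ (mix R x' y) * χ (mix R x y')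

theorem CommonFactor.of_proportional {R S : Set (Fin n)} {α ψ χ : Bits n → ℂ} {x₀ : Bits n}
    (hχ : χ x₀ ≠ 0) (hα : ∀ x y, (∀ q ∈ R, x q = y q) → α x = α y)
    (hαχ : Proportional R α χ) (hψχ : Proportional S ψ χ) (hR : Proportional R χ χ)
    (hS : Proportional S χ χ) : CommonFactor (R ∩ S) α ψ := by
  refine ⟨fun x => χ (mix (R ∩ S) x x₀), fun x => α x₀ * χ (mix (R \ S) x x₀) / χ x₀ ^ 2,
    fun x => ψ (mix S x₀ x) * χ (mix (S \ R) x x₀) / χ x₀ ^ 2, ?_, ?_, ?_, ?_, ?_⟩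
  · intro x y h
    refine congrArg χ (funext fun q => ?_)
    by_cases hq : q ∈ R ∩ S
    · rw [mix_of_mem hq, mix_of_mem hq, h q hq]
    · rw [mix_of_notMem hq, mix_of_notMem hq]
  · intro x y h
    have : mix (R \ S) x x₀ = mix (R \ S) y x₀ := by
      funext q
      by_cases hq : q ∈ R \ S
      · rw [mix_of_mem hq, mix_of_mem hq, h q fun h' => hq.2 h'.2]
      · rw [mix_of_notMem hq, mix_of_notMem hq]
    simp only [this]
  · intro x y h
    have h1 : mix (S \ R) x x₀ = mix (S \ R) y x₀ := by
      funext q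
      by_cases hq : q ∈ S \ R
      · rw [mix_of_mem hq, mix_of_mem hq, h q fun h' => hq.2 h'.1]
      · rw [mix_of_notMem hq, mix_of_notMem hq]
    have h2 : mix S x₀ x = mix S x₀ y := by
      funext q
      by_cases hq : q ∈ S
      · rw [mix_of_mem hq, mix_of_mem hq]
      · rw [mix_of_notMem hq, mix_of_notMem hq, h q fun h' => hq h'.2]
    simp only [h1, h2]
  · intro x
    have e1 := hαχ x x₀ x₀ x₀
    have e2 := hS (mix R x x₀) x₀ (mix R x x₀) x₀
    rw [mix_self] at e1
    rw [mix_self, mix_self] at e2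
    have e3 : mix S x₀ (mix R x x₀) = mix (R \ S) x x₀ := by
      funext q
      by_cases hq : q ∈ S <;> by_cases hq' : q ∈ R <;> simp [mix, hq, hq']
    have e4 : mix S (mix R x x₀) x₀ = mix (R ∩ S) x x₀ := by
      funext q
      by_cases hq : q ∈ S <;> by_cases hq' : q ∈ R <;> simp [mix, hq, hq']
    have e5 : α (mix R x x₀) = α x := hα _ _ fun q hq => mix_of_mem hq _ _
    rw [e3, e4] at e2
    rw [e5] at e1
    field_simp
    have : α x * χ x₀ * χ x₀ = α x₀ * (χ (mix (R \ S) x x₀) * χ (mix (R ∩ S) x x₀)) := by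
      rw [e1, mul_assoc, e2]
    linear_combination this
  · intro x
    have e1 := hψχ x x₀ x x₀
    have e2 := hR (mix S x x₀) x₀ (mix S x x₀) x₀
    rw [mix_self, mix_self] at e1
    rw [mix_self, mix_self] at e2
    have e3 : mix R x₀ (mix S x x₀) = mix (S \ R) x x₀ := by
      funext q
      by_cases hq : q ∈ S <;> by_cases hq' : q ∈ R <;> simp [mix, hq, hq']
    have e4 : mix R (mix S x x₀) x₀ = mix (R ∩ S) x x₀ := by
      funext q
      by_cases hq : q ∈ S <;> by_cases hq' : q ∈ R <;> simp [mix, hq, hq']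
    rw [e3, e4] at e2
    field_simp
    have : ψ x * χ x₀ * χ x₀ =
        ψ (mix S x₀ x) * (χ (mix (S \ R) x x₀) * χ (mix (R ∩ S) x x₀)) := by
      rw [e1, mul_assoc, e2]
    linear_combination this

theorem proportional_of_ker {r : ℕ} {T : Fin r ↪ Fin n} {M : Matrix (Bits r) (Bits r) ℂ}
    (hM : Module.finrank ℂ (LinearMap.ker M.mulVecLin) ≤ 1) {ψ χ : Bits n → ℂ}
    (hψ : localOp T M *ᵥ ψ = 0) (hχ : localOp T M *ᵥ χ = 0) :
    Proportional (Set.range T) ψ χ := by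
  intro x x' y y'
  rw [localOp_mulVec_eq_zero_iff] at hψ hχ
  have := mul_eq_mul_of_finrank_ker_le_one hM (hψ y) (hχ y') (fun j => x (T j)) (fun j => x' (T j))
  simpa only [extend_eq_mix] using this

/-- If every qubit of `T` is covered by some `T' v` such that the operators on `T` and `T' v` have a common
kernel vector, then the common kernel of the operators on the `T' v` lies in that of the operator
on `T`. -/
theorem localOp_mulVec_eq_zero_of_cover {r : ℕ} (hr : 0 < r) {T : Fin r ↪ Fin n}
    {M : Matrix (Bits r) (Bits r) ℂ} (hM : Module.finrank ℂ (LinearMap.ker M.mulVecLin) ≤ 1)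
    {T' : Fin r → Fin r ↪ Fin n} {M' : Fin r → Matrix (Bits r) (Bits r) ℂ}
    (hM' : ∀ v, Module.finrank ℂ (LinearMap.ker (M' v).mulVecLin) ≤ 1)
    (hcover : ∀ v, T v ∈ Set.range (T' v))
    (hcommon : ∀ v, ∃ χ : Bits n → ℂ, χ ≠ 0 ∧ localOp T M *ᵥ χ = 0 ∧ localOp (T' v) (M' v) *ᵥ χ = 0)
    {ψ : Bits n → ℂ} (hψ : ∀ v, localOp (T' v) (M' v) *ᵥ ψ = 0) : localOp T M *ᵥ ψ = 0 := by
  obtain ⟨a, ha0, ha⟩ : ∃ a : Bits r → ℂ, a ≠ 0 ∧ M *ᵥ a = 0 := by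
    obtain ⟨χ, hχ0, hχ, _⟩ := hcommon ⟨0, hr⟩
    obtain ⟨x, hx⟩ := Function.ne_iff.1 hχ0
    refine ⟨fun z => χ (Function.extend T z x), fun h0 => hx ?_,
      (localOp_mulVec_eq_zero_iff T M χ).1 hχ x⟩
    have := congrFun h0 fun j => x (T j)
    simp only [extend_comp] at this
    exact this
  obtain ⟨z₀, hz₀⟩ := Function.ne_iff.1 ha0
  set α : Bits n → ℂ := fun x => a fun j => x (T j) with hα
  have hαker : localOp T M *ᵥ α = 0 := by
    rw [localOp_mulVec_eq_zero_iff]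
    intro x
    simpa only [hα, extend_apply_tuple] using ha
  have hcf : ∀ v, CommonFactor (Set.range T ∩ Set.range (T' v)) α ψ := by
    intro v
    obtain ⟨χ, hχ0, hχ, hχ'⟩ := hcommon v
    obtain ⟨x₀, hx₀⟩ := Function.ne_iff.1 hχ0
    refine CommonFactor.of_proportional hx₀ (fun x y h => ?_) (proportional_of_ker hM hαker hχ)
      (proportional_of_ker (hM' v) (hψ v) hχ') (proportional_of_ker hM hχ hχ)
      (proportional_of_ker (hM' v) hχ' hχ')
    exact congrArg a (funext fun j => h _ (Set.mem_range_self j))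
  rw [localOp_mulVec_eq_zero_iff]
  intro x
  have hcross : ∀ z, ψ (Function.extend T z x) =
      (ψ (Function.extend T z₀ x) / a z₀) * a z := by
    intro z
    have h := CommonFactor.cross_mul_eq hcf (x := Function.extend T z x)
      (x₀ := Function.extend T z₀ x) (by simp only [hα, extend_apply_tuple]; exact hz₀)
      (fun q hq => by
        have : ¬∃ j, T j = q := by
          rintro ⟨j, rfl⟩
          exact hq j ⟨Set.mem_range_self j, hcover j⟩
        rw [Function.extend_apply' _ _ _ this, Function.extend_apply' _ _ _ this])
    simp only [hα, extend_apply_tuple] at h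
    have hz : a z₀ ≠ 0 := hz₀
    field_simp
    linear_combination h
  have : (fun z => ψ (Function.extend T z x)) = (ψ (Function.extend T z₀ x) / a z₀) • a :=
    funext hcross
  rw [this, mulVec_smul, ha, smul_zero]

end Product

end QHam

/-! ## Conflicts and importances in bounded Hamiltonians -/

namespace QHam

open scoped ComplexOrder
open Matrix

variable {r n m : ℕ}

namespace Hamiltonian

variable (H : Hamiltonian r n m)

/-- The operator `(M_i)_{T_i}`. -/
def term (i : Fin m) : Matrix (Bits n) (Bits n) ℂ := localOp (H.tuple i) (H.op i)

/-- Two terms are in conflict if their kernels intersect trivially. -/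
def Conflict (i j : Fin m) : Prop := ∀ ψ, H.term i *ᵥ ψ = 0 → H.term j *ᵥ ψ = 0 → ψ = 0

theorem term_posSemidef (i : Fin m) : (H.term i).PosSemidef := localOp_posSemidef _ (H.psd i)

theorem posSemidef_sum_term (s : Finset (Fin m)) : (∑ i ∈ s, H.term i).PosSemidef :=
  posSemidef_sum _ fun i _ => H.term_posSemidef i

variable {H} {C : ℝ}

theorem IsBounded.quadForm_term_le {ℓ : ℕ} (hH : H.IsBounded C ℓ) (i : Fin m) (ψ : Bits n → ℂ) :
    quadForm (H.term i) ψ ≤ C * quadForm 1 ψ :=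
  quadForm_localOp_le _ (H.psd i) (hH.2.2.1 i) ψ

theorem IsBounded.quadForm_le_of_ker {ℓ : ℕ} (hH : H.IsBounded C ℓ) {S : Finset (Fin m)}
    (hS : S.Nonempty) (hcard : S.card ≤ ℓ) {B : Matrix (Bits n) (Bits n) ℂ} (hB : B.PosSemidef)
    {b : ℝ} (hb : 0 ≤ b) (hBb : ∀ ψ, quadForm B ψ ≤ b * quadForm 1 ψ)
    (hker : ∀ ψ, (∀ i ∈ S, H.term i *ᵥ ψ = 0) → B *ᵥ ψ = 0) (ψ : Bits n → ℂ) :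
    quadForm B ψ ≤ b * C * ∑ i ∈ S, quadForm (H.term i) ψ := by
  rw [← quadForm_sum]
  exact quadForm_le_of_spectral_gap (H.posSemidef_sum_term S) hB hH.1 hb hBb
    (hH.2.2.2 S hS hcard n H.tuple fun _ _ _ _ h => h)
    (fun φ hφ => hker φ fun i hi => sum_mulVec_eq_zero H.term_posSemidef hφ hi) ψ

theorem IsBounded.one_le_sq (hH : H.IsBounded C (2 * r)) (hr : 0 < r) (i : Fin m) : 1 ≤ C ^ 2 := by
  have hle := hH.quadForm_le_of_ker (S := {i}) (Finset.singleton_nonempty i)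
    (by rw [Finset.card_singleton]; omega) (H.term_posSemidef i) hH.1.le (hH.quadForm_term_le i)
    (fun ψ h => h i (Finset.mem_singleton_self i))
  by_contra! hC
  refine hH.2.1 i (localOp_eq_zero (H.tuple i) (localOp_ext fun ψ x => ?_))
  have h0 := (H.term_posSemidef i).quadForm_nonneg ψ
  have h1 := hle ψ
  rw [Finset.sum_singleton] at h1
  have h2 : quadForm (H.term i) ψ = 0 := by nlinarith
  rw [zero_mulVec]
  exact congrFun ((H.term_posSemidef i).mulVec_eq_zero_of_quadForm h2) x

theorem IsBounded.quadForm_one_le_of_conflict (hH : H.IsBounded C (2 * r)) (hr : 0 < r)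
    {i j : Fin m} (h : H.Conflict i j) (ψ : Bits n → ℂ) :
    quadForm 1 ψ ≤ C * ∑ k ∈ {i, j}, quadForm (H.term k) ψ := by
  have := hH.quadForm_le_of_ker (S := {i, j}) ⟨i, by simp⟩
    (Finset.card_le_two.trans (by omega)) (B := 1) PosSemidef.one zero_le_one (fun ψ => by simp)
    (fun ψ hψ => by rw [h ψ (hψ i (by simp)) (hψ j (by simp)), mulVec_zero]) ψ
  rwa [one_mul] at this

theorem IsBounded.quadForm_term_le_of_cover (hH : H.IsBounded C (2 * r)) (hr : 0 < r)
    (hN : H.NullityLeOne) {i : Fin m} {j : Fin r → Fin m}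
    (hcover : ∀ v, H.tuple i v ∈ Set.range (H.tuple (j v))) (hconf : ∀ v, ¬H.Conflict i (j v))
    (ψ : Bits n → ℂ) :
    quadForm (H.term i) ψ ≤ C ^ 2 * ∑ v, quadForm (H.term (j v)) ψ := by
  classical
  have h1 := hH.quadForm_le_of_ker (S := Finset.univ.image j)
    ((Finset.univ_nonempty_iff.2 ⟨⟨0, hr⟩⟩).image j)
    (Finset.card_image_le.trans (by rw [Finset.card_univ, Fintype.card_fin]; omega))
    (H.term_posSemidef i) hH.1.le (hH.quadForm_term_le i)
    (fun φ hφ => by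
      refine localOp_mulVec_eq_zero_of_cover hr (hN i) (T' := fun v => H.tuple (j v))
        (M' := fun v => H.op (j v)) (fun v => hN (j v)) hcover (fun v => ?_)
        fun v => hφ (j v) (Finset.mem_image_of_mem j (Finset.mem_univ v))
      have := hconf v
      rw [Conflict] at this
      push Not at this
      obtain ⟨χ, h1, h2, h3⟩ := this
      exact ⟨χ, h3, h1, h2⟩) ψ
  have h2 : ∑ k ∈ Finset.univ.image j, quadForm (H.term k) ψ ≤ ∑ v, quadForm (H.term (j v)) ψ :=
    Finset.sum_image_le_of_nonneg fun k _ => (H.term_posSemidef k).quadForm_nonneg ψ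
  calc quadForm (H.term i) ψ ≤ C * C * _ := h1
    _ ≤ C * C * ∑ v, quadForm (H.term (j v)) ψ :=
        mul_le_mul_of_nonneg_left h2 (mul_nonneg hH.1.le hH.1.le)
    _ = _ := by ring

variable (H) in
open Classical in
/-- The terms outside of `X` that act on the qubit `q`. -/
noncomputable def incident (X : Finset (Fin m)) (q : Fin n) : Finset (Fin m) :=
  {j | j ∉ X ∧ q ∈ Set.range (H.tuple j)}

variable (H) in
/-- A set of terms such that there are no conflicts between the other terms and that has much energy in
every state. -/
structure ConflictCover (C : ℝ) (X : Finset (Fin m)) : Prop where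
  energy : ∀ ψ, X.card * quadForm 1 ψ ≤ 2 * C * ∑ i ∈ X, quadForm (H.term i) ψ
  free : ∀ i ∉ X, ∀ j ∉ X, ¬H.Conflict i j

/-- The importance of a term, in terms of upper bounds `h q` and `h'` of `m` divided by the number of the
terms at `q` and by the cardinality of `X`. -/
theorem IsBounded.quadForm_term_le_importance (hH : H.IsBounded C (2 * r)) (hr : 0 < r)
    (hN : H.NullityLeOne) {X : Finset (Fin m)} (hX : H.ConflictCover C X) {h : Fin n → ℝ} {h' : ℝ}
    (hh0 : ∀ q, 0 ≤ h q)
    (hh : ∀ q, (H.incident X q).Nonempty → m ≤ h q * (H.incident X q).card)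
    (hh' : X.Nonempty → m ≤ h' * X.card) (i : Fin m) (ψ : Bits n → ℂ) :
    m * quadForm (H.term i) ψ ≤ 2 * C ^ 2 * (if i ∈ X then h' else ∑ v, h (H.tuple i v)) *
      ∑ j, quadForm (H.term j) ψ := by
  have hnn := fun j => (H.term_posSemidef j).quadForm_nonneg ψ
  have hsub : ∀ s : Finset (Fin m), ∑ j ∈ s, quadForm (H.term j) ψ ≤
      ∑ j, quadForm (H.term j) ψ := fun s =>
    Finset.sum_le_sum_of_subset_of_nonneg (Finset.subset_univ s) fun j _ _ => hnn j
  have hE : 0 ≤ ∑ j, quadForm (H.term j) ψ := Finset.sum_nonneg fun j _ => hnn j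
  have hC := hH.1
  split_ifs with hi
  · have hm := hh' ⟨i, hi⟩
    have h'0 : 0 ≤ h' := by
      have hc : 0 < (X.card : ℝ) := by exact_mod_cast Finset.card_pos.2 ⟨i, hi⟩
      by_contra! hneg
      nlinarith [Nat.cast_nonneg (α := ℝ) m]
    calc (m : ℝ) * quadForm (H.term i) ψ ≤ (h' * X.card) * (C * quadForm 1 ψ) :=
          mul_le_mul hm (hH.quadForm_term_le i ψ) (hnn i) ((Nat.cast_nonneg _).trans hm)
      _ = h' * C * (X.card * quadForm 1 ψ) := by ring
      _ ≤ h' * C * (2 * C * ∑ j, quadForm (H.term j) ψ) := by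
          refine mul_le_mul_of_nonneg_left ((hX.energy ψ).trans ?_) (by positivity)
          exact mul_le_mul_of_nonneg_left (hsub X) (by positivity)
      _ = _ := by ring
  · have hmem : ∀ v, i ∈ H.incident X (H.tuple i v) := fun v => by simp [incident, hi]
    have hmin := fun v => (H.incident X (H.tuple i v)).exists_min_image
      (fun j => quadForm (H.term j) ψ) ⟨i, hmem v⟩
    choose j hj hjmin using hmin
    have hj' : ∀ v, j v ∉ X ∧ H.tuple i v ∈ Set.range (H.tuple (j v)) := fun v => by
      simpa [incident] using hj v
    have hcov := hH.quadForm_term_le_of_cover hr hN (fun v => (hj' v).2)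
      (fun v => hX.free i hi (j v) (hj' v).1) ψ
    have hv : ∀ v, m * quadForm (H.term (j v)) ψ ≤
        h (H.tuple i v) * ∑ j, quadForm (H.term j) ψ := by
      intro v
      have h1 := Finset.card_nsmul_le_sum (H.incident X (H.tuple i v))
        (fun j => quadForm (H.term j) ψ) _ (hjmin v)
      rw [nsmul_eq_mul] at h1
      calc (m : ℝ) * quadForm (H.term (j v)) ψ
          ≤ (h (H.tuple i v) * (H.incident X (H.tuple i v)).card) * quadForm (H.term (j v)) ψ :=
            mul_le_mul_of_nonneg_right (hh _ ⟨i, hmem v⟩) (hnn _)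
        _ = h (H.tuple i v) * ((H.incident X (H.tuple i v)).card * quadForm (H.term (j v)) ψ) := by
            ring
        _ ≤ _ := mul_le_mul_of_nonneg_left (h1.trans (hsub _)) (hh0 _)
    have hs : 0 ≤ (∑ v, h (H.tuple i v)) * ∑ j, quadForm (H.term j) ψ :=
      mul_nonneg (Finset.sum_nonneg fun v _ => hh0 _) hE
    calc (m : ℝ) * quadForm (H.term i) ψ
        ≤ m * (C ^ 2 * ∑ v, quadForm (H.term (j v)) ψ) := by gcongr
      _ = C ^ 2 * ∑ v, m * quadForm (H.term (j v)) ψ := by rw [← Finset.mul_sum]; ring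
      _ ≤ C ^ 2 * ∑ v, h (H.tuple i v) * ∑ j, quadForm (H.term j) ψ := by
          exact mul_le_mul_of_nonneg_left (Finset.sum_le_sum fun v _ => hv v) (sq_nonneg C)
      _ = C ^ 2 * ((∑ v, h (H.tuple i v)) * ∑ j, quadForm (H.term j) ψ) := by
          rw [Finset.sum_mul]
      _ ≤ _ := by nlinarith [sq_nonneg C, mul_nonneg (sq_nonneg C) hs]

variable (H) in
theorem sum_importance_le (X : Finset (Fin m)) {h : Fin n → ℝ} {h' b : ℝ}
    (hh : ∀ q, h q * (H.incident X q).card ≤ b) (hh' : h' * X.card ≤ b) :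
    ∑ i, (if i ∈ X then h' else ∑ v, h (H.tuple i v)) ≤ (n + 1) * b := by
  classical
  rw [← Finset.sum_add_sum_compl X]
  have h1 : ∑ i ∈ X, (if i ∈ X then h' else ∑ v, h (H.tuple i v)) ≤ b := by
    rw [Finset.sum_congr rfl fun i hi => if_pos hi, Finset.sum_const, nsmul_eq_mul, mul_comm]
    exact hh'
  have h2 : ∑ i ∈ Xᶜ, (if i ∈ X then h' else ∑ v, h (H.tuple i v)) ≤ n * b := by
    rw [Finset.sum_congr rfl fun i hi => if_neg (Finset.mem_compl.1 hi)]
    have h3 : ∀ i, ∑ v, h (H.tuple i v) =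
        ∑ q, if q ∈ Set.range (H.tuple i) then h q else 0 := by
      intro i
      rw [← Finset.sum_filter, ← Finset.sum_map Finset.univ (H.tuple i) h]
      refine Finset.sum_congr ?_ fun _ _ => rfl
      ext q; simp
    simp only [h3]
    rw [Finset.sum_comm]
    calc ∑ q, ∑ i ∈ Xᶜ, (if q ∈ Set.range (H.tuple i) then h q else 0)
        = ∑ q, h q * (H.incident X q).card := by
          refine Finset.sum_congr rfl fun q _ => ?_
          rw [← Finset.sum_filter, Finset.sum_const, nsmul_eq_mul, mul_comm]
          congr 3
          ext i; simp [incident]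
      _ ≤ ∑ _q : Fin n, b := Finset.sum_le_sum fun q _ => hh q
      _ = n * b := by simp
  linarith

end Hamiltonian

section Determinant

variable {C : ℝ}

/-- The position of the qubits of `T'` in a system in which the qubits of `T` come first. -/
def IsPattern (T T' : Fin r ↪ Fin n) (e : Fin r ↪ Fin (r + r)) : Prop :=
  (∀ p s, T p = T' s ↔ e s = Fin.castAdd r p) ∧
    ∀ s, (∀ p, T p ≠ T' s) → e s = Fin.natAdd r s

theorem exists_isPattern (T T' : Fin r ↪ Fin n) : ∃ e, IsPattern T T' e := by
  classical
  set f : Fin r → Fin (r + r) := fun s =>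
    if h : ∃ p, T p = T' s then Fin.castAdd r h.choose else Fin.natAdd r s with hf
  have hpos : ∀ p s, T p = T' s → f s = Fin.castAdd r p := by
    intro p s h
    have hex : ∃ p, T p = T' s := ⟨p, h⟩
    rw [hf]; simp only [hex, dif_pos]
    rw [T.injective (hex.choose_spec.trans h.symm)]
  have hneg : ∀ s, (∀ p, T p ≠ T' s) → f s = Fin.natAdd r s := by
    intro s h
    rw [hf]; exact dif_neg (by push Not; exact h)
  have hne : ∀ p s, (Fin.castAdd r p : Fin (r + r)) ≠ Fin.natAdd r s := by
    intro p s h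
    have := congrArg Fin.val h
    simp at this; omega
  have hinj : Function.Injective f := by
    intro s s' h
    by_cases h1 : ∃ p, T p = T' s
    · obtain ⟨p, hp⟩ := h1
      by_cases h2 : ∃ p, T p = T' s'
      · obtain ⟨p', hp'⟩ := h2
        rw [hpos p s hp, hpos p' s' hp'] at h
        rw [Fin.castAdd_injective r r h] at hp
        exact T'.injective (hp.symm.trans hp')
      · push Not at h2
        rw [hpos p s hp, hneg s' h2] at h
        exact absurd h (hne _ _)
    · push Not at h1
      by_cases h2 : ∃ p, T p = T' s'
      · obtain ⟨p', hp'⟩ := h2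
        rw [hneg s h1, hpos p' s' hp'] at h
        exact absurd h.symm (hne _ _)
      · push Not at h2
        rw [hneg s h1, hneg s' h2] at h
        exact Fin.natAdd_injective r r h
  refine ⟨⟨f, hinj⟩, fun p s => ⟨hpos p s, fun h => ?_⟩, hneg⟩
  by_contra hc
  by_cases h1 : ∃ p, T p = T' s
  · obtain ⟨p', hp'⟩ := h1
    have := (hpos p' s hp').symm.trans h
    rw [Fin.castAdd_injective r r this] at hp'
    exact hc hp'
  · push Not at h1
    exact hne p s (h.symm.trans (hneg s h1))

open Classical in
/-- Whether two terms are in conflict can be decided on `2 r` qubits. -/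
theorem Hamiltonian.conflict_iff_det (H : Hamiltonian r n m) (i j : Fin m)
    {e : Fin r ↪ Fin (r + r)} (he : IsPattern (H.tuple i) (H.tuple j) e) :
    H.Conflict i j ↔
      (localOp (Fin.castAddEmb r) (H.op i) + localOp e (H.op j)).det ≠ 0 := by
  set T := H.tuple i with hT
  set T' := H.tuple j with hT'
  have hι : ∀ p : Fin r, (Fin.castAddEmb r : Fin r ↪ Fin (r + r)) p = Fin.castAdd r p := fun _ => rfl
  have hne : ∀ p s : Fin r, (Fin.castAdd r p : Fin (r + r)) ≠ Fin.natAdd r s := by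
    intro p s h
    have := congrArg Fin.val h
    simp at this; omega
  rw [ne_eq, ← exists_mulVec_eq_zero_iff, not_exists]
  constructor
  · rintro hc φ ⟨hφ0, hφ⟩
    have hpsd : ∀ b : Bool, (if b then localOp (Fin.castAddEmb r) (H.op i)
        else localOp e (H.op j) : Matrix (Bits (r + r)) (Bits (r + r)) ℂ).PosSemidef := by
      rintro (_ | _)
      · exact localOp_posSemidef _ (H.psd j)
      · exact localOp_posSemidef _ (H.psd i)
    have hsum : (∑ b : Bool, (if b then localOp (Fin.castAddEmb r) (H.op i)
        else localOp e (H.op j) : Matrix (Bits (r + r)) (Bits (r + r)) ℂ)) *ᵥ φ = 0 := by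
      simpa using hφ
    have h1 : localOp (Fin.castAddEmb r) (H.op i) *ᵥ φ = 0 := by
      simpa using sum_mulVec_eq_zero hpsd hsum (Finset.mem_univ true)
    have h2 : localOp e (H.op j) *ᵥ φ = 0 := by
      simpa using sum_mulVec_eq_zero hpsd hsum (Finset.mem_univ false)
    obtain ⟨w₀, hw₀⟩ := Function.ne_iff.1 hφ0
    set g : Bits n → Bits (r + r) := fun x => Fin.addCases (motive := fun _ => Fin 2)
      (fun p => x (T p)) fun s => if ∃ p, T p = T' s then w₀ (Fin.natAdd r s) else x (T' s) with hg
    have hgl : ∀ x p, g x (Fin.castAdd r p) = x (T p) := fun x p =>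
      Fin.addCases_left (motive := fun _ => Fin 2) p
    have hgr : ∀ x s, g x (Fin.natAdd r s) =
        if ∃ p, T p = T' s then w₀ (Fin.natAdd r s) else x (T' s) := fun x s =>
      Fin.addCases_right (motive := fun _ => Fin 2) s
    have hge : ∀ x s, g x (e s) = x (T' s) := by
      intro x s
      by_cases h : ∃ p, T p = T' s
      · obtain ⟨p, hp⟩ := h
        rw [(he.1 p s).1 hp, hgl, hp]
      · rw [he.2 s (by push Not at h; exact h), hgr, if_neg h]
    have hgT : ∀ z x, g (Function.extend T z x) = Function.extend (Fin.castAddEmb r) z (g x) := by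
      intro z x
      funext q
      refine Fin.addCases (fun p => ?_) (fun s => ?_) q
      · rw [hgl, extend_apply_tuple, ← hι, extend_apply_tuple]
      · have hn : ¬∃ p, (Fin.castAddEmb r : Fin r ↪ Fin (r + r)) p = Fin.natAdd r s := by
          rintro ⟨p, hp⟩; exact hne p s hp
        rw [hgr, Function.extend_apply' _ _ _ hn, hgr]
        split_ifs with h
        · rfl
        · rw [Function.extend_apply' _ _ _ h]
    have hgT' : ∀ z x, g (Function.extend T' z x) = Function.extend e z (g x) := by
      intro z x
      funext q
      by_cases hq : ∃ s, e s = q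
      · obtain ⟨s, rfl⟩ := hq
        rw [hge, extend_apply_tuple, extend_apply_tuple]
      · rw [Function.extend_apply' _ _ _ hq]
        revert hq
        refine Fin.addCases (fun p => ?_) (fun s => ?_) q <;> intro hq
        · rw [hgl, hgl, Function.extend_apply']
          rintro ⟨s, hs⟩
          exact hq ⟨s, (he.1 p s).1 hs.symm⟩
        · rw [hgr, hgr]
          split_ifs with h
          · rfl
          · exact absurd ⟨s, he.2 s (by push Not at h; exact h)⟩ hq
    have hψ := hc (φ ∘ g) (localOp_comp_eq_zero _ _ hgT h1) (localOp_comp_eq_zero _ _ hgT' h2)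
    refine hw₀ ?_
    set x : Bits n := Function.extend T (fun p => w₀ (Fin.castAdd r p))
      (Function.extend T' (fun s => w₀ (e s)) 0) with hx
    have hxT : ∀ p, x (T p) = w₀ (Fin.castAdd r p) := fun p => extend_apply_tuple _ _ _ p
    have hgx : g x = w₀ := by
      funext q
      refine Fin.addCases (fun p => ?_) (fun s => ?_) q
      · rw [hgl, hxT]
      · rw [hgr]
        split_ifs with h
        · rfl
        · rw [hx, Function.extend_apply' _ _ _ h, extend_apply_tuple,
            he.2 s (by push Not at h; exact h)]
    have := congrFun hψ x
    rwa [Function.comp, hgx] at this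
  · intro hdet ψ h1 h2
    by_contra hψ0
    obtain ⟨x₀, hx₀⟩ := Function.ne_iff.1 hψ0
    set g : Bits (r + r) → Bits n := fun w => Function.extend T (fun p => w (Fin.castAdd r p))
      (Function.extend T' (fun s => w (e s)) x₀) with hg
    have hgT : ∀ w p, g w (T p) = w (Fin.castAdd r p) := fun w p => extend_apply_tuple _ _ _ p
    have hgT' : ∀ w s, g w (T' s) = w (e s) := by
      intro w s
      by_cases h : ∃ p, T p = T' s
      · obtain ⟨p, hp⟩ := h
        rw [← hp, hgT, (he.1 p s).1 hp]
      · rw [hg]; simp only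
        rw [Function.extend_apply' _ _ _ h, extend_apply_tuple]
    have hgo : ∀ w q, (¬∃ p, T p = q) → (¬∃ s, T' s = q) → g w q = x₀ q := by
      intro w q h h'
      rw [hg]; simp only
      rw [Function.extend_apply' _ _ _ h, Function.extend_apply' _ _ _ h']
    have hc1 : ∀ z w, g (Function.extend (Fin.castAddEmb r) z w) = Function.extend T z (g w) := by
      intro z w
      funext q
      by_cases h : ∃ p, T p = q
      · obtain ⟨p, rfl⟩ := h
        rw [hgT, extend_apply_tuple, ← hι, extend_apply_tuple]
      · rw [Function.extend_apply' _ _ _ h]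
        by_cases h' : ∃ s, T' s = q
        · obtain ⟨s, rfl⟩ := h'
          rw [hgT', hgT', Function.extend_apply']
          rintro ⟨p, hp⟩
          exact h ⟨p, (he.1 p s).2 hp.symm⟩
        · rw [hgo _ _ h h', hgo _ _ h h']
    have hc2 : ∀ z w, g (Function.extend e z w) = Function.extend T' z (g w) := by
      intro z w
      funext q
      by_cases h' : ∃ s, T' s = q
      · obtain ⟨s, rfl⟩ := h'
        rw [hgT', extend_apply_tuple, extend_apply_tuple]
      · rw [Function.extend_apply' _ _ _ h']
        by_cases h : ∃ p, T p = q
        · obtain ⟨p, rfl⟩ := h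
          rw [hgT, hgT, Function.extend_apply']
          rintro ⟨s, hs⟩
          exact h' ⟨s, ((he.1 p s).2 hs).symm⟩
        · rw [hgo _ _ h h', hgo _ _ h h']
    refine hdet (ψ ∘ g) ⟨fun h0 => hx₀ ?_, ?_⟩
    · set w : Bits (r + r) := Fin.addCases (motive := fun _ => Fin 2) (fun p => x₀ (T p))
        fun s => x₀ (T' s) with hw
      have hwl : ∀ p, w (Fin.castAdd r p) = x₀ (T p) := fun p =>
        Fin.addCases_left (motive := fun _ => Fin 2) p
      have hgw : g w = x₀ := by
        funext q
        by_cases h : ∃ p, T p = q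
        · obtain ⟨p, rfl⟩ := h
          rw [hgT, hwl]
        · by_cases h' : ∃ s, T' s = q
          · obtain ⟨s, rfl⟩ := h'
            rw [hgT', he.2 s (by push Not at h; exact h)]
            exact Fin.addCases_right (motive := fun _ => Fin 2) s
          · rw [hgo _ _ h h']
      have := congrFun h0 w
      rwa [Function.comp, hgw] at this
    · rw [add_mulVec, localOp_comp_eq_zero _ _ hc1 h1, localOp_comp_eq_zero _ _ hc2 h2, add_zero]

end Determinant

end QHam

/-! ## Programs with polynomial running time

A number of steps is polynomial if it is polynomial in the integer variable `2`, which bounds all loops. -/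

namespace RealRAM

/-- From every state `s` the program halts, after polynomially many steps, in a state `s'` such that
`Q s s'`. -/
def Runs (P : Program) (Q : State → State → Prop) : Prop :=
  ∃ A a : ℕ, ∀ s, ∃ s' t, Exec P s s' t ∧ Q s s' ∧ t ≤ A * (s.natVar 2 + 1) ^ a

theorem Runs.mono {P : Program} {Q Q' : State → State → Prop} (h : Runs P Q)
    (hQ : ∀ s s', Q s s' → Q' s s') : Runs P Q' := by
  obtain ⟨A, a, h⟩ := h
  refine ⟨A, a, fun s => ?_⟩
  obtain ⟨s', t, h1, h2, h3⟩ := h s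
  exact ⟨s', t, h1, hQ _ _ h2, h3⟩

theorem Runs.instr (i : Instr) : Runs (.instr i) fun s s' => s' = i.apply s :=
  ⟨1, 0, fun s => ⟨_, 1, .instr i s, rfl, by simp⟩⟩

theorem Runs.skip : Runs .skip fun s s' => s' = s :=
  ⟨1, 0, fun s => ⟨_, 1, .skip s, rfl, by simp⟩⟩

theorem add_mul_pow_le (A B x a b : ℕ) :
    A * (x + 1) ^ a + B * (x + 1) ^ b ≤ (A + B) * (x + 1) ^ (a + b) := by
  have h1 : (x + 1) ^ a ≤ (x + 1) ^ (a + b) := Nat.pow_le_pow_right (Nat.succ_pos x) (by omega)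
  have h2 : (x + 1) ^ b ≤ (x + 1) ^ (a + b) := Nat.pow_le_pow_right (Nat.succ_pos x) (by omega)
  rw [add_mul]
  exact add_le_add (Nat.mul_le_mul_left A h1) (Nat.mul_le_mul_left B h2)

theorem Runs.seq {P P' : Program} {Q Q' : State → State → Prop} (h : Runs P Q) (h' : Runs P' Q')
    (hQ : ∀ s s', Q s s' → s'.natVar 2 = s.natVar 2) :
    Runs (.seq P P') fun s s'' => ∃ s', Q s s' ∧ Q' s' s'' := by
  obtain ⟨A, a, h⟩ := h
  obtain ⟨B, b, h'⟩ := h'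
  refine ⟨A + B, a + b, fun s => ?_⟩
  obtain ⟨s', t, h1, h2, h3⟩ := h s
  obtain ⟨s'', t', h1', h2', h3'⟩ := h' s'
  rw [hQ _ _ h2] at h3'
  exact ⟨s'', t + t', .seq h1 h1', ⟨s', h2, h2'⟩, (add_le_add h3 h3').trans (add_mul_pow_le ..)⟩

theorem Runs.ite {P P' : Program} {Q Q' : State → State → Prop} (b : Test) (h : Runs P Q)
    (h' : Runs P' Q') :
    Runs (.ite b P P') fun s s' => (b.Holds s → Q s s') ∧ (¬b.Holds s → Q' s s') := by
  obtain ⟨A, a, h⟩ := h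
  obtain ⟨B, c, h'⟩ := h'
  refine ⟨A + B + 1, a + c, fun s => ?_⟩
  have hle := add_mul_pow_le A B (s.natVar 2) a c
  have hpos : 1 ≤ (s.natVar 2 + 1) ^ (a + c) := Nat.one_le_pow _ _ (Nat.succ_pos _)
  by_cases hb : b.Holds s
  · obtain ⟨s', t, h1, h2, h3⟩ := h s
    refine ⟨s', t + 1, .iteTrue hb h1, ⟨fun _ => h2, fun hn => absurd hb hn⟩, ?_⟩
    rw [add_mul (A + B)]; omega
  · obtain ⟨s', t, h1, h2, h3⟩ := h' s
    refine ⟨s', t + 1, .iteFalse hb h1, ⟨fun hn => absurd hn hb, fun _ => h2⟩, ?_⟩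
    rw [add_mul (A + B)]; omega

/-- The effect of increasing the counter `x`, with the help of the variable `y`. -/
noncomputable def incr (x y : ℕ) (s : State) : State :=
  (Instr.natAdd x x y).apply ((Instr.natConst y 1).apply s)

/-- Run `P` with the counter `x` running through the numbers smaller than the value of the integer
variable `2`. -/
def forLoop (x y : ℕ) (P : Program) : Program :=
  .seq (.instr (.natConst x 0))
    (.loop (.natLt x 2) (.seq P (.seq (.instr (.natConst y 1)) (.instr (.natAdd x x y)))))

/-- The state `s'` is reached from `s` by a loop over `x` with the body `Q`. -/
def LoopPost (x y : ℕ) (Q : State → State → Prop) (s s' : State) : Prop :=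
  ∃ f : ℕ → State, f 0 = (Instr.natConst x 0).apply s ∧ f (s.natVar 2) = s' ∧
    ∀ i < s.natVar 2, (f i).natVar x = i ∧ ∃ s₁, Q (f i) s₁ ∧ f (i + 1) = incr x y s₁

theorem exec_loop {x y : ℕ} {P : Program} {Q : State → State → Prop} {A a : ℕ}
    (h : ∀ s, ∃ s' t, Exec P s s' t ∧ Q s s' ∧ t ≤ A * (s.natVar 2 + 1) ^ a) (hx : x ≠ 2)
    (hy : y ≠ 2) (hxy : x ≠ y)
    (hQ : ∀ s s', Q s s' → s'.natVar 2 = s.natVar 2 ∧ s'.natVar x = s.natVar x) (d : ℕ) :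
    ∀ s, s.natVar x + d = s.natVar 2 → ∃ (s' : State) (t : ℕ) (f : ℕ → State),
      Exec (.loop (.natLt x 2) (.seq P (.seq (.instr (.natConst y 1)) (.instr (.natAdd x x y)))))
        s s' t ∧ f 0 = s ∧ f d = s' ∧
      (∀ i < d, (f i).natVar x = s.natVar x + i ∧ ∃ s₁, Q (f i) s₁ ∧ f (i + 1) = incr x y s₁) ∧
      t ≤ d * (A * (s.natVar 2 + 1) ^ a + 3) + 1 := by
  induction d with
  | zero =>
    intro s hs
    refine ⟨s, 1, fun _ => s, .loopFalse ?_, rfl, rfl, by simp, by simp⟩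
    simp only [Test.Holds]; omega
  | succ d ih =>
    intro s hs
    obtain ⟨s₁, t, h1, h2, h3⟩ := h s
    obtain ⟨q1, q2⟩ := hQ _ _ h2
    have e1 : (incr x y s₁).natVar x = s.natVar x + 1 := by
      simp [incr, Instr.apply, Function.update_of_ne hxy, q2]
    have e2 : (incr x y s₁).natVar 2 = s.natVar 2 := by
      simp [incr, Instr.apply, Function.update_of_ne hx.symm, Function.update_of_ne hy.symm, q1]
    obtain ⟨s', t', f, g1, g2, g3, g4, g5⟩ := ih (incr x y s₁) (by rw [e1, e2]; omega)
    refine ⟨s', t + (1 + 1) + t' + 1, fun i => Nat.casesOn i s f, .loopTrue ?_ (.seq h1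
      (.seq (.instr _ _) (.instr _ _))) g1, rfl, g3, ?_, ?_⟩
    · simp only [Test.Holds]; omega
    · intro i hi
      cases i with
      | zero => exact ⟨rfl, s₁, h2, g2⟩
      | succ i =>
        obtain ⟨k1, k2⟩ := g4 i (by omega)
        exact ⟨by rw [k1, e1]; omega, k2⟩
    · rw [e2] at g5
      rw [add_mul d]; omega

theorem Runs.forLoop {x y : ℕ} {P : Program} {Q : State → State → Prop} (h : Runs P Q) (hx : x ≠ 2)
    (hy : y ≠ 2) (hxy : x ≠ y)
    (hQ : ∀ s s', Q s s' → s'.natVar 2 = s.natVar 2 ∧ s'.natVar x = s.natVar x) :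
    Runs (forLoop x y P) (LoopPost x y Q) := by
  obtain ⟨A, a, h⟩ := h
  refine ⟨A + 5, a + 1, fun s => ?_⟩
  have e : ((Instr.natConst x 0).apply s).natVar 2 = s.natVar 2 := by
    simp [Instr.apply, Function.update_of_ne hx.symm]
  have e0 : ((Instr.natConst x 0).apply s).natVar x = 0 := by simp [Instr.apply]
  obtain ⟨s', t, f, g1, g2, g3, g4, g5⟩ := exec_loop h hx hy hxy hQ (s.natVar 2)
    ((Instr.natConst x 0).apply s) (by rw [e, e0]; omega)
  refine ⟨s', 1 + t, .seq (.instr _ _) g1, ⟨f, g2, g3, fun i hi => ?_⟩, ?_⟩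
  · obtain ⟨k1, k2⟩ := g4 i hi
    exact ⟨by rw [k1, e0]; omega, k2⟩
  · rw [e] at g5
    have hp : 1 ≤ (s.natVar 2 + 1) ^ a := Nat.one_le_pow _ _ (Nat.succ_pos _)
    set X := (s.natVar 2 + 1) ^ a with hX
    have : (A + 5) * (s.natVar 2 + 1) ^ (a + 1) = (A + 5) * X * s.natVar 2 + (A + 5) * X := by
      rw [pow_succ]; ring
    rw [this]
    have h1 : s.natVar 2 * (A * X + 3) ≤ (A + 5) * X * s.natVar 2 := by
      rw [mul_comm]
      refine Nat.mul_le_mul_right _ ?_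
      nlinarith
    nlinarith

/-! ### Expressions

Expressions may use the integer and real variables `0, 1, 2`, and the variables below `10` are
available to programs; an expression in a context with `k`
bound variables keeps these in the variables `10 + 2 j`, `j < k`, and is evaluated with the temporary
variables `11 + 2 j`. -/

/-- The variables that an evaluation must not change. -/
def Protected (k e x : ℕ) : Prop :=
  x < 10 ∨ (x % 2 = 0 ∧ x < 10 + 2 * k) ∨ (x % 2 = 1 ∧ x < 11 + 2 * e)

/-- The states `s` and `s'` agree on all arrays, on the coins and on the protected variables. -/
structure Agree (k e : ℕ) (s s' : State) : Prop where
  nat : ∀ x, Protected k e x → s'.natVar x = s.natVar x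
  real : ∀ x, Protected k e x → s'.realVar x = s.realVar x
  natArr : s'.natArr = s.natArr
  realArr : s'.realArr = s.realArr
  coins : s'.coins = s.coins

namespace Agree

variable {k e k' e' : ℕ} {s s' s'' : State}

theorem trans (h : Agree k e s s') (h' : Agree k e s' s'') : Agree k e s s'' :=
  ⟨fun x hx => (h'.nat x hx).trans (h.nat x hx), fun x hx => (h'.real x hx).trans (h.real x hx),
    h'.natArr.trans h.natArr, h'.realArr.trans h.realArr, h'.coins.trans h.coins⟩

theorem mono (h : Agree k' e' s s') (hk : k ≤ k') (he : e ≤ e') : Agree k e s s' := by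
  have : ∀ x, Protected k e x → Protected k' e' x := fun x hx => by
    unfold Protected at *; omega
  exact ⟨fun x hx => h.nat x (this x hx), fun x hx => h.real x (this x hx), h.natArr, h.realArr,
    h.coins⟩

theorem updateNat (s : State) {x : ℕ} (v : ℕ) (hx : ¬Protected k e x) :
    Agree k e s { s with natVar := Function.update s.natVar x v } :=
  ⟨fun y hy => Function.update_of_ne (by rintro rfl; exact hx hy) _ _, fun _ _ => rfl, rfl, rfl, rfl⟩

theorem updateReal (s : State) {x : ℕ} (v : ℝ) (hx : ¬Protected k e x) :
    Agree k e s { s with realVar := Function.update s.realVar x v } :=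
  ⟨fun _ _ => rfl, fun y hy => Function.update_of_ne (by rintro rfl; exact hx hy) _ _, rfl, rfl, rfl⟩

theorem two (h : Agree k e s s') : s'.natVar 2 = s.natVar 2 :=
  h.nat 2 (Or.inl (by norm_num))

theorem natTmp (h : Agree k e s s') {j : ℕ} (hj : j < e) :
    s'.natVar (11 + 2 * j) = s.natVar (11 + 2 * j) :=
  h.nat _ (by unfold Protected; omega)

theorem realTmp (h : Agree k e s s') {j : ℕ} (hj : j < e) :
    s'.realVar (11 + 2 * j) = s.realVar (11 + 2 * j) :=
  h.real _ (by unfold Protected; omega)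

end Agree

theorem not_protected_tmp {k e j : ℕ} (h : e ≤ j) : ¬Protected k e (11 + 2 * j) := by
  unfold Protected; omega

/-- The part of a state on which the values of expressions depend.  The real array `2` is hidden: it is
written while expressions are evaluated. -/
structure Env where
  natVar : ℕ → ℕ
  realVar : ℕ → ℝ
  natArr : ℕ → ℕ → ℕ
  realArr : ℕ → ℕ → ℝ

noncomputable def State.env (s : State) : Env where
  natVar x := if x < 3 then s.natVar x else 0
  realVar x := if x < 3 then s.realVar x else 0
  natArr := s.natArr
  realArr A := if A = 2 then 0 else s.realArr A

theorem Agree.env {k e : ℕ} {s s' : State} (h : Agree k e s s') : s'.env = s.env := by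
  simp only [State.env, h.natArr, h.realArr, Env.mk.injEq, and_true]
  constructor <;> funext x <;> split_ifs with hx
  · exact h.nat x (Or.inl (by omega))
  · rfl
  · exact h.real x (Or.inl (by omega))
  · rfl

/-- A context with `k` bound variables: a way to read off a value of type `Γ` from a state. -/
structure Ctx (k : ℕ) (Γ : Type) where
  read : State → Γ
  env : Γ → Env
  env_read : ∀ s, env (read s) = s.env
  agree : ∀ s s', Agree k 0 s s' → read s' = read s

/-- The context without bound variables. -/
noncomputable def Ctx.base : Ctx 0 Env :=
  ⟨State.env, id, fun _ => rfl, fun _ _ h => h.env⟩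

variable {k : ℕ} {Γ : Type}

/-- The extension of a context by the variable `10 + 2 k'`. -/
def Ctx.ext (c : Ctx k Γ) (k' : ℕ) (hk : k ≤ k') : Ctx (k' + 1) (Γ × ℕ) where
  read s := (c.read s, s.natVar (10 + 2 * k'))
  env γ := c.env γ.1
  env_read s := c.env_read s
  agree s s' h := by
    rw [c.agree s s' (h.mono (by omega) le_rfl), h.nat _ (by unfold Protected; omega)]

theorem Ctx.read_eq (c : Ctx k Γ) {k' e : ℕ} (hk : k ≤ k') {s s' : State} (h : Agree k' e s s') :
    c.read s' = c.read s :=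
  c.agree s s' (h.mono hk (Nat.zero_le e))

/-- The integer expression `F` can be evaluated in polynomial time. -/
def NatE (c : Ctx k Γ) (F : Γ → ℕ) : Prop :=
  ∀ k' ≥ k, ∀ e, ∃ P, Runs P fun s s' => Agree k' e s s' ∧ s'.natVar (11 + 2 * e) = F (c.read s)

/-- The real expression `F` can be evaluated in polynomial time. -/
def RealE (c : Ctx k Γ) (F : Γ → ℝ) : Prop :=
  ∀ k' ≥ k, ∀ e, ∃ P, Runs P fun s s' => Agree k' e s s' ∧ s'.realVar (11 + 2 * e) = F (c.read s)

open Classical in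
/-- The condition `p` can be tested in polynomial time. -/
def BoolE (c : Ctx k Γ) (p : Γ → Prop) : Prop := NatE c fun γ => if p γ then 1 else 0

/-- The loop bound. -/
def Ctx.lim (c : Ctx k Γ) (γ : Γ) : ℕ := (c.env γ).natVar 2

theorem Ctx.lim_read (c : Ctx k Γ) (s : State) : c.lim (c.read s) = s.natVar 2 := by
  rw [lim, env_read]; rfl

variable {c : Ctx k Γ}

theorem NatE.of_instr {F : Γ → ℕ} (i : ℕ → Instr) (v : State → ℕ)
    (hi : ∀ x s, (i x).apply s = { s with natVar := Function.update s.natVar x (v s) })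
    (hv : ∀ s, v s = F (c.read s)) : NatE c F := fun k' _ e =>
  ⟨.instr (i (11 + 2 * e)), (Runs.instr _).mono fun s s' h => by
    rw [h, hi]
    exact ⟨Agree.updateNat s _ (not_protected_tmp le_rfl), by simp [hv]⟩⟩

theorem RealE.of_instr {F : Γ → ℝ} (i : ℕ → Instr) (v : State → ℝ)
    (hi : ∀ x s, (i x).apply s = { s with realVar := Function.update s.realVar x (v s) })
    (hv : ∀ s, v s = F (c.read s)) : RealE c F := fun k' _ e =>
  ⟨.instr (i (11 + 2 * e)), (Runs.instr _).mono fun s s' h => by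
    rw [h, hi]
    exact ⟨Agree.updateReal s _ (not_protected_tmp le_rfl), by simp [hv]⟩⟩

theorem NatE.const (a : ℕ) : NatE c fun _ => a :=
  .of_instr (fun x => .natConst x a) (fun _ => a) (fun _ _ => rfl) fun _ => rfl

theorem RealE.const (a : ℕ) : RealE c fun _ => (a : ℝ) :=
  .of_instr (fun x => .realConst x a) (fun _ => a) (fun _ _ => rfl) fun _ => rfl

/-- Evaluate two integer expressions and combine the results. -/
theorem NatE.binary {F G : Γ → ℕ} {H : Γ → ℕ} (hF : NatE c F) (hG : NatE c G)
    (i : ℕ → ℕ → ℕ → Instr) (v : ℕ → ℕ → ℕ)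
    (hi : ∀ x y z s, (i x y z).apply s =
      { s with natVar := Function.update s.natVar x (v (s.natVar y) (s.natVar z)) })
    (hv : ∀ γ, v (F γ) (G γ) = H γ) : NatE c H := by
  intro k' hk e
  obtain ⟨P, hP⟩ := hF k' hk e
  obtain ⟨P', hP'⟩ := hG k' hk (e + 1)
  refine ⟨.seq P (.seq P' (.instr (i (11 + 2 * e) (11 + 2 * e) (11 + 2 * (e + 1))))),
    (hP.seq (hP'.seq (Runs.instr _) fun _ _ h => h.1.two) fun _ _ h => h.1.two).mono ?_⟩
  rintro s s' ⟨s₁, ⟨a1, v1⟩, s₂, ⟨a2, v2⟩, rfl⟩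
  have a3 := a1.trans (a2.mono le_rfl (Nat.le_succ e))
  rw [hi, a2.natTmp (Nat.lt_succ_self e), v1, v2, c.read_eq hk a1, hv]
  exact ⟨a3.trans (Agree.updateNat s₂ _ (not_protected_tmp le_rfl)), by simp⟩

theorem NatE.add {F G : Γ → ℕ} (hF : NatE c F) (hG : NatE c G) : NatE c fun γ => F γ + G γ :=
  hF.binary hG .natAdd (· + ·) (fun _ _ _ _ => rfl) fun _ => rfl

/-- Evaluate two real expressions and combine the results. -/
theorem RealE.binary {F G : Γ → ℝ} {H : Γ → ℝ} (hF : RealE c F) (hG : RealE c G)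
    (i : ℕ → ℕ → ℕ → Instr) (v : ℝ → ℝ → ℝ)
    (hi : ∀ x y z s, (i x y z).apply s =
      { s with realVar := Function.update s.realVar x (v (s.realVar y) (s.realVar z)) })
    (hv : ∀ γ, v (F γ) (G γ) = H γ) : RealE c H := by
  intro k' hk e
  obtain ⟨P, hP⟩ := hF k' hk e
  obtain ⟨P', hP'⟩ := hG k' hk (e + 1)
  refine ⟨.seq P (.seq P' (.instr (i (11 + 2 * e) (11 + 2 * e) (11 + 2 * (e + 1))))),
    (hP.seq (hP'.seq (Runs.instr _) fun _ _ h => h.1.two) fun _ _ h => h.1.two).mono ?_⟩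
  rintro s s' ⟨s₁, ⟨a1, v1⟩, s₂, ⟨a2, v2⟩, rfl⟩
  have a3 := a1.trans (a2.mono le_rfl (Nat.le_succ e))
  rw [hi, a2.realTmp (Nat.lt_succ_self e), v1, v2, c.read_eq hk a1, hv]
  exact ⟨a3.trans (Agree.updateReal s₂ _ (not_protected_tmp le_rfl)), by simp⟩

theorem RealE.add {F G : Γ → ℝ} (hF : RealE c F) (hG : RealE c G) : RealE c fun γ => F γ + G γ :=
  hF.binary hG .realAdd (· + ·) (fun _ _ _ _ => rfl) fun _ => rfl

theorem RealE.sub {F G : Γ → ℝ} (hF : RealE c F) (hG : RealE c G) : RealE c fun γ => F γ - G γ :=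
  hF.binary hG .realSub (· - ·) (fun _ _ _ _ => rfl) fun _ => rfl

theorem RealE.mul {F G : Γ → ℝ} (hF : RealE c F) (hG : RealE c G) : RealE c fun γ => F γ * G γ :=
  hF.binary hG .realMul (· * ·) (fun _ _ _ _ => rfl) fun _ => rfl

theorem RealE.div {F G : Γ → ℝ} (hF : RealE c F) (hG : RealE c G) : RealE c fun γ => F γ / G γ :=
  hF.binary hG .realDiv (· / ·) (fun _ _ _ _ => rfl) fun _ => rfl

theorem NatE.var (x : ℕ) (hx : x < 3) : NatE c fun γ => (c.env γ).natVar x := by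
  have h0 : NatE c fun _ => 0 := .const 0
  intro k' hk e
  refine ⟨.seq (.instr (.natConst (11 + 2 * e) 0)) (.instr (.natAdd (11 + 2 * e) x (11 + 2 * e))),
    ((Runs.instr _).seq (Runs.instr _) ?_).mono ?_⟩
  · rintro s s' rfl; simp [Instr.apply, Function.update_of_ne (show (2 : ℕ) ≠ 11 + 2 * e by omega)]
  · rintro s s' ⟨s₁, rfl, rfl⟩
    refine ⟨(Agree.updateNat s 0 (not_protected_tmp le_rfl)).trans
      (Agree.updateNat _ _ (not_protected_tmp le_rfl)), ?_⟩
    simp [Instr.apply, Function.update_of_ne (show x ≠ 11 + 2 * e by omega), c.env_read, State.env,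
      hx]

theorem RealE.var (x : ℕ) (hx : x < 3) : RealE c fun γ => (c.env γ).realVar x := by
  intro k' hk e
  refine ⟨.seq (.instr (.realConst (11 + 2 * e) 0))
    (.instr (.realAdd (11 + 2 * e) x (11 + 2 * e))),
    ((Runs.instr _).seq (Runs.instr _) ?_).mono ?_⟩
  · rintro s s' rfl; simp [Instr.apply]
  · rintro s s' ⟨s₁, rfl, rfl⟩
    refine ⟨(Agree.updateReal s _ (not_protected_tmp le_rfl)).trans
      (Agree.updateReal _ _ (not_protected_tmp le_rfl)), ?_⟩
    simp [Instr.apply, Function.update_of_ne (show x ≠ 11 + 2 * e by omega), c.env_read, State.env,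
      hx]

theorem NatE.bound (k' : ℕ) (hk : k ≤ k') : NatE (c.ext k' hk) fun γ => γ.2 := by
  intro k'' hk'' e
  refine ⟨.seq (.instr (.natConst (11 + 2 * e) 0))
    (.instr (.natAdd (11 + 2 * e) (10 + 2 * k') (11 + 2 * e))),
    ((Runs.instr _).seq (Runs.instr _) ?_).mono ?_⟩
  · rintro s s' rfl; simp [Instr.apply, Function.update_of_ne (show (2 : ℕ) ≠ 11 + 2 * e by omega)]
  · rintro s s' ⟨s₁, rfl, rfl⟩
    refine ⟨(Agree.updateNat s 0 (not_protected_tmp le_rfl)).trans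
      (Agree.updateNat _ _ (not_protected_tmp le_rfl)), ?_⟩
    simp [Instr.apply, Function.update_of_ne (show 10 + 2 * k' ≠ 11 + 2 * e by omega), Ctx.ext]

theorem NatE.ext {F : Γ → ℕ} (h : NatE c F) (k' : ℕ) (hk : k ≤ k') :
    NatE (c.ext k' hk) fun γ => F γ.1 :=
  fun k'' hk'' e => h k'' (by omega) e

theorem RealE.ext {F : Γ → ℝ} (h : RealE c F) (k' : ℕ) (hk : k ≤ k') :
    RealE (c.ext k' hk) fun γ => F γ.1 :=
  fun k'' hk'' e => h k'' (by omega) e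

theorem NatE.load {F : Γ → ℕ} (A : ℕ) (hF : NatE c F) :
    NatE c fun γ => (c.env γ).natArr A (F γ) := by
  intro k' hk e
  obtain ⟨P, hP⟩ := hF k' hk e
  refine ⟨.seq P (.instr (.natLoad (11 + 2 * e) A (11 + 2 * e))),
    (hP.seq (Runs.instr _) fun _ _ h => h.1.two).mono ?_⟩
  rintro s s' ⟨s₁, ⟨a1, v1⟩, rfl⟩
  refine ⟨a1.trans (Agree.updateNat s₁ _ (not_protected_tmp le_rfl)), ?_⟩
  simp [Instr.apply, v1, a1.natArr, c.env_read, State.env]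

theorem NatE.realLoad {F : Γ → ℕ} (A : ℕ) (hA : A ≠ 2) (hF : NatE c F) :
    RealE c fun γ => (c.env γ).realArr A (F γ) := by
  intro k' hk e
  obtain ⟨P, hP⟩ := hF k' hk e
  refine ⟨.seq P (.instr (.realLoad (11 + 2 * e) A (11 + 2 * e))),
    (hP.seq (Runs.instr _) fun _ _ h => h.1.two).mono ?_⟩
  rintro s s' ⟨s₁, ⟨a1, v1⟩, rfl⟩
  refine ⟨a1.trans (Agree.updateReal s₁ _ (not_protected_tmp le_rfl)), ?_⟩
  simp [Instr.apply, v1, a1.realArr, c.env_read, State.env, hA]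

open Classical in
/-- Branch on a condition. -/
theorem BoolE.runs_ite {p : Γ → Prop} (hp : BoolE c p) {k' e : ℕ} (hk : k ≤ k') {P P' : Program}
    {Q Q' : State → State → Prop} (hP : Runs P Q) (hP' : Runs P' Q') :
    ∃ R, Runs R fun s s' => ∃ s₁, Agree k' e s s₁ ∧
      (p (c.read s) → Q s₁ s') ∧ (¬p (c.read s) → Q' s₁ s') := by
  obtain ⟨P₀, h0⟩ := hp k' hk e
  refine ⟨.seq P₀ (.seq (.instr (.natConst (11 + 2 * (e + 1)) 0))
    (.ite (.natLt (11 + 2 * (e + 1)) (11 + 2 * e)) P P')),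
    (h0.seq ((Runs.instr _).seq (Runs.ite _ hP hP') ?_) fun _ _ h => h.1.two).mono ?_⟩
  · rintro s s' rfl
    simp [Instr.apply, Function.update_of_ne (show (2 : ℕ) ≠ 11 + 2 * (e + 1) by omega)]
  · rintro s s' ⟨s₁, ⟨a1, v1⟩, s₂, rfl, h1, h2⟩
    have hh : (Test.natLt (11 + 2 * (e + 1)) (11 + 2 * e)).Holds
        ((Instr.natConst (11 + 2 * (e + 1)) 0).apply s₁) ↔ p (c.read s) := by
      simp only [Test.Holds, Instr.apply, Function.update_self,
        Function.update_of_ne (show 11 + 2 * e ≠ 11 + 2 * (e + 1) by omega), v1]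
      split_ifs with h <;> simp [h]
    rw [hh] at h1 h2
    exact ⟨_, a1.trans (Agree.updateNat s₁ 0 (not_protected_tmp (Nat.le_succ e))), h1, h2⟩

theorem NatE.ite {p : Γ → Prop} {_ : ∀ γ, Decidable (p γ)} {F G : Γ → ℕ} (hp : BoolE c p) (hF : NatE c F) (hG : NatE c G) :
    NatE c fun γ => if p γ then F γ else G γ := by
  intro k' hk e
  obtain ⟨P, hP⟩ := hF k' hk e
  obtain ⟨P', hP'⟩ := hG k' hk e
  obtain ⟨R, hR⟩ := hp.runs_ite (e := e) hk hP hP'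
  refine ⟨R, hR.mono ?_⟩
  rintro s s' ⟨s₁, a1, h1, h2⟩
  rw [c.read_eq hk a1] at h1 h2
  beta_reduce
  split_ifs with h
  · exact ⟨a1.trans (h1 h).1, (h1 h).2⟩
  · exact ⟨a1.trans (h2 h).1, (h2 h).2⟩

theorem RealE.ite {p : Γ → Prop} {_ : ∀ γ, Decidable (p γ)} {F G : Γ → ℝ} (hp : BoolE c p) (hF : RealE c F) (hG : RealE c G) :
    RealE c fun γ => if p γ then F γ else G γ := by
  intro k' hk e
  obtain ⟨P, hP⟩ := hF k' hk e
  obtain ⟨P', hP'⟩ := hG k' hk e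
  obtain ⟨R, hR⟩ := hp.runs_ite (e := e) hk hP hP'
  refine ⟨R, hR.mono ?_⟩
  rintro s s' ⟨s₁, a1, h1, h2⟩
  rw [c.read_eq hk a1] at h1 h2
  beta_reduce
  split_ifs with h
  · exact ⟨a1.trans (h1 h).1, (h1 h).2⟩
  · exact ⟨a1.trans (h2 h).1, (h2 h).2⟩

open Classical in
/-- Evaluation of a comparison whose two sides have been evaluated. -/
theorem Runs.setTest {k e : ℕ} (b : Test) {P : Program} {p : State → Prop}
    (hP : Runs P fun s s' => Agree k e s s' ∧ (b.Holds s' ↔ p s)) :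
    ∃ R, Runs R fun s s' => Agree k e s s' ∧
      s'.natVar (11 + 2 * e) = if p s then 1 else 0 := by
  refine ⟨.seq P (.ite b (.instr (.natConst (11 + 2 * e) 1)) (.instr (.natConst (11 + 2 * e) 0))),
    (hP.seq (Runs.ite _ (Runs.instr _) (Runs.instr _)) fun _ _ h => h.1.two).mono ?_⟩
  rintro s s' ⟨s₁, ⟨a1, hb⟩, h1, h2⟩
  rw [hb] at h1 h2
  split_ifs with h
  · rw [h1 h]; exact ⟨a1.trans (Agree.updateNat s₁ 1 (not_protected_tmp le_rfl)), by simp [Instr.apply]⟩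
  · rw [h2 h]; exact ⟨a1.trans (Agree.updateNat s₁ 0 (not_protected_tmp le_rfl)), by simp [Instr.apply]⟩

theorem NatE.lt {F G : Γ → ℕ} (hF : NatE c F) (hG : NatE c G) : BoolE c fun γ => F γ < G γ := by
  intro k' hk e
  obtain ⟨P, hP⟩ := hF k' hk e
  obtain ⟨P', hP'⟩ := hG k' hk (e + 1)
  refine Runs.setTest (.natLt (11 + 2 * e) (11 + 2 * (e + 1)))
    ((hP.seq hP' fun _ _ h => h.1.two).mono (P := .seq P P') ?_)
  rintro s s' ⟨s₁, ⟨a1, v1⟩, a2, v2⟩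
  rw [c.read_eq hk a1] at v2
  exact ⟨a1.trans (a2.mono le_rfl (Nat.le_succ e)), by
    rw [Test.Holds, a2.natTmp (Nat.lt_succ_self e), v1, v2]⟩

theorem RealE.lt {F G : Γ → ℝ} (hF : RealE c F) (hG : RealE c G) :
    BoolE c fun γ => F γ < G γ := by
  intro k' hk e
  obtain ⟨P, hP⟩ := hF k' hk e
  obtain ⟨P', hP'⟩ := hG k' hk (e + 1)
  refine Runs.setTest (.realLt (11 + 2 * e) (11 + 2 * (e + 1)))
    ((hP.seq hP' fun _ _ h => h.1.two).mono (P := .seq P P') ?_)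
  rintro s s' ⟨s₁, ⟨a1, v1⟩, a2, v2⟩
  rw [c.read_eq hk a1] at v2
  exact ⟨a1.trans (a2.mono le_rfl (Nat.le_succ e)), by
    rw [Test.Holds, a2.realTmp (Nat.lt_succ_self e), v1, v2]⟩

theorem BoolE.congr {p q : Γ → Prop} (hp : BoolE c p) (h : ∀ γ, p γ ↔ q γ) : BoolE c q := by
  rwa [show q = p from funext fun γ => propext (h γ).symm]

theorem BoolE.not {p : Γ → Prop} (hp : BoolE c p) : BoolE c fun γ => ¬p γ := by
  classical
  have h : NatE c fun γ => if p γ then 0 else 1 := NatE.ite hp (.const 0) (.const 1)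
  rw [BoolE]
  convert h using 2 with γ
  by_cases h : p γ <;> simp [h]

theorem BoolE.and {p q : Γ → Prop} (hp : BoolE c p) (hq : BoolE c q) :
    BoolE c fun γ => p γ ∧ q γ := by
  classical
  have h : NatE c fun γ => if p γ then (if q γ then 1 else 0) else 0 := NatE.ite hp hq (.const 0)
  rw [BoolE]
  convert h using 2 with γ
  by_cases h : p γ <;> simp [h]

theorem BoolE.or {p q : Γ → Prop} (hp : BoolE c p) (hq : BoolE c q) :
    BoolE c fun γ => p γ ∨ q γ :=
  (hp.not.and hq.not).not.congr fun γ => by tauto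

theorem BoolE.const (p : Prop) : BoolE c fun _ => p := by
  by_cases h : p
  · simpa [BoolE, h] using NatE.const (c := c) 1
  · simpa [BoolE, h] using NatE.const (c := c) 0

theorem BoolE.forall_finset {ι : Type*} (s : Finset ι) {p : ι → Γ → Prop}
    (hp : ∀ i, BoolE c (p i)) : BoolE c fun γ => ∀ i ∈ s, p i γ := by
  classical
  induction s using Finset.induction_on with
  | empty => exact (BoolE.const True).congr fun γ => by simp
  | insert i s _ ih => exact ((hp i).and ih).congr fun γ => by simp

theorem BoolE.forall_fintype {ι : Type*} [Fintype ι] {p : ι → Γ → Prop} (hp : ∀ i, BoolE c (p i)) :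
    BoolE c fun γ => ∀ i, p i γ :=
  (BoolE.forall_finset Finset.univ hp).congr fun γ => by simp

theorem BoolE.exists_fintype {ι : Type*} [Fintype ι] {p : ι → Γ → Prop} (hp : ∀ i, BoolE c (p i)) :
    BoolE c fun γ => ∃ i, p i γ :=
  (BoolE.forall_fintype fun i => (hp i).not).not.congr fun γ => by push Not; rfl

theorem NatE.eq {F G : Γ → ℕ} (hF : NatE c F) (hG : NatE c G) : BoolE c fun γ => F γ = G γ :=
  ((NatE.lt hF hG).not.and (NatE.lt hG hF).not).congr fun γ => by omega

theorem RealE.ne {F G : Γ → ℝ} (hF : RealE c F) (hG : RealE c G) :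
    BoolE c fun γ => F γ ≠ G γ :=
  ((RealE.lt hF hG).or (RealE.lt hG hF)).congr fun _ => ne_iff_lt_or_gt.symm

theorem RealE.finset_sum {ι : Type*} (s : Finset ι) {F : ι → Γ → ℝ} (hF : ∀ i, RealE c (F i)) :
    RealE c fun γ => ∑ i ∈ s, F i γ := by
  classical
  induction s using Finset.induction_on with
  | empty => simpa using RealE.const (c := c) 0
  | insert i s hi ih => simpa only [Finset.sum_insert hi] using (hF i).add ih

theorem NatE.const_mul {F : Γ → ℕ} (a : ℕ) (hF : NatE c F) : NatE c fun γ => a * F γ := by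
  induction a with
  | zero => simpa using NatE.const (c := c) 0
  | succ a ih => simpa only [Nat.succ_mul] using ih.add hF

/-- Evaluate a real expression for all values of a bound variable and combine the results. -/
theorem RealE.fold {F : Γ × ℕ → ℝ} (hF : ∀ k' (hk : k ≤ k'), RealE (c.ext k' hk) F)
    (a : ℕ) (op : ℕ → ℕ → ℕ → Instr) (v : ℝ → ℝ → ℝ)
    (hop : ∀ x y z s, (op x y z).apply s =
      { s with realVar := Function.update s.realVar x (v (s.realVar y) (s.realVar z)) })
    {H : Γ → ℕ → ℝ} (h0 : ∀ γ, H γ 0 = a) (hs : ∀ γ i, H γ (i + 1) = v (H γ i) (F (γ, i))) :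
    RealE c fun γ => H γ (c.lim γ) := by
  intro k' hk e
  obtain ⟨P, hP⟩ := hF k' hk (k' + 1) le_rfl (e + 1)
  have hbody := hP.seq (Runs.instr (op (11 + 2 * e) (11 + 2 * e) (11 + 2 * (e + 1))))
    fun _ _ h => h.1.two
  have hloop := hbody.forLoop (x := 10 + 2 * k') (y := 11 + 2 * (e + 1)) (by omega) (by omega)
    (by omega) (by
      rintro s s' ⟨s₁, ⟨a1, _⟩, rfl⟩
      rw [hop]
      exact ⟨a1.two, a1.nat _ (by unfold Protected; omega)⟩)
  refine ⟨_, ((Runs.instr (.realConst (11 + 2 * e) a)).seq hloop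
    (by rintro s s' rfl; rfl)).mono ?_⟩
  rintro s s' ⟨s₀, rfl, f, hf0, hfl, hf⟩
  set s₀ := (Instr.realConst (11 + 2 * e) a).apply s with hs₀
  have hl : s₀.natVar 2 = s.natVar 2 := rfl
  have hctr : ¬Protected k' e (10 + 2 * k') := by unfold Protected; omega
  have key : ∀ i ≤ s.natVar 2, Agree k' e s (f i) ∧
      (f i).realVar (11 + 2 * e) = H (c.read s) i := by
    intro i
    induction i with
    | zero =>
      intro _
      rw [hf0]
      refine ⟨(Agree.updateReal s _ (not_protected_tmp le_rfl)).trans (Agree.updateNat _ 0 hctr), ?_⟩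
      simp [Instr.apply, hs₀, h0]
    | succ i ih =>
      intro hi
      obtain ⟨a1, v1⟩ := ih (by omega)
      obtain ⟨hx, s₁, ⟨s₂, ⟨a2, v2⟩, rfl⟩, hfi⟩ := hf i (by rw [hl]; omega)
      rw [hfi, hop]
      have a2' := a2.mono (Nat.le_succ k') (Nat.le_succ e)
      refine ⟨a1.trans (a2'.trans ((Agree.updateReal s₂ _ (not_protected_tmp le_rfl)).trans
        ((Agree.updateNat _ 1 (not_protected_tmp (Nat.le_succ e))).trans
          (Agree.updateNat _ _ hctr)))), ?_⟩
      have hread : (c.ext k' hk).read (f i) = (c.read s, i) := by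
        simp only [Ctx.ext, hx, c.read_eq hk a1]
      rw [hread] at v2
      simp only [incr, Instr.apply, Function.update_self]
      rw [a2.realTmp (Nat.lt_succ_self e), v1, v2, hs]
  beta_reduce
  rw [c.lim_read, ← hfl, hl]
  exact key _ le_rfl

/-- Bounded sums of real expressions. -/
theorem RealE.sum {F : Γ × ℕ → ℝ} (hF : ∀ k' (hk : k ≤ k'), RealE (c.ext k' hk) F) :
    RealE c fun γ => ∑ i ∈ Finset.range (c.lim γ), F (γ, i) :=
  RealE.fold hF 0 .realAdd (· + ·) (fun _ _ _ _ => rfl)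
    (H := fun γ l => ∑ i ∈ Finset.range l, F (γ, i)) (by simp) fun γ i => Finset.sum_range_succ _ _

/-- Bounded products of real expressions. -/
theorem RealE.prod {F : Γ × ℕ → ℝ} (hF : ∀ k' (hk : k ≤ k'), RealE (c.ext k' hk) F) :
    RealE c fun γ => ∏ i ∈ Finset.range (c.lim γ), F (γ, i) :=
  RealE.fold hF 1 .realMul (· * ·) (fun _ _ _ _ => rfl)
    (H := fun γ l => ∏ i ∈ Finset.range l, F (γ, i)) (by simp) fun γ i => Finset.prod_range_succ _ _

/-- Bounded sums of integer expressions. -/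
theorem NatE.sum {F : Γ × ℕ → ℕ} (hF : ∀ k' (hk : k ≤ k'), NatE (c.ext k' hk) F) :
    NatE c fun γ => ∑ i ∈ Finset.range (c.lim γ), F (γ, i) := by
  intro k' hk e
  obtain ⟨P, hP⟩ := hF k' hk (k' + 1) le_rfl (e + 1)
  have hbody := hP.seq (Runs.instr (.natAdd (11 + 2 * e) (11 + 2 * e) (11 + 2 * (e + 1))))
    fun _ _ h => h.1.two
  have hloop := hbody.forLoop (x := 10 + 2 * k') (y := 11 + 2 * (e + 1)) (by omega) (by omega)
    (by omega) (by
      rintro s s' ⟨s₁, ⟨a1, _⟩, rfl⟩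
      simp only [Instr.apply, Function.update_of_ne (show (2 : ℕ) ≠ 11 + 2 * e by omega),
        Function.update_of_ne (show 10 + 2 * k' ≠ 11 + 2 * e by omega)]
      exact ⟨a1.two, a1.nat _ (by unfold Protected; omega)⟩)
  refine ⟨_, ((Runs.instr (.natConst (11 + 2 * e) 0)).seq hloop (by
    rintro s s' rfl
    simp [Instr.apply, Function.update_of_ne (show (2 : ℕ) ≠ 11 + 2 * e by omega)])).mono ?_⟩
  rintro s s' ⟨s₀, rfl, f, hf0, hfl, hf⟩
  set s₀ := (Instr.natConst (11 + 2 * e) 0).apply s with hs₀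
  have hl : s₀.natVar 2 = s.natVar 2 := by
    simp [hs₀, Instr.apply, Function.update_of_ne (show (2 : ℕ) ≠ 11 + 2 * e by omega)]
  have hctr : ¬Protected k' e (10 + 2 * k') := by unfold Protected; omega
  have key : ∀ i ≤ s.natVar 2, Agree k' e s (f i) ∧
      (f i).natVar (11 + 2 * e) = ∑ j ∈ Finset.range i, F (c.read s, j) := by
    intro i
    induction i with
    | zero =>
      intro _
      rw [hf0]
      refine ⟨(Agree.updateNat s _ (not_protected_tmp le_rfl)).trans (Agree.updateNat _ 0 hctr), ?_⟩
      simp [Instr.apply, hs₀, Function.update_of_ne (show 11 + 2 * e ≠ 10 + 2 * k' by omega)]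
    | succ i ih =>
      intro hi
      obtain ⟨a1, v1⟩ := ih (by omega)
      obtain ⟨hx, s₁, ⟨s₂, ⟨a2, v2⟩, rfl⟩, hfi⟩ := hf i (by rw [hl]; omega)
      rw [hfi]
      have a2' := a2.mono (Nat.le_succ k') (Nat.le_succ e)
      refine ⟨a1.trans (a2'.trans ((Agree.updateNat s₂ _ (not_protected_tmp le_rfl)).trans
        ((Agree.updateNat _ 1 (not_protected_tmp (Nat.le_succ e))).trans
          (Agree.updateNat _ _ hctr)))), ?_⟩
      have hread : (c.ext k' hk).read (f i) = (c.read s, i) := by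
        simp only [Ctx.ext, hx, c.read_eq hk a1]
      rw [hread] at v2
      simp only [incr, Instr.apply, Function.update_self,
        Function.update_of_ne (show 11 + 2 * e ≠ 10 + 2 * k' by omega),
        Function.update_of_ne (show 11 + 2 * e ≠ 11 + 2 * (e + 1) by omega)]
      rw [a2.natTmp (Nat.lt_succ_self e), v1, v2, Finset.sum_range_succ]
  beta_reduce
  rw [c.lim_read, ← hfl, hl]
  exact key _ le_rfl

end RealRAM

/-! ## Complex expressions and determinants -/

namespace RealRAM

variable {k : ℕ} {Γ : Type} {c : Ctx k Γ}

/-- The real and the imaginary part of `F` can be evaluated in polynomial time. -/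
def ComplexE (c : Ctx k Γ) (F : Γ → ℂ) : Prop :=
  RealE c (fun γ => (F γ).re) ∧ RealE c fun γ => (F γ).im

theorem RealE.ofReal {F : Γ → ℝ} (hF : RealE c F) : ComplexE c fun γ => (F γ : ℂ) := by
  refine ⟨by simpa using hF, by simpa using RealE.const 0⟩

theorem ComplexE.natCast (a : ℕ) : ComplexE c fun _ => (a : ℂ) := by
  simpa using (RealE.const a).ofReal (c := c)

theorem ComplexE.zero : ComplexE c fun _ => (0 : ℂ) := by
  simpa using ComplexE.natCast (c := c) 0

theorem ComplexE.add {F G : Γ → ℂ} (hF : ComplexE c F) (hG : ComplexE c G) :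
    ComplexE c fun γ => F γ + G γ :=
  ⟨by simpa using hF.1.add hG.1, by simpa using hF.2.add hG.2⟩

theorem ComplexE.sub {F G : Γ → ℂ} (hF : ComplexE c F) (hG : ComplexE c G) :
    ComplexE c fun γ => F γ - G γ :=
  ⟨by simpa using hF.1.sub hG.1, by simpa using hF.2.sub hG.2⟩

theorem ComplexE.mul {F G : Γ → ℂ} (hF : ComplexE c F) (hG : ComplexE c G) :
    ComplexE c fun γ => F γ * G γ :=
  ⟨by simpa using (hF.1.mul hG.1).sub (hF.2.mul hG.2),
    by simpa using (hF.1.mul hG.2).add (hF.2.mul hG.1)⟩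

theorem ComplexE.neg {F : Γ → ℂ} (hF : ComplexE c F) : ComplexE c fun γ => -F γ := by
  simpa using ComplexE.zero.sub hF

theorem ComplexE.finset_sum {ι : Type*} (s : Finset ι) {F : ι → Γ → ℂ}
    (hF : ∀ i, ComplexE c (F i)) : ComplexE c fun γ => ∑ i ∈ s, F i γ := by
  classical
  induction s using Finset.induction_on with
  | empty => simpa using ComplexE.zero
  | insert i s hi ih => simpa only [Finset.sum_insert hi] using (hF i).add ih

theorem ComplexE.finset_prod {ι : Type*} (s : Finset ι) {F : ι → Γ → ℂ}
    (hF : ∀ i, ComplexE c (F i)) : ComplexE c fun γ => ∏ i ∈ s, F i γ := by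
  classical
  induction s using Finset.induction_on with
  | empty => simpa using ComplexE.natCast 1
  | insert i s hi ih => simpa only [Finset.prod_insert hi] using (hF i).mul ih

theorem ComplexE.det {ι : Type*} [Fintype ι] [DecidableEq ι] {F : Γ → Matrix ι ι ℂ}
    (hF : ∀ a b, ComplexE c fun γ => F γ a b) : ComplexE c fun γ => (F γ).det := by
  simp only [Matrix.det_apply]
  refine ComplexE.finset_sum _ fun σ => ?_
  have h := ComplexE.finset_prod Finset.univ fun a => hF (σ a) a
  rcases Int.units_eq_one_or (Equiv.Perm.sign σ) with e | e
  · simpa [e] using h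
  · simpa [e] using h.neg

theorem ComplexE.ne_zero {F : Γ → ℂ} (hF : ComplexE c F) : BoolE c fun γ => F γ ≠ 0 :=
  ((hF.1.ne (RealE.const 0)).or (hF.2.ne (RealE.const 0))).congr fun γ => by
    simp [Complex.ext_iff]; tauto

/-! ### Sums over initial segments -/

/-- The sum of the values of `f` at the numbers smaller than `b`. -/
noncomputable def Env.sumLt (E : Env) (b : ℕ) (f : ℕ → ℝ) : ℝ :=
  ∑ i ∈ Finset.range (E.natVar 2), if i < b then f i else 0

theorem RealE.sumLt {B : Γ → ℕ} {F : Γ → ℕ → ℝ} (hB : NatE c B)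
    (hF : ∀ k' (hk : k ≤ k'), RealE (c.ext k' hk) fun γ => F γ.1 γ.2) :
    RealE c fun γ => (c.env γ).sumLt (B γ) (F γ) :=
  RealE.sum (c := c) (F := fun γ => if γ.2 < B γ.1 then F γ.1 γ.2 else 0) fun k' hk =>
    .ite ((NatE.bound k' hk).lt (hB.ext k' hk)) (hF k' hk) (by simpa using RealE.const 0)

theorem Env.sumLt_eq_range {E : Env} {b : ℕ} (hb : b ≤ E.natVar 2) (f : ℕ → ℝ) :
    E.sumLt b f = ∑ i ∈ Finset.range b, f i := by
  rw [sumLt, ← Finset.sum_filter]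
  congr 1
  ext i
  simp only [Finset.mem_filter, Finset.mem_range]
  omega

theorem Env.sumLt_eq {E : Env} {b : ℕ} (hb : b ≤ E.natVar 2) (f : ℕ → ℝ) :
    E.sumLt b f = ∑ i : Fin b, f i := by
  rw [E.sumLt_eq_range hb, Finset.sum_range]

/-- A natural number as a real number. -/
noncomputable def Env.cast (E : Env) (a : ℕ) : ℝ := E.sumLt a fun _ => 1

theorem NatE.cast {F : Γ → ℕ} (hF : NatE c F) : RealE c fun γ => (c.env γ).cast (F γ) :=
  RealE.sumLt hF fun _ _ => by simpa using RealE.const 1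

theorem Env.cast_eq {E : Env} {a : ℕ} (ha : a ≤ E.natVar 2) : E.cast a = a := by
  simp [cast, E.sumLt_eq_range ha]

/-- A power of `2`. -/
noncomputable def Env.pow (E : Env) (b : ℕ) : ℝ :=
  ∏ i ∈ Finset.range (E.natVar 2), if i < b then 2 else 1

theorem NatE.pow {F : Γ → ℕ} (hF : NatE c F) : RealE c fun γ => (c.env γ).pow (F γ) :=
  RealE.prod (c := c) (F := fun γ => if γ.2 < F γ.1 then 2 else 1) fun k' hk =>
    .ite ((NatE.bound k' hk).lt (hF.ext k' hk)) (by simpa using RealE.const 2)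
      (by simpa using RealE.const 1)

theorem Env.pow_eq {E : Env} {b : ℕ} (hb : b ≤ E.natVar 2) : E.pow b = 2 ^ b := by
  rw [pow, ← Finset.prod_filter, Finset.prod_const]
  congr 1
  rw [show (Finset.range (E.natVar 2)).filter (· < b) = Finset.range b by
    ext i; simp only [Finset.mem_filter, Finset.mem_range]; omega, Finset.card_range]

/-! ### The sparsification algorithm

The integer array `1` marks the terms in conflicting pairs and the integer array `2` holds coin tosses. -/

namespace Env

variable (E : Env)

/-- `T_i(j)` -/
def tup (r i j : ℕ) : ℕ := E.natArr 0 (r * i + j)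

/-- `M_i` -/
noncomputable def mat (r i : ℕ) : Matrix (QHam.Bits r) (QHam.Bits r) ℂ := fun x y =>
  ⟨E.realArr 0 ((2 ^ r * 2 ^ r) * i + (finFunctionFinEquiv y + 2 ^ r * finFunctionFinEquiv x)),
    E.realArr 1 ((2 ^ r * 2 ^ r) * i + (finFunctionFinEquiv y + 2 ^ r * finFunctionFinEquiv x))⟩

/-- The terms `i` and `j` are in conflict. -/
def Conflict (r i j : ℕ) : Prop := ∃ e : Fin r ↪ Fin (r + r),
  ((∀ p s : Fin r, E.tup r i p = E.tup r j s ↔ e s = Fin.castAdd r p) ∧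
    ∀ s : Fin r, (∀ p : Fin r, E.tup r i p ≠ E.tup r j s) → e s = Fin.natAdd r s) ∧
  (QHam.localOp (Fin.castAddEmb r) (E.mat r i) + QHam.localOp e (E.mat r j)).det ≠ 0

open Classical in
/-- The number of unmarked terms that contain the qubit `v`. -/
noncomputable def deg (r v : ℕ) : ℝ :=
  E.sumLt (E.natVar 1) fun i => if E.natArr 1 i = 0 ∧ ∃ j : Fin r, E.tup r i j = v then 1 else 0

/-- The number of marked terms. -/
noncomputable def numMarked : ℝ :=
  E.sumLt (E.natVar 1) fun i => if E.natArr 1 i = 0 then 0 else 1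

open Classical in
/-- The quotient of the number of terms by `d`, rounded up. -/
noncomputable def quot (d : ℝ) : ℝ :=
  E.sumLt (E.natVar 1) fun k => if E.cast k * d < E.cast (E.natVar 1) then 1 else 0

/-- The importance of the term `i`. -/
noncomputable def imp (r i : ℕ) : ℝ :=
  if E.natArr 1 i = 0 then ∑ j : Fin r, E.quot (E.deg r (E.tup r i j)) else E.quot E.numMarked

/-- The total importance of the terms before `i`. -/
noncomputable def acc (r i : ℕ) : ℝ := E.sumLt i (E.imp r)

/-- The smallest power of `2` not smaller than the total importance. -/
noncomputable def total (r : ℕ) : ℝ := ∏ b ∈ Finset.range (E.natVar 2),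
  if E.pow b < E.acc r (E.natVar 1) then 2 else 1

/-- The `k`-th sample, a random number smaller than `E.total r`. -/
noncomputable def sample (r k : ℕ) : ℝ := ∑ b ∈ Finset.range (E.natVar 2),
  if E.pow b < E.acc r (E.natVar 1) ∧ E.natArr 2 (E.natVar 2 * k + b) ≠ 0 then E.pow b else 0

/-- The required number of samples. -/
noncomputable def req (K : ℕ) : ℝ :=
  K * (E.cast (E.natVar 0) * E.cast (E.natVar 0)) * (E.realVar 0 * E.realVar 0) /
    (E.realVar 1 * E.realVar 1)

/-- The required number of samples, rounded up. -/
noncomputable def num (K : ℕ) : ℝ :=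
  E.sumLt (E.natVar 1) fun k => if E.cast k < E.req K then 1 else 0

/-- The number of samples in which the term `i` is chosen. -/
noncomputable def hits (r K i : ℕ) : ℝ :=
  E.sumLt (E.natVar 1) fun k => if E.cast k < E.req K ∧ ¬E.sample r k < E.acc r i ∧
    E.sample r k < E.acc r (i + 1) then 1 else 0

/-- The weight of the term `i`. -/
noncomputable def weight (r K i : ℕ) : ℝ :=
  if E.realVar 1 < 1 then
    if E.req K < E.cast (E.natVar 1) then E.total r / (E.num K * E.imp r i) * E.hits r K i else 1
  else 0

end Env

theorem NatE.var_lim_mul {F : Γ → ℕ} (hF : NatE c F) :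
    NatE c fun γ => (c.env γ).natVar 2 * F γ := by
  have := NatE.sum (c := c) (F := fun γ => F γ.1) fun k' hk => hF.ext k' hk
  simpa [Ctx.lim] using this

theorem NatE.tup {r : ℕ} {I J : Γ → ℕ} (hI : NatE c I) (hJ : NatE c J) :
    NatE c fun γ => (c.env γ).tup r (I γ) (J γ) :=
  ((hI.const_mul r).add hJ).load 0

theorem NatE.mat {r : ℕ} {I : Γ → ℕ} (hI : NatE c I) (x y : QHam.Bits r) :
    ComplexE c fun γ => (c.env γ).mat r (I γ) x y :=
  have h := (hI.const_mul (2 ^ r * 2 ^ r)).add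
    (.const (finFunctionFinEquiv y + 2 ^ r * finFunctionFinEquiv x))
  ⟨h.realLoad 0 (by norm_num), h.realLoad 1 (by norm_num)⟩

theorem ComplexE.localOp {r n : ℕ} (e : Fin r ↪ Fin n)
    {F : Γ → Matrix (QHam.Bits r) (QHam.Bits r) ℂ} (hF : ∀ x y, ComplexE c fun γ => F γ x y)
    (x y : QHam.Bits n) : ComplexE c fun γ => QHam.localOp e (F γ) x y := by
  unfold QHam.localOp
  split_ifs with h
  · exact hF _ _
  · exact .zero

theorem NatE.conflict {r : ℕ} {I J : Γ → ℕ} (hI : NatE c I) (hJ : NatE c J) :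
    BoolE c fun γ => (c.env γ).Conflict r (I γ) (J γ) := by
  refine BoolE.exists_fintype fun e => ?_
  have ht : ∀ p s : Fin r, BoolE c fun γ =>
      (c.env γ).tup r (I γ) p = (c.env γ).tup r (J γ) s :=
    fun p s => (hI.tup (.const p)).eq (hJ.tup (.const s))
  refine ((BoolE.forall_fintype fun p => BoolE.forall_fintype fun s => ?_).and
    (BoolE.forall_fintype fun s => ?_)).and (ComplexE.ne_zero (.det fun x y => ?_))
  · by_cases h : e s = Fin.castAdd r p
    · exact (ht p s).congr fun γ => by simp [h]
    · exact (ht p s).not.congr fun γ => by simp [h]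
  · by_cases h : e s = Fin.natAdd r s
    · exact (BoolE.const True).congr fun γ => by simp [h]
    · exact (BoolE.forall_fintype fun p => (ht p s).not).not.congr fun γ => by simp only [h, imp_false]
  · exact (ComplexE.localOp _ hI.mat x y).add (ComplexE.localOp _ hJ.mat x y)

theorem RealE.one : RealE c fun _ => (1 : ℝ) := by simpa using RealE.const 1

theorem RealE.zero : RealE c fun _ => (0 : ℝ) := by simpa using RealE.const 0

theorem NatE.natVar (x : ℕ) (hx : x < 3 := by norm_num) : NatE c fun γ => (c.env γ).natVar x :=
  .var x hx

theorem NatE.unmarked {I : Γ → ℕ} (hI : NatE c I) : BoolE c fun γ => (c.env γ).natArr 1 (I γ) = 0 :=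
  (hI.load 1).eq (.const 0)

theorem NatE.deg {r : ℕ} {V : Γ → ℕ} (hV : NatE c V) :
    RealE c fun γ => (c.env γ).deg r (V γ) :=
  .sumLt (.natVar 1) fun k' hk =>
    have hb := NatE.bound (c := c) k' hk
    .ite (hb.unmarked.and (.exists_fintype fun j : Fin r => (hb.tup (.const j)).eq (hV.ext k' hk)))
      .one .zero

theorem RealE.numMarked : RealE c fun γ => (c.env γ).numMarked :=
  .sumLt (.natVar 1) fun k' hk => .ite (NatE.bound (c := c) k' hk).unmarked .zero .one

theorem RealE.quot {D : Γ → ℝ} (hD : RealE c D) : RealE c fun γ => (c.env γ).quot (D γ) :=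
  .sumLt (.natVar 1) fun k' hk =>
    .ite (((NatE.bound (c := c) k' hk).cast.mul (hD.ext k' hk)).lt (NatE.natVar 1).cast)
      .one .zero

theorem NatE.imp {r : ℕ} {I : Γ → ℕ} (hI : NatE c I) : RealE c fun γ => (c.env γ).imp r (I γ) :=
  .ite hI.unmarked (.finset_sum _ fun j => (hI.tup (.const j)).deg.quot) RealE.numMarked.quot

theorem NatE.acc {r : ℕ} {I : Γ → ℕ} (hI : NatE c I) : RealE c fun γ => (c.env γ).acc r (I γ) :=
  RealE.sumLt hI fun k' hk => (NatE.bound k' hk).imp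

theorem RealE.total {r : ℕ} : RealE c fun γ => (c.env γ).total r :=
  RealE.prod (c := c) (F := fun γ =>
    if (c.env γ.1).pow γ.2 < (c.env γ.1).acc r ((c.env γ.1).natVar 1) then 2 else 1) fun k' hk =>
      .ite ((NatE.bound (c := c) k' hk).pow.lt (NatE.natVar 1).acc)
        (by simpa using RealE.const 2) .one

theorem NatE.sample {r : ℕ} {I : Γ → ℕ} (hI : NatE c I) :
    RealE c fun γ => (c.env γ).sample r (I γ) :=
  RealE.sum (c := c) (F := fun γ =>
    if (c.env γ.1).pow γ.2 < (c.env γ.1).acc r ((c.env γ.1).natVar 1) ∧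
      (c.env γ.1).natArr 2 ((c.env γ.1).natVar 2 * I γ.1 + γ.2) ≠ 0
    then (c.env γ.1).pow γ.2 else 0) fun k' hk =>
      have hb := NatE.bound (c := c) k' hk
      .ite ((hb.pow.lt (NatE.natVar 1).acc).and
        ((((hI.ext k' hk).var_lim_mul.add hb).load 2).eq (.const 0)).not) hb.pow .zero

theorem RealE.req {K : ℕ} : RealE c fun γ => (c.env γ).req K :=
  (((RealE.const K).mul ((NatE.natVar 0).cast.mul (NatE.natVar 0).cast)).mul
    ((RealE.var 0 (by norm_num)).mul (.var 0 (by norm_num)))).div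
    ((RealE.var 1 (by norm_num)).mul (.var 1 (by norm_num)))

theorem RealE.num {K : ℕ} : RealE c fun γ => (c.env γ).num K :=
  .sumLt (.natVar 1) fun k' hk =>
    .ite ((NatE.bound (c := c) k' hk).cast.lt .req) .one .zero

theorem NatE.hits {r K : ℕ} {I : Γ → ℕ} (hI : NatE c I) :
    RealE c fun γ => (c.env γ).hits r K (I γ) :=
  .sumLt (.natVar 1) fun k' hk =>
    have hb := NatE.bound (c := c) k' hk
    have hI' := hI.ext k' hk
    .ite ((hb.cast.lt .req).and ((hb.sample.lt hI'.acc).not.and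
      (hb.sample.lt (hI'.add (.const 1)).acc))) .one .zero

theorem NatE.weight {r K : ℕ} {I : Γ → ℕ} (hI : NatE c I) :
    RealE c fun γ => (c.env γ).weight r K (I γ) :=
  .ite ((RealE.var 1 (by norm_num)).lt .one)
    (.ite (RealE.req.lt (NatE.natVar 1).cast)
      ((RealE.total.div (RealE.num.mul hI.imp)).mul hI.hits) .one) .zero

end RealRAM

/-! ### The phases of the algorithm -/

namespace RealRAM

theorem LoopPost.induct {x y : ℕ} {Q : State → State → Prop} {s s' : State}
    (h : LoopPost x y Q s s') (J : ℕ → State → Prop) (h0 : J 0 ((Instr.natConst x 0).apply s))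
    (hs : ∀ i < s.natVar 2, ∀ s₁ s₂, J i s₁ → s₁.natVar x = i → Q s₁ s₂ → J (i + 1) (incr x y s₂)) :
    J (s.natVar 2) s' := by
  obtain ⟨f, hf0, hfl, hf⟩ := h
  have key : ∀ i ≤ s.natVar 2, J i (f i) := by
    intro i
    induction i with
    | zero => intro _; rwa [hf0]
    | succ i ih =>
      intro hi
      obtain ⟨h1, s₁, h2, h3⟩ := hf i (by omega)
      rw [h3]
      exact hs i (by omega) _ _ (ih (by omega)) h1 h2
  exact hfl ▸ key _ le_rfl

theorem env_natConst {x : ℕ} (hx : 3 ≤ x) (v : ℕ) (s : State) :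
    ((Instr.natConst x v).apply s).env = s.env := by
  simp only [State.env, Instr.apply, Env.mk.injEq, and_true]
  funext z
  split_ifs with hz
  · exact Function.update_of_ne (by omega) _ _
  · rfl

theorem env_natAdd {x : ℕ} (hx : 3 ≤ x) (y z : ℕ) (s : State) :
    ((Instr.natAdd x y z).apply s).env = s.env := by
  simp only [State.env, Instr.apply, Env.mk.injEq, and_true]
  funext z
  split_ifs with hz
  · exact Function.update_of_ne (by omega) _ _
  · rfl

theorem env_incr {x y : ℕ} (hx : 3 ≤ x) (hy : 3 ≤ y) (s : State) : (incr x y s).env = s.env :=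
  (env_natAdd hx ..).trans (env_natConst hy ..)

theorem natVar_natConst_of_ne {x z : ℕ} (h : z ≠ x) (v : ℕ) (s : State) :
    ((Instr.natConst x v).apply s).natVar z = s.natVar z :=
  Function.update_of_ne h _ _

theorem natVar_incr_of_ne {x y z : ℕ} (h : z ≠ x) (h' : z ≠ y) (s : State) :
    (incr x y s).natVar z = s.natVar z :=
  (Function.update_of_ne h _ _).trans (natVar_natConst_of_ne h' _ _)

theorem natVar_two_of_env {s s' : State} (h : s'.env = s.env) : s'.natVar 2 = s.natVar 2 := by
  simpa [State.env] using congrArg (fun E : Env => E.natVar 2) h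

/-- Replace an integer array. -/
def Env.setArr (E : Env) (A : ℕ) (a : ℕ → ℕ) : Env :=
  { E with natArr := Function.update E.natArr A a }

theorem Env.setArr_natArr_self (E : Env) (A : ℕ) (a : ℕ → ℕ) : (E.setArr A a).natArr A = a :=
  Function.update_self ..

theorem Env.setArr_setArr (E : Env) (A : ℕ) (a b : ℕ → ℕ) :
    (E.setArr A a).setArr A b = E.setArr A b := by
  simp [setArr]

theorem Env.setArr_eq_self (E : Env) (A : ℕ) : E.setArr A (E.natArr A) = E := by
  simp [setArr]

theorem env_natStore (A i x : ℕ) (s : State) : ((Instr.natStore A i x).apply s).env =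
    s.env.setArr A (Function.update (s.natArr A) (s.natVar i) (s.natVar x)) := rfl

/-! #### Marking -/

/-- The terms `i` and `j` can be marked. -/
def Env.Markable (E : Env) (r i j : ℕ) : Prop :=
  i < E.natVar 1 ∧ j < E.natVar 1 ∧ E.natArr 1 i = 0 ∧ E.natArr 1 j = 0 ∧ E.Conflict r i j

open Classical in
/-- The marks after an attempt to mark `i` and `j`. -/
noncomputable def Env.mark (E : Env) (r i j : ℕ) : ℕ → ℕ :=
  if E.Markable r i j then Function.update (Function.update (E.natArr 1) i 1) j 1 else E.natArr 1

theorem NatE.markable {k : ℕ} {Γ : Type} {c : Ctx k Γ} {r : ℕ} {I J : Γ → ℕ} (hI : NatE c I)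
    (hJ : NatE c J) : BoolE c fun γ => (c.env γ).Markable r (I γ) (J γ) :=
  (hI.lt (.natVar 1)).and <| (hJ.lt (.natVar 1)).and <| hI.unmarked.and <| hJ.unmarked.and <|
    hI.conflict hJ

/-- The effect of an attempt to mark the terms whose numbers are in the integer variables `10`
and `12`. -/
structure MarkPost (r : ℕ) (s s' : State) : Prop where
  coins : s'.coins = s.coins
  ten : s'.natVar 10 = s.natVar 10
  twelve : s'.natVar 12 = s.natVar 12
  env : s'.env = s.env.setArr 1 (s.env.mark r (s.natVar 10) (s.natVar 12))

theorem exists_runs_markPost (r : ℕ) : ∃ P, Runs P (MarkPost r) := by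
  set c := (Ctx.base.ext 0 le_rfl).ext 1 le_rfl with hc
  have hI : NatE c fun γ => γ.1.2 := (NatE.bound (c := Ctx.base) 0 le_rfl).ext 1 le_rfl
  have hJ : NatE c fun γ => γ.2 := NatE.bound (c := Ctx.base.ext 0 le_rfl) 1 le_rfl
  obtain ⟨R, hR⟩ := (hI.markable (r := r) hJ).runs_ite (k' := 2) (e := 0) le_rfl
    ((Runs.instr (.natConst 9 1)).seq ((Runs.instr (.natStore 1 10 9)).seq
      (Runs.instr (.natStore 1 12 9)) (by rintro s s' rfl; rfl)) (by rintro s s' rfl; rfl)) Runs.skip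
  refine ⟨R, hR.mono ?_⟩
  rintro s s' ⟨s₁, a, h1, h2⟩
  have e10 : s₁.natVar 10 = s.natVar 10 := a.nat 10 (by unfold Protected; omega)
  have e12 : s₁.natVar 12 = s.natVar 12 := a.nat 12 (by unfold Protected; omega)
  have hread : c.read s = ((s.env, s.natVar 10), s.natVar 12) := rfl
  rw [hread] at h1 h2
  by_cases h : s.env.Markable r (s.natVar 10) (s.natVar 12)
  · obtain ⟨_, rfl, _, rfl, rfl⟩ := h1 h
    refine ⟨a.coins, e10, e12, ?_⟩
    rw [env_natStore, env_natStore, env_natConst (by norm_num), Env.mark, if_pos h, a.env,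
      Env.setArr_setArr]
    simp only [Instr.apply, Function.update_self, Function.update_of_ne (show (10 : ℕ) ≠ 9 by norm_num),
      Function.update_of_ne (show (12 : ℕ) ≠ 9 by norm_num), e10, e12, a.natArr]
    rfl
  · obtain rfl := h2 h
    exact ⟨a.coins, e10, e12, by rw [Env.mark, if_neg h, Env.setArr_eq_self, a.env]⟩

/-! #### Coin tosses -/

/-- The effect of a coin toss whose outcome is appended to the integer array `2`. -/
structure FlipPost (s s' : State) : Prop where
  coins : s'.coins = fun k => s.coins (k + 1)
  six : s'.natVar 6 = s.natVar 6 + 1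
  ten : s'.natVar 10 = s.natVar 10
  twelve : s'.natVar 12 = s.natVar 12
  env : s'.env = s.env.setArr 2
    (Function.update (s.env.natArr 2) (s.natVar 6) (if s.coins 0 then 1 else 0))

theorem exists_runs_flipPost : ∃ P, Runs P FlipPost := by
  refine ⟨_, (((Runs.instr (.flip 7)).seq (Runs.instr (.natStore 2 6 7)) ?_).seq
    (Runs.instr (.natConst 9 1)) ?_).seq (Runs.instr (.natAdd 6 6 9)) ?_ |>.mono ?_⟩
  · rintro s s' rfl; rfl
  · rintro s s' ⟨_, rfl, rfl⟩; rfl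
  · rintro s s' ⟨_, ⟨_, rfl, rfl⟩, rfl⟩; rfl
  · rintro s s' ⟨_, ⟨_, ⟨_, rfl, rfl⟩, rfl⟩, rfl⟩
    refine ⟨rfl, by simp [Instr.apply], rfl, rfl, ?_⟩
    rw [env_natAdd (by norm_num), env_natConst (by norm_num), env_natStore]
    have : ((Instr.flip 7).apply s).env = s.env := by
      simp only [State.env, Instr.apply, Env.mk.injEq, and_true]
      funext z
      by_cases hz : z < 3
      · simp only [if_pos hz]
        exact Function.update_of_ne (by omega) _ _
      · simp only [if_neg hz]
    rw [this]
    simp [Instr.apply, State.env]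

/-! #### Weights -/

/-- The effect of the computation of the weight of the term whose number is in the integer variable
`10`. -/
structure WeightPost (r K : ℕ) (s s' : State) : Prop where
  ten : s'.natVar 10 = s.natVar 10
  env : s'.env = s.env
  out : s'.realArr 2 =
    Function.update (s.realArr 2) (s.natVar 10) (s.env.weight r K (s.natVar 10))

theorem exists_runs_weightPost (r K : ℕ) : ∃ P, Runs P (WeightPost r K) := by
  obtain ⟨P, hP⟩ := (NatE.bound (c := Ctx.base) 0 le_rfl).weight (r := r) (K := K) 1 le_rfl 0
  refine ⟨_, (hP.seq (Runs.instr (.realStore 2 10 11)) fun _ _ h => h.1.two).mono ?_⟩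
  rintro s s' ⟨s₁, ⟨a, v⟩, rfl⟩
  have e10 : s₁.natVar 10 = s.natVar 10 := a.nat 10 (by unfold Protected; omega)
  refine ⟨e10, ?_, ?_⟩
  · rw [← a.env]
    simp only [State.env, Instr.apply, Env.mk.injEq, true_and]
    funext A
    split_ifs with hA
    · rfl
    · exact Function.update_of_ne hA _ _
  · simp only [Instr.apply, Function.update_self, e10, a.realArr]
    have v' : s₁.realVar 11 = s.env.weight r K (s.natVar 10) := v
    rw [v']

/-! #### The whole program -/

/-- The marks after attempts to mark the pairs `(i, 0), …, (i, j - 1)`. -/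
noncomputable def Env.marksRow (E : Env) (r i : ℕ) (a : ℕ → ℕ) : ℕ → ℕ → ℕ
  | 0 => a
  | j + 1 => (E.setArr 1 (E.marksRow r i a j)).mark r i j

/-- The marks after attempts to mark all pairs whose first component is smaller than a given
number. -/
noncomputable def Env.marks (E : Env) (r : ℕ) : ℕ → ℕ → ℕ
  | 0 => E.natArr 1
  | i + 1 => E.marksRow r i (E.marks r i) (E.natVar 2)

theorem exists_runs_marks (r : ℕ) : ∃ P, Runs P fun s s' =>
    s'.coins = s.coins ∧ s'.env = s.env.setArr 1 (s.env.marks r (s.env.natVar 2)) := by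
  obtain ⟨P, hP⟩ := exists_runs_markPost r
  have h2 : ∀ s s', MarkPost r s s' → s'.natVar 2 = s.natVar 2 := fun s s' h => by
    simpa [State.env, Env.setArr] using congrArg (fun E : Env => E.natVar 2) h.env
  have hin := hP.forLoop (x := 12) (y := 9) (by norm_num) (by norm_num) (by norm_num)
    fun s s' h => ⟨h2 s s' h, h.twelve⟩
  have hrow : ∀ s s', LoopPost 12 9 (MarkPost r) s s' → s'.coins = s.coins ∧
      s'.natVar 10 = s.natVar 10 ∧ s'.env = s.env.setArr 1
        (s.env.marksRow r (s.natVar 10) (s.env.natArr 1) (s.natVar 2)) := by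
    intro s s' h
    refine h.induct (fun j s₁ => s₁.coins = s.coins ∧ s₁.natVar 10 = s.natVar 10 ∧
      s₁.env = s.env.setArr 1 (s.env.marksRow r (s.natVar 10) (s.env.natArr 1) j)) ?_ ?_
    · exact ⟨rfl, rfl, by rw [env_natConst (by norm_num), Env.marksRow, Env.setArr_eq_self]⟩
    · rintro j - s₁ s₂ ⟨c1, t1, e1⟩ hj h
      refine ⟨h.coins.trans c1, (natVar_incr_of_ne (by norm_num) (by norm_num) _).trans
        (h.ten.trans t1), ?_⟩
      rw [env_incr (by norm_num) (by norm_num), h.env, e1, hj, t1, Env.setArr_setArr, Env.marksRow]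
  refine ⟨_, (hin.forLoop (x := 10) (y := 9) (by norm_num) (by norm_num) (by norm_num)
    fun s s' h => ⟨?_, (hrow s s' h).2.1⟩).mono ?_⟩
  · simpa [State.env, Env.setArr] using congrArg (fun E : Env => E.natVar 2) (hrow s s' h).2.2
  · intro s s' h
    refine h.induct (fun i s₁ => s₁.coins = s.coins ∧ s₁.env = s.env.setArr 1 (s.env.marks r i))
      ?_ ?_
    · exact ⟨rfl, by rw [env_natConst (by norm_num), Env.marks, Env.setArr_eq_self]⟩
    · rintro i - s₁ s₂ ⟨c1, e1⟩ hi h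
      obtain ⟨c2, -, e2⟩ := hrow _ _ h
      refine ⟨c2.trans c1, ?_⟩
      have hl : s₁.natVar 2 = s.env.natVar 2 := by
        simpa [State.env, Env.setArr] using congrArg (fun E : Env => E.natVar 2) e1
      rw [env_incr (by norm_num) (by norm_num), e2, e1, hi, hl, Env.setArr_setArr,
        Env.setArr_natArr_self, Env.marks]
      congr 1
      generalize s.env.natVar 2 = l
      induction l with
      | zero => rfl
      | succ l ih => rw [Env.marksRow, Env.marksRow, ih, Env.setArr_setArr]

/-- The integer array `2` after `l` coin tosses. -/
def Env.flips (E : Env) (ω : ℕ → Bool) (l p : ℕ) : ℕ :=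
  if p < l then if ω p then 1 else 0 else E.natArr 2 p

theorem exists_runs_flips : ∃ P, Runs P fun s s' =>
    s'.env = s.env.setArr 2 (s.env.flips s.coins (s.env.natVar 2 * s.env.natVar 2)) := by
  obtain ⟨P, hP⟩ := exists_runs_flipPost
  have h2 : ∀ s s', FlipPost s s' → s'.natVar 2 = s.natVar 2 := fun s s' h => by
    simpa [State.env, Env.setArr] using congrArg (fun E : Env => E.natVar 2) h.env
  set J : State → ℕ → State → Prop := fun s l s₁ => s₁.natVar 6 = l ∧
    s₁.coins = (fun k => s.coins (k + l)) ∧ s₁.env = s.env.setArr 2 (s.env.flips s.coins l) with hJ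
  have hstep : ∀ s l s₁ s₂, J s l s₁ → FlipPost s₁ s₂ → J s (l + 1) s₂ := by
    rintro s l s₁ s₂ ⟨h6, hc, he⟩ h
    refine ⟨by rw [h.six, h6], ?_, ?_⟩
    · rw [h.coins, hc]
      funext k
      exact congrArg s.coins (by omega : k + 1 + l = k + (l + 1))
    · rw [h.env, he, Env.setArr_setArr, Env.setArr_natArr_self, h6, hc]
      congr 1
      funext p
      simp only [Env.flips, Function.update_apply, zero_add]
      rcases lt_trichotomy p l with hp | rfl | hp
      · simp [hp, hp.ne, Nat.lt_succ_of_lt hp]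
      · simp
      · simp [hp.ne', hp.not_gt, (show ¬p < l + 1 by omega)]
  have hincr : ∀ s l s₁ x, 10 ≤ x → J s l s₁ → J s l (incr x 9 s₁) := by
    rintro s l s₁ x hx ⟨h6, hc, he⟩
    exact ⟨(natVar_incr_of_ne (by omega) (by norm_num) _).trans h6, hc,
      (env_incr (by omega) (by norm_num) _).trans he⟩
  have hcons : ∀ s l s₁ x, 10 ≤ x → J s l s₁ → J s l ((Instr.natConst x 0).apply s₁) := by
    rintro s l s₁ x hx ⟨h6, hc, he⟩
    exact ⟨(natVar_natConst_of_ne (by omega) _ _).trans h6, hc,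
      (env_natConst (by omega) _ _).trans he⟩
  have hin := hP.forLoop (x := 12) (y := 9) (by norm_num) (by norm_num) (by norm_num)
    fun s s' h => ⟨h2 s s' h, h.twelve⟩
  have hrow : ∀ s s', LoopPost 12 9 FlipPost s s' → s'.natVar 2 = s.natVar 2 ∧
      s'.natVar 10 = s.natVar 10 ∧ ∀ s₀ l, J s₀ l s → J s₀ (l + s.natVar 2) s' := by
    intro s s' h
    refine h.induct (fun j s₁ => s₁.natVar 2 = s.natVar 2 ∧ s₁.natVar 10 = s.natVar 10 ∧
      ∀ s₀ l, J s₀ l s → J s₀ (l + j) s₁) ?_ ?_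
    · exact ⟨rfl, rfl, fun s₀ l hl => hcons _ _ _ _ (by norm_num) hl⟩
    · rintro j - s₁ s₂ ⟨e1, t1, hl⟩ - h
      exact ⟨((natVar_incr_of_ne (by norm_num) (by norm_num) _).trans (h2 _ _ h)).trans e1,
        (natVar_incr_of_ne (by norm_num) (by norm_num) _).trans (h.ten.trans t1),
        fun s₀ l h0 => hincr _ _ _ _ (by norm_num) (hstep _ _ _ _ (hl s₀ l h0) h)⟩
  refine ⟨_, ((Runs.instr (.natConst 6 0)).seq (hin.forLoop (x := 10) (y := 9) (by norm_num)
    (by norm_num) (by norm_num) fun s s' h => ⟨(hrow s s' h).1, (hrow s s' h).2.1⟩)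
    (by rintro s s' rfl; rfl)).mono ?_⟩
  rintro s s' ⟨s₀, rfl, h⟩
  have := h.induct (fun i s₁ => s₁.natVar 2 = s.natVar 2 ∧ J s (i * s.natVar 2) s₁) ?_ ?_
  · exact this.2.2.2
  · refine ⟨rfl, hcons _ _ _ _ (by norm_num) ⟨?_, ?_, ?_⟩⟩
    · simp [Instr.apply]
    · simp [Instr.apply]
    · rw [env_natConst (by norm_num)]
      have : s.env.flips s.coins (0 * s.natVar 2) = s.env.natArr 2 := by
        funext p; simp [Env.flips]
      rw [this, Env.setArr_eq_self]
  · rintro i - s₁ s₂ ⟨e1, hl⟩ - h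
    obtain ⟨e2, -, h3⟩ := hrow _ _ h
    refine ⟨((natVar_incr_of_ne (by norm_num) (by norm_num) _).trans e2).trans e1,
      hincr _ _ _ _ (by norm_num) ?_⟩
    have := h3 _ _ hl
    rwa [e1, ← Nat.succ_mul] at this

theorem exists_runs_weights (r K : ℕ) : ∃ P, Runs P fun s s' =>
    ∀ i < s.env.natVar 2, s'.realArr 2 i = s.env.weight r K i := by
  obtain ⟨P, hP⟩ := exists_runs_weightPost r K
  refine ⟨_, (hP.forLoop (x := 10) (y := 9) (by norm_num) (by norm_num) (by norm_num)
    fun s s' h => ⟨natVar_two_of_env h.env, h.ten⟩).mono ?_⟩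
  intro s s' h
  refine (h.induct (fun l s₁ => s₁.env = s.env ∧ ∀ i < l, s₁.realArr 2 i = s.env.weight r K i)
    ?_ ?_).2
  · exact ⟨env_natConst (by norm_num) _ _, by simp⟩
  · rintro l - s₁ s₂ ⟨e1, h1⟩ hl h
    refine ⟨(env_incr (by norm_num) (by norm_num) _).trans (h.env.trans e1), fun i hi => ?_⟩
    change s₂.realArr 2 i = _
    rw [h.out, hl, e1, Function.update_apply]
    split_ifs with hil
    · rw [hil]
    · exact h1 i (by omega)

/-- Set the loop bound. -/
def Env.init (E : Env) : Env :=
  { E with natVar := Function.update E.natVar 2 (10 + E.natVar 0 + E.natVar 1) }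

/-- The data on which the weights depend. -/
noncomputable def Env.final (E : Env) (r : ℕ) (ω : ℕ → Bool) : Env :=
  (E.init.setArr 1 (E.init.marks r (E.init.natVar 2))).setArr 2
    (E.init.flips ω (E.init.natVar 2 * E.init.natVar 2))

theorem exists_program (r K : ℕ) : ∃ (P : Program) (A a : ℕ), ∀ s, ∃ s' t,
    Exec P s s' t ∧ t ≤ A * (s.natVar 0 + s.natVar 1 + 1) ^ a ∧
    ∀ i < s.natVar 1, s'.realArr 2 i = (s.env.final r s.coins).weight r K i := by
  obtain ⟨P₁, h1⟩ := exists_runs_marks r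
  obtain ⟨P₂, h2⟩ := exists_runs_flips
  obtain ⟨P₃, h3⟩ := exists_runs_weights r K
  have key : ∀ {s s' : State} {A : ℕ} {b : ℕ → ℕ}, s'.env = s.env.setArr A b →
      s'.natVar 2 = s.natVar 2 := fun h => by
    simpa [State.env, Env.setArr] using congrArg (fun E : Env => E.natVar 2) h
  obtain ⟨A, a, h⟩ := h1.seq (h2.seq h3 fun _ _ h => key h) fun _ _ h => key h.2
  refine ⟨.seq (.seq (.instr (.natConst 2 10)) (.seq (.instr (.natAdd 2 2 0))
    (.instr (.natAdd 2 2 1)))) (.seq P₁ (.seq P₂ P₃)), 3 + A * 11 ^ a, a, fun s => ?_⟩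
  set s₀ := (Instr.natAdd 2 2 1).apply ((Instr.natAdd 2 2 0).apply
    ((Instr.natConst 2 10).apply s)) with hs₀
  have e2 : s₀.natVar 2 = 10 + s.natVar 0 + s.natVar 1 := by simp [hs₀, Instr.apply]
  have ee : s₀.env = s.env.init := by
    simp only [State.env, Env.init, Env.mk.injEq]
    refine ⟨?_, rfl, rfl, rfl⟩
    funext x
    rcases eq_or_ne x 2 with rfl | hx
    · simp [e2]
    · rw [Function.update_of_ne hx]
      split_ifs
      · simp [hs₀, Instr.apply, Function.update_of_ne hx]
      · rfl
  obtain ⟨s', t, hex, ⟨s₁, ⟨c1, e1⟩, s₂, e2', hw⟩, ht⟩ := h s₀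
  refine ⟨s', 1 + (1 + 1) + t, .seq (.seq (.instr _ _) (.seq (.instr _ _) (.instr _ _))) hex, ?_, ?_⟩
  · have hp : 1 ≤ (s.natVar 0 + s.natVar 1 + 1) ^ a := Nat.one_le_pow _ _ (Nat.succ_pos _)
    have : A * (s₀.natVar 2 + 1) ^ a ≤ A * (11 ^ a * (s.natVar 0 + s.natVar 1 + 1) ^ a) := by
      rw [← mul_pow, e2]
      exact Nat.mul_le_mul_left _ (Nat.pow_le_pow_left (by omega) _)
    rw [add_mul, mul_assoc]
    omega
  · intro i hi
    have hfin : s₂.env = s.env.final r s.coins := by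
      rw [e2', e1, c1, ee, Env.final]
      rfl
    rw [hw i ?_, hfin]
    rw [hfin]
    change i < 10 + s.natVar 0 + s.natVar 1
    omega

end RealRAM

/-! ## Correctness of the algorithm -/

namespace RealRAM

open QHam Matrix

variable {r n m : ℕ}

/-- The environment `E` holds the Hamiltonian `H` and the numbers `C` and `ε`. -/
structure Env.Holds (E : Env) (H : Hamiltonian r n m) (C ε : ℝ) : Prop where
  nat_zero : E.natVar 0 = n
  nat_one : E.natVar 1 = m
  lim : E.natVar 2 = 10 + n + m
  real_zero : E.realVar 0 = C
  real_one : E.realVar 1 = ε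
  tuples : E.natArr 0 = H.tupleArray
  re : E.realArr 0 = fun p => (H.entryArray p).re
  im : E.realArr 1 = fun p => (H.entryArray p).im

theorem Env.holds_init (H : Hamiltonian r n m) (C ε : ℝ) (ω : ℕ → Bool) :
    (H.input C ε ω).env.init.Holds H C ε where
  nat_zero := rfl
  nat_one := rfl
  lim := rfl
  real_zero := by simp [State.env, init, Hamiltonian.input]
  real_one := by simp [State.env, init, Hamiltonian.input]
  tuples := rfl
  re := by simp [State.env, init, Hamiltonian.input]
  im := by simp [State.env, init, Hamiltonian.input]

namespace Env.Holds

variable {E : Env} {H : Hamiltonian r n m} {C ε : ℝ}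

theorem setArr (h : E.Holds H C ε) {A : ℕ} (hA : A ≠ 0) (a : ℕ → ℕ) : (E.setArr A a).Holds H C ε :=
  ⟨h.nat_zero, h.nat_one, h.lim, h.real_zero, h.real_one,
    (Function.update_of_ne hA.symm _ _).trans h.tuples, h.re, h.im⟩

theorem tup_eq (h : E.Holds H C ε) (i : Fin m) (j : Fin r) : E.tup r i j = H.tuple i j := by
  have hlt := (finProdFinEquiv (i, j)).2
  have hval : (finProdFinEquiv (i, j) : ℕ) = r * i + j := by simp [finProdFinEquiv, add_comm]
  rw [Env.tup, h.tuples, ← hval, Hamiltonian.tupleArray, dif_pos hlt]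
  simp only [Fin.eta, Equiv.symm_apply_apply]

theorem mat_eq (h : E.Holds H C ε) (i : Fin m) : E.mat r i = H.op i := by
  ext x y
  set q := finProdFinEquiv (finFunctionFinEquiv x, finFunctionFinEquiv y) with hq
  have hlt := (finProdFinEquiv (i, q)).2
  have hval : (finProdFinEquiv (i, q) : ℕ) = (2 ^ r * 2 ^ r) * i +
      (finFunctionFinEquiv y + 2 ^ r * finFunctionFinEquiv x) := by
    simp only [hq, finProdFinEquiv, Equiv.coe_fn_mk]
    ring
  have he : H.entryArray (finProdFinEquiv (i, q)) = H.op i x y := by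
    unfold Hamiltonian.entryArray
    rw [dif_pos hlt]
    simp only [Fin.eta, Equiv.symm_apply_apply, hq]
  rw [Env.mat, h.re, h.im, ← hval]
  simp only [he]

theorem conflict_iff (h : E.Holds H C ε) (i j : Fin m) : E.Conflict r i j ↔ H.Conflict i j := by
  have key : ∀ e, ((∀ p s : Fin r, E.tup r i p = E.tup r j s ↔ e s = Fin.castAdd r p) ∧
      ∀ s : Fin r, (∀ p : Fin r, E.tup r i p ≠ E.tup r j s) → e s = Fin.natAdd r s) ↔
      IsPattern (H.tuple i) (H.tuple j) e := fun e => by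
    simp only [h.tup_eq, ne_eq, Fin.val_inj, IsPattern]
  unfold Env.Conflict
  simp only [key, h.mat_eq]
  constructor
  · rintro ⟨e, he, hd⟩
    exact (H.conflict_iff_det i j he).2 hd
  · intro hc
    obtain ⟨e, he⟩ := exists_isPattern (H.tuple i) (H.tuple j)
    exact ⟨e, he, (H.conflict_iff_det i j he).1 hc⟩

end Env.Holds

theorem Env.mark_eq_zero {E : Env} {i j x : ℕ} (h : E.mark r i j x = 0) : E.natArr 1 x = 0 := by
  unfold mark at h
  split_ifs at h
  · simp only [Function.update_apply] at h
    split_ifs at h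
    exact h
  · exact h

/-- The marked terms. -/
def marked (m : ℕ) (a : ℕ → ℕ) : Finset (Fin m) := {i | a i ≠ 0}

theorem mem_marked {a : ℕ → ℕ} {i : Fin m} : i ∈ marked m a ↔ a i ≠ 0 := by simp [marked]

theorem Env.Holds.energy_mark {E : Env} {H : Hamiltonian r n m} {C ε : ℝ} (h : E.Holds H C ε)
    (hH : H.IsBounded C (2 * r)) (hr : 0 < r) {i j : ℕ}
    (hE : ∀ ψ, (marked m (E.natArr 1)).card * quadForm 1 ψ ≤
      2 * C * ∑ i ∈ marked m (E.natArr 1), quadForm (H.term i) ψ) (ψ : Bits n → ℂ) :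
    (marked m (E.mark r i j)).card * quadForm 1 ψ ≤
      2 * C * ∑ i ∈ marked m (E.mark r i j), quadForm (H.term i) ψ := by
  by_cases hm : E.Markable r i j
  swap
  · rw [Env.mark, if_neg hm]; exact hE ψ
  rw [Env.mark, if_pos hm]
  obtain ⟨hi, hj, ai, aj, hc⟩ := hm
  rw [h.nat_one] at hi hj
  have hc' := hH.quadForm_one_le_of_conflict hr ((h.conflict_iff ⟨i, hi⟩ ⟨j, hj⟩).1 hc) ψ
  have hX : marked m (Function.update (Function.update (E.natArr 1) i 1) j 1) =
      marked m (E.natArr 1) ∪ {⟨i, hi⟩, ⟨j, hj⟩} := by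
    ext x
    simp only [mem_marked, Function.update_apply, Finset.mem_union, Finset.mem_insert,
      Finset.mem_singleton, Fin.ext_iff]
    split_ifs <;> simp_all
  have hd : Disjoint (marked m (E.natArr 1)) {⟨i, hi⟩, ⟨j, hj⟩} := by
    simp [mem_marked, ai, aj]
  rw [hX, Finset.card_union_of_disjoint hd, Finset.sum_union hd, Nat.cast_add, add_mul, mul_add]
  refine add_le_add (hE ψ) ?_
  have h2 : ((({⟨i, hi⟩, ⟨j, hj⟩} : Finset (Fin m)).card : ℕ) : ℝ) ≤ 2 := by
    exact_mod_cast Finset.card_le_two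
  calc _ ≤ 2 * quadForm 1 ψ := mul_le_mul_of_nonneg_right h2 (quadForm_one_nonneg ψ)
    _ ≤ _ := by rw [mul_assoc]; linarith

theorem Env.Holds.conflictCover {E : Env} {H : Hamiltonian r n m} {C ε : ℝ} (h : E.Holds H C ε)
    (hH : H.IsBounded C (2 * r)) (hr : 0 < r) (h0 : E.natArr 1 = 0) :
    H.ConflictCover C (marked m (E.marks r (E.natVar 2))) := by
  set D : (ℕ → ℕ) → ℕ → ℕ → Prop := fun a i j => a i = 0 → a j = 0 →
    ¬(i < m ∧ j < m ∧ E.Conflict r i j) with hD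
  set I : (ℕ → ℕ) → Prop := fun a => ∀ ψ, (marked m a).card * quadForm 1 ψ ≤
    2 * C * ∑ i ∈ marked m a, quadForm (H.term i) ψ with hI
  have hmono : ∀ a i j i' j', D a i j → D ((E.setArr 1 a).mark r i' j') i j := by
    intro a i j i' j' hd hi hj
    exact hd (Env.mark_eq_zero hi) (Env.mark_eq_zero hj)
  have hnew : ∀ a i j, D ((E.setArr 1 a).mark r i j) i j := by
    rintro a i j hi hj ⟨him, hjm, hc⟩
    have hm : (E.setArr 1 a).Markable r i j := ⟨by rw [(h.setArr one_ne_zero a).nat_one]; exact him,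
      by rw [(h.setArr one_ne_zero a).nat_one]; exact hjm, Env.mark_eq_zero hi,
      Env.mark_eq_zero hj, hc⟩
    rw [Env.mark, if_pos hm, Function.update_self] at hj
    exact one_ne_zero hj
  have hrow : ∀ a i l, I a → (∀ i' j', D a i' j' → D (E.marksRow r i a l) i' j') ∧
      I (E.marksRow r i a l) ∧ ∀ j < l, D (E.marksRow r i a l) i j := by
    intro a i l ha
    induction l with
    | zero => exact ⟨fun _ _ h => h, ha, by simp⟩
    | succ l ih =>
      obtain ⟨h1, h2, h3⟩ := ih
      refine ⟨fun i' j' hd => hmono _ _ _ _ _ (h1 i' j' hd),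
        (h.setArr one_ne_zero _).energy_mark hH hr ?_, fun j hj => ?_⟩
      · rw [Env.setArr_natArr_self]; exact h2
      · rcases Nat.lt_succ_iff_lt_or_eq.1 hj with hj | rfl
        · exact hmono _ _ _ _ _ (h3 j hj)
        · exact hnew _ _ _
  have hall : ∀ l, I (E.marks r l) ∧ ∀ i < l, ∀ j < E.natVar 2, D (E.marks r l) i j := by
    intro l
    induction l with
    | zero =>
      refine ⟨fun ψ => ?_, by simp⟩
      have : marked m (E.marks r 0) = ∅ := by
        ext x; simp [mem_marked, Env.marks, h0]
      simp [this]
    | succ l ih =>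
      obtain ⟨h1, h2, h3⟩ := hrow (E.marks r l) l (E.natVar 2) ih.1
      refine ⟨h2, fun i hi j hj => ?_⟩
      rcases Nat.lt_succ_iff_lt_or_eq.1 hi with hi | rfl
      · exact h1 _ _ (ih.2 i hi j hj)
      · exact h3 j hj
  obtain ⟨h1, h2⟩ := hall (E.natVar 2)
  refine ⟨h1, fun i hi j hj hc => ?_⟩
  have hl := h.lim
  refine h2 i (by omega) j (by omega) ?_ ?_ ⟨i.2, j.2, (h.conflict_iff i j).2 hc⟩
  · simpa [mem_marked] using hi
  · simpa [mem_marked] using hj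

end RealRAM

/-! ### Sampling with dyadic probabilities -/

namespace Matrix

open scoped ComplexOrder

variable {m : ℕ}

/-- The number with the binary digits `f`. -/
def bitsVal {s : ℕ} (f : Fin s → Bool) : ℕ := ∑ b : Fin s, if f b then 2 ^ (b : ℕ) else 0

/-- The number `bitsVal f` is uniformly distributed. -/
theorem sum_bitsVal {M : Type*} [AddCommMonoid M] (s : ℕ) (F : ℕ → M) :
    ∑ f : Fin s → Bool, F (bitsVal f) = ∑ u ∈ Finset.range (2 ^ s), F u := by
  rw [Finset.sum_range, ← (finFunctionFinEquiv (m := 2) (n := s)).sum_comp,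
    ← (Equiv.arrowCongr (Equiv.refl (Fin s)) finTwoEquiv).sum_comp]
  refine Finset.sum_congr rfl fun f _ => congrArg F ?_
  rw [finFunctionFinEquiv_apply, bitsVal]
  refine Finset.sum_congr rfl fun b _ => ?_
  simp only [Equiv.arrowCongr_apply, Function.comp, Equiv.refl_symm, Equiv.refl_apply]
  generalize f b = x
  fin_cases x <;> simp [finTwoEquiv]

/-- The number `u` selects `i`, for the weights `g`. -/
def Selects (g : ℕ → ℕ) (u i : ℕ) : Prop :=
  ∑ j ∈ Finset.range i, g j ≤ u ∧ u < ∑ j ∈ Finset.range (i + 1), g j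

instance (g : ℕ → ℕ) (u i : ℕ) : Decidable (Selects g u i) := inferInstanceAs (Decidable (_ ∧ _))

theorem Selects.eq {g : ℕ → ℕ} {u i j : ℕ} (hi : Selects g u i) (hj : Selects g u j) : i = j := by
  have hmono : Monotone fun i => ∑ j ∈ Finset.range i, g j :=
    monotone_nat_of_le_succ fun i => by simp [Finset.sum_range_succ]
  by_contra hne
  rcases Nat.lt_or_gt_of_ne hne with h | h
  · have := hmono (Nat.succ_le_of_lt h)
    exact absurd (hi.2.trans_le (this.trans hj.1)) (lt_irrefl _)
  · have := hmono (Nat.succ_le_of_lt h)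
    exact absurd (hj.2.trans_le (this.trans hi.1)) (lt_irrefl _)

theorem card_selects (g : ℕ → ℕ) {i Q : ℕ} (hi : i < m)
    (hQ : ∑ j ∈ Finset.range m, g j ≤ Q) :
    ((Finset.range Q).filter fun u => Selects g u i).card = g i := by
  have hmono : Monotone fun i => ∑ j ∈ Finset.range i, g j :=
    monotone_nat_of_le_succ fun i => by simp [Finset.sum_range_succ]
  have h1 := (hmono (Nat.succ_le_of_lt hi)).trans hQ
  have : (Finset.range Q).filter (fun u => Selects g u i) =
      Finset.Ico (∑ j ∈ Finset.range i, g j) (∑ j ∈ Finset.range (i + 1), g j) := by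
    ext u
    rw [Finset.mem_filter, Finset.mem_range, Finset.mem_Ico]
    exact ⟨fun h => h.2, fun h => ⟨h.2.trans_le h1, h⟩⟩
  rw [this, Nat.card_Ico, Finset.sum_range_succ]
  omega

variable {d : Type*}

/-- The sample that belongs to the number `u < Q`. -/
noncomputable def slot (T : Fin m → Matrix d d ℂ) (g : ℕ → ℕ) (Q : ℝ) (u : ℕ) : Matrix d d ℂ :=
  ∑ i : Fin m, if Selects g u i then (Q / g i) • T i else 0

variable {T : Fin m → Matrix d d ℂ} {g : ℕ → ℕ}

theorem sum_slot (hg : ∀ i : Fin m, 0 < g i) {Q : ℕ} (hQ : ∑ j ∈ Finset.range m, g j ≤ Q) :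
    ∑ u ∈ Finset.range Q, slot T g Q u = (Q : ℝ) • ∑ i, T i := by
  unfold slot
  rw [Finset.sum_comm, Finset.smul_sum]
  refine Finset.sum_congr rfl fun i _ => ?_
  rw [← Finset.sum_filter, Finset.sum_const, card_selects g i.2 hQ, ← Nat.cast_smul_eq_nsmul ℝ,
    smul_smul, mul_div_cancel₀]
  exact_mod_cast (hg i).ne'

variable [Fintype d]

theorem quadForm_slot (Q : ℝ) (u : ℕ) (ψ : d → ℂ) : quadForm (slot T g Q u) ψ =
    ∑ i : Fin m, if Selects g u i then Q / g i * quadForm (T i) ψ else 0 := by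
  rw [slot, quadForm_sum]
  refine Finset.sum_congr rfl fun i _ => ?_
  split_ifs
  · rw [quadForm_smul]
  · rw [quadForm_zero]

theorem slot_posSemidef (hT : ∀ i, (T i).PosSemidef) {Q : ℝ} (hQ : 0 ≤ Q) (u : ℕ) :
    (slot T g Q u).PosSemidef := by
  refine posSemidef_sum _ fun i _ => ?_
  split_ifs
  · exact (hT i).real_smul (by positivity)
  · exact PosSemidef.zero

theorem quadForm_slot_le (hT : ∀ i, (T i).PosSemidef) {Q P : ℝ} (hP : 0 ≤ P)
    (hle : ∀ (i : Fin m) ψ, Q / g i * quadForm (T i) ψ ≤ P * quadForm (∑ i, T i) ψ) (u : ℕ)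
    (ψ : d → ℂ) : quadForm (slot T g Q u) ψ ≤ P * quadForm (∑ i, T i) ψ := by
  rw [quadForm_slot]
  by_cases h : ∃ i : Fin m, Selects g u i
  · obtain ⟨i, hi⟩ := h
    rw [Finset.sum_eq_single i, if_pos hi]
    · exact hle i ψ
    · exact fun j _ hj => if_neg fun hj' => hj (Fin.ext (hj'.eq hi))
    · simp
  · push Not at h
    rw [Finset.sum_eq_zero fun i _ => if_neg (h i)]
    exact mul_nonneg hP ((posSemidef_sum _ fun i _ => hT i).quadForm_nonneg ψ)

open Classical in
/-- Most outcomes of `N` samples yield a good approximation of `∑ i, T i`. -/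
theorem card_bad_samples_le [DecidableEq d] [Nonempty d] (hT : ∀ i, (T i).PosSemidef) (hg : ∀ i : Fin m, 0 < g i)
    {s : ℕ} (hs : ∑ j ∈ Finset.range m, g j ≤ 2 ^ s) {P ε : ℝ} (hP : 1 ≤ P) (hε : 0 < ε) (hε1 : ε ≤ 1)
    (hle : ∀ (i : Fin m) ψ, 2 ^ s / g i * quadForm (T i) ψ ≤ P * quadForm (∑ i, T i) ψ) (N : ℕ) :
    (Finset.card {f : Fin N → Fin s → Bool | ∃ ψ, N * ε * quadForm (∑ i, T i) ψ <
      |∑ i : Fin m, 2 ^ s / g i * (Finset.card {k | Selects g (bitsVal (f k)) i} : ℝ) *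
        quadForm (T i) ψ - N * quadForm (∑ i, T i) ψ|} : ℝ) ≤
    2 * (Fintype.card d * (2 ^ s) ^ N * Real.exp (-(N * ε ^ 2 / (4 * P)))) := by
  have hcard : (Fintype.card (Fin s → Bool) : ℝ) = 2 ^ s := by simp
  have h := card_deviation_le (M := fun f : Fin s → Bool => slot T g (2 ^ s) (bitsVal f))
    (fun f => slot_posSemidef hT (by positivity) _) (posSemidef_sum _ fun i _ => hT i)
    (by
      rw [hcard, sum_bitsVal s fun u => slot T g (2 ^ s) u]
      have := sum_slot (T := T) hg (Q := 2 ^ s) hs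
      push_cast at this
      exact this) hP hε hε1 (fun f ψ => quadForm_slot_le hT (by linarith) hle _ ψ) N
  rw [hcard] at h
  refine le_of_eq_of_le ?_ h
  congr 2
  ext f
  simp only [Finset.mem_filter, Finset.mem_univ, true_and]
  refine exists_congr fun ψ => ?_
  have : ∑ k, quadForm (slot T g (2 ^ s) (bitsVal (f k))) ψ = ∑ i : Fin m, 2 ^ s / g i *
      (Finset.card {k | Selects g (bitsVal (f k)) i} : ℝ) * quadForm (T i) ψ := by
    simp only [quadForm_slot]
    rw [Finset.sum_comm]
    refine Finset.sum_congr rfl fun i _ => ?_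
    rw [← Finset.sum_filter, Finset.sum_const, nsmul_eq_mul]
    ring
  rw [this]

end Matrix

/-! ### Importances and the values of the expressions -/

/-- The quotient of `m` by `d`, rounded up. -/
def ceilQuot (m d : ℕ) : ℕ := (m + d - 1) / d

theorem lt_ceilQuot_iff {m d k : ℕ} (hd : 0 < d) : k < ceilQuot m d ↔ k * d < m := by
  rw [ceilQuot, ← Nat.succ_le_iff, Nat.le_div_iff_mul_le hd, Nat.succ_mul]
  omega

theorem le_ceilQuot_mul {m d : ℕ} (hd : 0 < d) : m ≤ ceilQuot m d * d :=
  not_lt.1 fun h => lt_irrefl _ ((lt_ceilQuot_iff hd).2 h)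

theorem ceilQuot_mul_le (m d : ℕ) : ceilQuot m d * d ≤ m + d :=
  (Nat.div_mul_le_self _ _).trans (Nat.sub_le _ _)

theorem ceilQuot_pos {m d : ℕ} (hm : 0 < m) (hd : 0 < d) : 0 < ceilQuot m d :=
  (lt_ceilQuot_iff hd).2 (by omega)

theorem ceilQuot_le {m d : ℕ} (hd : 0 < d) : ceilQuot m d ≤ m := by
  by_contra h
  have := (lt_ceilQuot_iff hd).1 (not_le.1 h)
  nlinarith

namespace QHam.Hamiltonian

open Matrix

variable {r n m : ℕ} (H : Hamiltonian r n m) (X : Finset (Fin m))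

/-- The importance of a term, an integer. -/
noncomputable def importance (i : ℕ) : ℕ :=
  if h : i < m then
    if ⟨i, h⟩ ∈ X then ceilQuot m X.card
    else ∑ j, ceilQuot m (H.incident X (H.tuple ⟨i, h⟩ j)).card
  else 0

variable {H X}

theorem importance_eq (i : Fin m) : H.importance X i = if i ∈ X then ceilQuot m X.card
    else ∑ j, ceilQuot m (H.incident X (H.tuple i j)).card := by
  rw [importance, dif_pos i.2]

theorem importance_cast (i : Fin m) : (H.importance X i : ℝ) =
    if i ∈ X then (ceilQuot m X.card : ℝ)
    else ∑ j, (ceilQuot m (H.incident X (H.tuple i j)).card : ℝ) := by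
  rw [importance_eq]
  split_ifs <;> simp

theorem card_incident_pos {i : Fin m} (hi : i ∉ X) (j : Fin r) :
    0 < (H.incident X (H.tuple i j)).card :=
  Finset.card_pos.2 ⟨i, by simp [incident, hi]⟩

theorem importance_pos (hr : 0 < r) (i : Fin m) : 0 < H.importance X i := by
  have hm : 0 < m := i.pos
  rw [importance_eq]
  split_ifs with hi
  · exact ceilQuot_pos hm (Finset.card_pos.2 ⟨i, hi⟩)
  · exact Finset.sum_pos (fun j _ => ceilQuot_pos hm (card_incident_pos hi j)) ⟨⟨0, hr⟩, by simp⟩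

theorem sum_importance : ∑ i ∈ Finset.range m, H.importance X i ≤ (n + 1) * (2 * m) := by
  have hcard : ∀ s : Finset (Fin m), ceilQuot m s.card * s.card ≤ 2 * m := fun s =>
    (ceilQuot_mul_le _ _).trans (by have := s.card_le_univ; rw [Fintype.card_fin] at this; omega)
  have := H.sum_importance_le X (h := fun q => (ceilQuot m (H.incident X q).card : ℝ))
    (h' := ceilQuot m X.card) (b := ((2 * m : ℕ) : ℝ)) (fun q => by exact_mod_cast hcard _)
    (by exact_mod_cast hcard X)
  rw [Finset.sum_congr rfl fun i _ => (importance_cast (H := H) (X := X) i).symm] at this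
  rw [Finset.sum_range]
  exact_mod_cast this

theorem IsBounded.quadForm_term_le_natImportance {C : ℝ} (hH : H.IsBounded C (2 * r)) (hr : 0 < r)
    (hN : H.NullityLeOne) (hX : H.ConflictCover C X) (i : Fin m) (ψ : Bits n → ℂ) :
    m * quadForm (H.term i) ψ ≤ 2 * C ^ 2 * H.importance X i * ∑ j, quadForm (H.term j) ψ := by
  rw [importance_cast]
  exact hH.quadForm_term_le_importance hr hN hX
    (h := fun q => (ceilQuot m (H.incident X q).card : ℝ)) (fun q => Nat.cast_nonneg _)
    (fun q hq => by exact_mod_cast le_ceilQuot_mul (Finset.card_pos.2 hq))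
    (fun hne => by exact_mod_cast le_ceilQuot_mul (Finset.card_pos.2 hne)) i ψ

end QHam.Hamiltonian

namespace RealRAM.Env.Holds

open QHam Matrix

variable {r n m : ℕ} {E : Env} {H : Hamiltonian r n m} {C ε : ℝ}

theorem cast_eq (h : E.Holds H C ε) {a : ℕ} (ha : a ≤ 10 + n + m) : E.cast a = a :=
  Env.cast_eq (h.lim ▸ ha)

theorem sumLt_eq (h : E.Holds H C ε) (f : ℕ → ℝ) : E.sumLt (E.natVar 1) f = ∑ i : Fin m, f i := by
  rw [h.nat_one]
  exact Env.sumLt_eq (by rw [h.lim]; omega) f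

theorem deg_eq (h : E.Holds H C ε) (v : Fin n) :
    E.deg r v = (H.incident (marked m (E.natArr 1)) v).card := by
  rw [Env.deg, h.sumLt_eq, Finset.sum_boole, Hamiltonian.incident]
  congr 2
  ext i
  simp [mem_marked, h.tup_eq, Fin.val_inj]

theorem numMarked_eq (h : E.Holds H C ε) : E.numMarked = (marked m (E.natArr 1)).card := by
  rw [Env.numMarked, h.sumLt_eq, marked, Finset.card_filter]
  push_cast
  refine Finset.sum_congr rfl fun i _ => ?_
  by_cases hi : E.natArr 1 i = 0 <;> simp [hi]

theorem sum_lt_eq_card (h : E.Holds H C ε) {p : ℕ → Prop} [DecidablePred p] {a : ℕ} (ha : a ≤ m)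
    (hp : ∀ k < m, p k ↔ k < a) : E.sumLt (E.natVar 1) (fun k => if p k then 1 else 0) = a := by
  rw [h.nat_one, Env.sumLt_eq_range (by rw [h.lim]; omega), Finset.sum_boole]
  have : (Finset.range m).filter p = Finset.range a := by
    ext k
    simp only [Finset.mem_filter, Finset.mem_range]
    exact ⟨fun hk => (hp k hk.1).1 hk.2, fun hk => ⟨by omega, (hp k (by omega)).2 hk⟩⟩
  rw [this, Finset.card_range]

theorem quot_eq (h : E.Holds H C ε) {d : ℕ} (hd : 0 < d) : E.quot d = ceilQuot m d := by
  refine h.sum_lt_eq_card (ceilQuot_le hd) fun k hk => ?_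
  rw [lt_ceilQuot_iff hd, h.nat_one, h.cast_eq (by omega), h.cast_eq (by omega)]
  exact_mod_cast Iff.rfl

theorem imp_eq (h : E.Holds H C ε) (i : Fin m) :
    E.imp r i = H.importance (marked m (E.natArr 1)) i := by
  rw [Hamiltonian.importance_cast, Env.imp]
  by_cases hi : E.natArr 1 i = 0
  · have hi' : i ∉ marked m (E.natArr 1) := by simp [mem_marked, hi]
    rw [if_pos hi, if_neg hi']
    refine Finset.sum_congr rfl fun j _ => ?_
    rw [h.tup_eq, h.deg_eq, h.quot_eq (Hamiltonian.card_incident_pos hi' j)]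
  · have hi' : i ∈ marked m (E.natArr 1) := by simp [mem_marked, hi]
    rw [if_neg hi, if_pos hi', h.numMarked_eq, h.quot_eq (Finset.card_pos.2 ⟨i, hi'⟩)]

theorem acc_eq (h : E.Holds H C ε) {i : ℕ} (hi : i ≤ m) : E.acc r i =
    (∑ j ∈ Finset.range i, H.importance (marked m (E.natArr 1)) j : ℕ) := by
  rw [Env.acc, Env.sumLt_eq_range (by rw [h.lim]; omega), Nat.cast_sum]
  exact Finset.sum_congr rfl fun j hj => h.imp_eq ⟨j, by have := Finset.mem_range.1 hj; omega⟩

/-- The number of coin tosses for one sample. -/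
noncomputable def numBits (H : Hamiltonian r n m) (X : Finset (Fin m)) : ℕ :=
  Nat.clog 2 (∑ j ∈ Finset.range m, H.importance X j)

theorem numBits_le (H : Hamiltonian r n m) (X : Finset (Fin m)) : numBits H X ≤ 10 + n + m := by
  refine (Nat.clog_le_iff_le_pow one_lt_two).2 (Hamiltonian.sum_importance.trans ?_)
  have h1 : n + 1 ≤ 2 ^ n := Nat.lt_two_pow_self
  have h2 : m ≤ 2 ^ m := Nat.lt_two_pow_self.le
  calc (n + 1) * (2 * m) ≤ 2 ^ n * (2 ^ 10 * 2 ^ m) := by gcongr; norm_num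
    _ = _ := by rw [pow_add, pow_add]; ring

theorem pow_lt_acc_iff (h : E.Holds H C ε) {b : ℕ} (hb : b < E.natVar 2) :
    E.pow b < E.acc r (E.natVar 1) ↔ b < numBits H (marked m (E.natArr 1)) := by
  rw [Env.pow_eq hb.le, h.nat_one, h.acc_eq le_rfl, numBits, ← not_le, ← not_le,
    Nat.clog_le_iff_le_pow one_lt_two]
  exact_mod_cast Iff.rfl

theorem filter_pow_lt_acc (h : E.Holds H C ε) : (Finset.range (E.natVar 2)).filter
    (fun b => E.pow b < E.acc r (E.natVar 1)) =
    Finset.range (numBits H (marked m (E.natArr 1))) := by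
  ext b
  simp only [Finset.mem_filter, Finset.mem_range]
  have := numBits_le H (marked m (E.natArr 1))
  exact ⟨fun hb => (h.pow_lt_acc_iff hb.1).1 hb.2, fun hb =>
    have hb' : b < E.natVar 2 := by rw [h.lim]; omega
    ⟨hb', (h.pow_lt_acc_iff hb').2 hb⟩⟩

theorem total_eq (h : E.Holds H C ε) :
    E.total r = 2 ^ numBits H (marked m (E.natArr 1)) := by
  rw [Env.total, ← Finset.prod_filter, h.filter_pow_lt_acc, Finset.prod_const, Finset.card_range]

theorem sample_eq (h : E.Holds H C ε) {ω : ℕ → Bool}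
    (hω : ∀ p < E.natVar 2 * E.natVar 2, E.natArr 2 p = if ω p then 1 else 0) {k : ℕ} (hk : k < m) :
    E.sample r k = (bitsVal fun b : Fin (numBits H (marked m (E.natArr 1))) =>
      ω ((10 + n + m) * k + b) : ℕ) := by
  rw [Env.sample, bitsVal, ← Finset.sum_range fun b => if ω ((10 + n + m) * k + b) then 2 ^ b else 0]
  simp only [ite_and]
  rw [← Finset.sum_filter, h.filter_pow_lt_acc]
  push_cast
  refine Finset.sum_congr rfl fun b hb => ?_
  have := numBits_le H (marked m (E.natArr 1))
  have hb' : b < 10 + n + m := (Finset.mem_range.1 hb).trans_le this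
  rw [hω, Env.pow_eq (by rw [h.lim]; exact hb'.le), h.lim]
  · by_cases hx : ω ((10 + n + m) * k + b) <;> simp [hx]
  · rw [h.lim]
    calc (10 + n + m) * k + b < (10 + n + m) * k + (10 + n + m) := by omega
      _ = (10 + n + m) * (k + 1) := by ring
      _ ≤ _ := Nat.mul_le_mul_left _ (by omega)

theorem req_eq (h : E.Holds H C ε) (K : ℕ) : E.req K = K * n ^ 2 * C ^ 2 / ε ^ 2 := by
  rw [Env.req, h.nat_zero, h.cast_eq (by omega), h.real_zero, h.real_one]
  ring

theorem num_eq (h : E.Holds H C ε) {K : ℕ} (hm : E.req K ≤ m) : E.num K = ⌈E.req K⌉₊ := by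
  refine h.sum_lt_eq_card (Nat.ceil_le.2 hm) fun k hk => ?_
  rw [h.cast_eq (by omega), Nat.lt_ceil]

theorem hits_eq (h : E.Holds H C ε) {ω : ℕ → Bool}
    (hω : ∀ p < E.natVar 2 * E.natVar 2, E.natArr 2 p = if ω p then 1 else 0) {K : ℕ}
    (hm : E.req K ≤ m) (i : Fin m) : E.hits r K i = (Finset.card {k : Fin ⌈E.req K⌉₊ |
      Selects (H.importance (marked m (E.natArr 1)))
        (bitsVal fun b : Fin (numBits H (marked m (E.natArr 1))) =>
          ω ((10 + n + m) * k + b)) i} : ℕ) := by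
  rw [Env.hits, h.nat_one, Env.sumLt_eq_range (by rw [h.lim]; omega), Finset.card_filter,
    ← Finset.sum_range fun k => if Selects (H.importance (marked m (E.natArr 1)))
        (bitsVal fun b : Fin (numBits H (marked m (E.natArr 1))) =>
          ω ((10 + n + m) * k + b)) i then 1 else 0]
  simp only [ite_and]
  rw [← Finset.sum_filter]
  have : (Finset.range m).filter (fun k => E.cast k < E.req K) = Finset.range ⌈E.req K⌉₊ := by
    ext k
    simp only [Finset.mem_filter, Finset.mem_range, Nat.lt_ceil]
    refine ⟨fun hk => ?_, fun hk => ?_⟩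
    · rw [← h.cast_eq (a := k) (by omega)]; exact hk.2
    · have hkm : k < m := by exact_mod_cast hk.trans_le hm
      exact ⟨hkm, by rwa [h.cast_eq (by omega)]⟩
  rw [this]
  push_cast
  refine Finset.sum_congr rfl fun k hk => ?_
  have hkm : k < m := by
    have := Nat.lt_ceil.1 (Finset.mem_range.1 hk)
    exact_mod_cast this.trans_le hm
  rw [h.sample_eq hω hkm, h.acc_eq i.2.le, h.acc_eq i.2, ← ite_and]
  simp only [Nat.cast_lt, not_lt]
  rfl

end RealRAM.Env.Holds

/-! ### The success probability -/

namespace RealRAM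

open MeasureTheory

theorem coinLaw_coordinates {ι : Type*} [Fintype ι] {σ : ι → ℕ} (hσ : Function.Injective σ)
    (f : ι → Bool) : coinLaw {ω | ∀ p, ω (σ p) = f p} = (2⁻¹ : ENNReal) ^ Fintype.card ι := by
  classical
  have : {ω : ℕ → Bool | ∀ p, ω (σ p) = f p} = Set.pi (Finset.univ.image σ : Finset ℕ)
      fun q => {b | ∀ p, σ p = q → b = f p} := by
    ext ω
    simp only [Set.mem_pi, Finset.coe_image, Finset.coe_univ, Set.image_univ, Set.forall_mem_range,
      Set.mem_ofPred_eq]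
    exact ⟨fun h a p hp => hp ▸ h p, fun h p => h p p rfl⟩
  rw [this, coinLaw, Measure.infinitePi_pi _ (fun _ _ => .of_discrete),
    Finset.prod_image hσ.injOn, Finset.prod_eq_pow_card (b := 2⁻¹) fun p _ => ?_, Finset.card_univ]
  have : {b | ∀ p', σ p' = σ p → b = f p'} = {f p} := by
    ext b
    simp only [hσ.eq_iff, forall_eq, Set.mem_ofPred_eq, Set.mem_singleton_iff]
  rw [this, PMF.toMeasure_apply_singleton _ _ (.of_discrete)]
  simp

theorem coinLaw_real_le {N s : ℕ} {σ : Fin N × Fin s → ℕ} (hσ : Function.Injective σ)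
    (B : Finset (Fin N → Fin s → Bool)) :
    coinLaw.real {ω | (fun k b => ω (σ (k, b))) ∈ B} ≤ B.card / (2 ^ s) ^ N := by
  have hsub : {ω : ℕ → Bool | (fun k b => ω (σ (k, b))) ∈ B} ⊆
      ⋃ f ∈ B, {ω | ∀ p : Fin N × Fin s, ω (σ p) = f p.1 p.2} := by
    intro ω hω
    simp only [Set.mem_iUnion, Set.mem_ofPred_eq]
    exact ⟨_, hω, fun p => rfl⟩
  have h1 : coinLaw {ω : ℕ → Bool | (fun k b => ω (σ (k, b))) ∈ B} ≤
      B.card * (2⁻¹ : ENNReal) ^ (N * s) := by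
    refine (measure_mono hsub).trans ((measure_biUnion_finset_le _ _).trans ?_)
    rw [Finset.sum_congr rfl fun f _ => coinLaw_coordinates hσ fun p => f p.1 p.2,
      Finset.sum_const, nsmul_eq_mul]
    simp
  refine (ENNReal.toReal_mono (by finiteness) h1).trans_eq ?_
  rw [ENNReal.toReal_mul, ENNReal.toReal_pow, ENNReal.toReal_inv, ENNReal.toReal_natCast,
    ENNReal.toReal_ofNat, inv_pow, ← div_eq_mul_inv, ← pow_mul, mul_comm s N]

end RealRAM

namespace RealRAM.Env.Holds

open QHam Matrix

open scoped ComplexOrder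

variable {r n m : ℕ} {E : Env} {H : Hamiltonian r n m} {C ε : ℝ}

theorem weight_nonneg (h : E.Holds H C ε) (K : ℕ) (ω : ℕ → Bool)
    (hω : ∀ p < E.natVar 2 * E.natVar 2, E.natArr 2 p = if ω p then 1 else 0) (i : Fin m) :
    0 ≤ E.weight r K i := by
  unfold Env.weight
  split_ifs with h1 h2
  · rw [h.nat_one, h.cast_eq (by omega)] at h2
    rw [h.total_eq, h.num_eq h2.le, h.imp_eq, h.hits_eq hω h2.le]
    positivity
  · exact zero_le_one
  · exact le_rfl

/-- The samples `f` do not yield a good approximation of the Hamiltonian. -/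
def _root_.QHam.Hamiltonian.BadSamples (H : Hamiltonian r n m) (X : Finset (Fin m)) (ε : ℝ) {N s : ℕ}
    (f : Fin N → Fin s → Bool) : Prop :=
  ∃ ψ, N * ε * quadForm (∑ i, H.term i) ψ <
    |∑ i : Fin m, 2 ^ s / H.importance X i *
      (Finset.card {k | Selects (H.importance X) (bitsVal (f k)) i} : ℝ) *
        quadForm (H.term i) ψ - N * quadForm (∑ i, H.term i) ψ|

theorem two_pow_numBits_le (X : Finset (Fin m)) (hr : 0 < r) (hm : 0 < m) :
    2 ^ numBits H X ≤ 4 * m * (n + 1) := by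
  have h1 := H.sum_importance (X := X)
  have hpos : 0 < ∑ j ∈ Finset.range m, H.importance X j :=
    Finset.sum_pos (fun j hj => Hamiltonian.importance_pos hr ⟨j, Finset.mem_range.1 hj⟩)
      ⟨0, by simpa using hm⟩
  have h2 : 2 ^ numBits H X ≤ 2 * ∑ j ∈ Finset.range m, H.importance X j := by
    rw [numBits]
    rcases Nat.lt_or_ge 1 (∑ j ∈ Finset.range m, H.importance X j) with h | h
    · have h3 := Nat.pow_pred_clog_lt_self one_lt_two h
      have h4 : 0 < Nat.clog 2 (∑ j ∈ Finset.range m, H.importance X j) := Nat.clog_pos one_lt_two h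
      rw [← Nat.succ_pred_eq_of_pos h4, pow_succ]
      omega
    · rw [Nat.clog_of_right_le_one h]
      omega
  nlinarith

open Classical in
theorem card_badSamples_le (hH : H.IsBounded C (2 * r)) (hr : 2 ≤ r) (hN : H.NullityLeOne)
    {X : Finset (Fin m)} (hX : H.ConflictCover C X) (hm : 0 < m) (hε : 0 < ε) (hε1 : ε ≤ 1) (N : ℕ) :
    (Finset.card {f : Fin N → Fin (numBits H X) → Bool | H.BadSamples X ε f} : ℝ) ≤
      2 * (2 ^ n * (2 ^ numBits H X) ^ N *
        Real.exp (-(N * ε ^ 2 / (4 * (12 * n * C ^ 2))))) := by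
  have hr0 : 0 < r := by omega
  have hC := hH.one_le_sq hr0 ⟨0, hm⟩
  have hn : (2 : ℝ) ≤ n := by
    have := Fintype.card_le_of_embedding (H.tuple ⟨0, hm⟩)
    simp only [Fintype.card_fin] at this
    exact_mod_cast hr.trans this
  have hm' : (0 : ℝ) < m := by exact_mod_cast hm
  have h := card_bad_samples_le (T := H.term) (g := H.importance X) (s := numBits H X)
    (P := 12 * n * C ^ 2) H.term_posSemidef (Hamiltonian.importance_pos hr0)
    (Nat.le_pow_clog one_lt_two _) (by nlinarith) hε hε1 (fun i ψ => ?_) N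
  · have hcard : (Fintype.card (Bits n) : ℝ) = 2 ^ n := by simp
    rw [hcard] at h
    exact h
  · have hi : (0 : ℝ) < H.importance X i := by exact_mod_cast Hamiltonian.importance_pos hr0 i
    have h1 := hH.quadForm_term_le_natImportance hr0 hN hX i ψ
    rw [← quadForm_sum] at h1
    have hq := (posSemidef_sum Finset.univ fun i _ => H.term_posSemidef i).quadForm_nonneg ψ
    have hqi := (H.term_posSemidef i).quadForm_nonneg ψ
    have h2 : (2 : ℝ) ^ numBits H X ≤ 4 * m * (n + 1) := by
      exact_mod_cast two_pow_numBits_le (H := H) X hr0 hm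
    rw [div_mul_eq_mul_div, div_le_iff₀ hi]
    calc 2 ^ numBits H X * quadForm (H.term i) ψ
        ≤ 4 * m * (n + 1) * quadForm (H.term i) ψ := mul_le_mul_of_nonneg_right h2 hqi
      _ = 4 * (n + 1) * (m * quadForm (H.term i) ψ) := by ring
      _ ≤ 4 * (n + 1) * (2 * C ^ 2 * H.importance X i * quadForm (∑ i, H.term i) ψ) :=
          mul_le_mul_of_nonneg_left h1 (by positivity)
      _ = (8 * (n + 1)) * (C ^ 2 * quadForm (∑ i, H.term i) ψ * H.importance X i) := by ring
      _ ≤ (12 * n) * (C ^ 2 * quadForm (∑ i, H.term i) ψ * H.importance X i) :=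
          mul_le_mul_of_nonneg_right (by linarith) (by positivity)
      _ = _ := by ring

/-- The weights form a small sparsifier if they are not computed from bad samples. -/
theorem isSparsifier (h : E.Holds H C ε) (hH : H.IsBounded C (2 * r)) (hr : 2 ≤ r) (hε : 0 < ε)
    {K : ℕ} (hK : 0 < K) {ω : ℕ → Bool}
    (hω : ∀ p < E.natVar 2 * E.natVar 2, E.natArr 2 p = if ω p then 1 else 0)
    (hgood : ε < 1 → K * n ^ 2 * C ^ 2 / ε ^ 2 < m →
      ¬H.BadSamples (marked m (E.natArr 1)) ε fun (k : Fin ⌈K * n ^ 2 * C ^ 2 / ε ^ 2⌉₊)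
        (b : Fin (numBits H (marked m (E.natArr 1)))) => ω ((10 + n + m) * k + b)) :
    H.IsSparsifier ε (fun i => E.weight r K i) ∧
      (size (fun i : Fin m => E.weight r K i) : ℝ) ≤ 2 * K * (C ^ 2 * n ^ 2 / ε ^ 2) := by
  have hnn := fun i ψ => (H.term_posSemidef i).quadForm_nonneg ψ
  have hq : ∀ ψ, 0 ≤ ∑ i, quadForm (H.term i) ψ := fun ψ => Finset.sum_nonneg fun i _ => hnn i ψ
  have hreq : E.req K = K * n ^ 2 * C ^ 2 / ε ^ 2 := h.req_eq K
  have hm_cast : E.cast (E.natVar 1) = m := by rw [h.nat_one, h.cast_eq (by omega)]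
  rw [← hreq] at hgood
  have hreq' : 2 * K * (C ^ 2 * n ^ 2 / ε ^ 2) = 2 * E.req K := by rw [hreq]; ring
  have hreq0 : 0 ≤ E.req K := by rw [hreq]; positivity
  rw [hreq']
  by_cases hε1 : ε < 1
  swap
  · have hw : ∀ i : Fin m, E.weight r K i = 0 := fun i => by
      rw [Env.weight, h.real_one, if_neg hε1]
    refine ⟨⟨h.weight_nonneg K ω hω, fun ψ => ?_⟩, ?_⟩
    · change (1 - ε) * ∑ i, quadForm (H.term i) ψ ≤ ∑ i : Fin m, E.weight r K i * quadForm (H.term i) ψ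
        ∧ ∑ i : Fin m, E.weight r K i * quadForm (H.term i) ψ ≤
          (1 + ε) * ∑ i, quadForm (H.term i) ψ
      simp only [hw, zero_mul, Finset.sum_const_zero]
      exact ⟨mul_nonpos_of_nonpos_of_nonneg (by linarith) (hq ψ), mul_nonneg (by linarith) (hq ψ)⟩
    · simp only [size, hw, lt_irrefl, Set.ofPred_false, Set.ncard_empty, Nat.cast_zero]
      positivity
  by_cases hm : E.req K < m
  swap
  · have hw : ∀ i : Fin m, E.weight r K i = 1 := fun i => by
      rw [Env.weight, h.real_one, if_pos hε1, hm_cast, if_neg hm]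
    refine ⟨⟨h.weight_nonneg K ω hω, fun ψ => ?_⟩, ?_⟩
    · change (1 - ε) * ∑ i, quadForm (H.term i) ψ ≤ ∑ i : Fin m, E.weight r K i * quadForm (H.term i) ψ
        ∧ ∑ i : Fin m, E.weight r K i * quadForm (H.term i) ψ ≤
          (1 + ε) * ∑ i, quadForm (H.term i) ψ
      simp only [hw, one_mul]
      constructor <;> nlinarith [hq ψ]
    · simp only [size, hw, zero_lt_one, Set.ofPred_true, Set.ncard_univ, Nat.card_eq_fintype_card,
        Fintype.card_fin]
      linarith
  set X := marked m (E.natArr 1) with hX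
  set N := ⌈E.req K⌉₊ with hN
  set f : Fin N → Fin (numBits H X) → Bool := fun k b => ω ((10 + n + m) * k + b) with hf
  have hm0 : 0 < m := by exact_mod_cast hreq0.trans_lt hm
  have hC := hH.one_le_sq (by omega) ⟨0, hm0⟩
  have hn : (1 : ℝ) ≤ n := by
    have := (H.tuple ⟨0, hm0⟩ ⟨0, by omega⟩).pos
    exact_mod_cast this
  have hreq1 : 1 ≤ E.req K := by
    have hK' : (1 : ℝ) ≤ K := by exact_mod_cast hK
    rw [hreq, one_le_div (by positivity)]
    calc ε ^ 2 ≤ 1 := pow_le_one₀ hε.le hε1.le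
      _ ≤ K * n ^ 2 * C ^ 2 := one_le_mul_of_one_le_of_one_le
        (one_le_mul_of_one_le_of_one_le hK' (one_le_pow₀ hn)) hC
  have hN0 : 0 < N := Nat.ceil_pos.2 (by linarith)
  have hN0' : (0 : ℝ) < N := by exact_mod_cast hN0
  have hw : ∀ i : Fin m, E.weight r K i = 2 ^ numBits H X / (N * H.importance X i) *
      (Finset.card {k | Selects (H.importance X) (bitsVal (f k)) i} : ℕ) := fun i => by
    rw [Env.weight, h.real_one, if_pos hε1, hm_cast, if_pos hm, h.total_eq, h.num_eq hm.le,
      h.imp_eq, h.hits_eq hω hm.le]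
  refine ⟨⟨h.weight_nonneg K ω hω, fun ψ => ?_⟩, ?_⟩
  · change (1 - ε) * ∑ i, quadForm (H.term i) ψ ≤ ∑ i : Fin m, E.weight r K i * quadForm (H.term i) ψ
      ∧ ∑ i : Fin m, E.weight r K i * quadForm (H.term i) ψ ≤
        (1 + ε) * ∑ i, quadForm (H.term i) ψ
    have hg := hgood hε1 hm
    unfold Hamiltonian.BadSamples at hg
    push Not at hg
    have hg := abs_le.1 (hg ψ)
    rw [quadForm_sum] at hg
    have hS : ∑ i : Fin m, 2 ^ numBits H X / H.importance X i *
        (Finset.card {k | Selects (H.importance X) (bitsVal (f k)) i} : ℝ) *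
        quadForm (H.term i) ψ = N * ∑ i : Fin m, E.weight r K i * quadForm (H.term i) ψ := by
      rw [Finset.mul_sum]
      refine Finset.sum_congr rfl fun i _ => ?_
      have hi : (H.importance X i : ℝ) ≠ 0 := by
        exact_mod_cast (Hamiltonian.importance_pos (by omega) i).ne'
      rw [hw]
      field_simp
    rw [hS] at hg
    constructor
    · refine le_of_mul_le_mul_left ?_ hN0'
      nlinarith [hg.1]
    · refine le_of_mul_le_mul_left ?_ hN0'
      nlinarith [hg.2]
  · have hsel : ∀ i : Fin m, 0 < E.weight r K i →
        ∃ k, Selects (H.importance X) (bitsVal (f k)) i := by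
      intro i hi
      by_contra hk
      push Not at hk
      rw [hw, Finset.filter_eq_empty_iff.2 fun k _ => hk k] at hi
      simp at hi
    have : Nonempty (Fin N) := ⟨⟨0, hN0⟩⟩
    choose! κ hκ using hsel
    have hsize : size (fun i : Fin m => E.weight r K i) ≤ N := by
      refine (Set.ncard_le_ncard_of_injOn (t := Set.univ) κ (fun _ _ => Set.mem_univ _) ?_).trans_eq
        (by simp [Set.ncard_univ])
      intro i hi j hj hij
      have h1 := hκ i hi
      rw [hij] at h1
      exact Fin.ext (h1.eq (hκ j hj))
    have h1 : (size (fun i : Fin m => E.weight r K i) : ℝ) ≤ N := by exact_mod_cast hsize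
    have h2 := Nat.ceil_lt_add_one hreq0
    linarith

end RealRAM.Env.Holds

theorem two_mul_two_pow_mul_exp_le (c : ℕ) {n : ℕ} (hn : 1 ≤ n) :
    2 * (2 ^ n * Real.exp (-((c + 2) * n))) ≤ 1 / (n : ℝ) ^ c := by
  have hn' : (1 : ℝ) ≤ n := by exact_mod_cast hn
  have h2 : (2 : ℝ) ≤ Real.exp 1 := by linarith [Real.add_one_le_exp (1 : ℝ)]
  have h3 : (n : ℝ) ^ c ≤ Real.exp (c * n) := by
    rw [Real.exp_nat_mul]
    exact pow_le_pow_left₀ (by positivity) (by linarith [Real.add_one_le_exp (n : ℝ)]) c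
  have h4 : (2 : ℝ) * 2 ^ n ≤ Real.exp (2 * n) := by
    calc (2 : ℝ) * 2 ^ n = 2 ^ (n + 1) := by ring
      _ ≤ Real.exp 1 ^ (n + 1) := pow_le_pow_left₀ (by norm_num) h2 _
      _ = Real.exp (n + 1) := by rw [← Real.exp_nat_mul]; push_cast; ring_nf
      _ ≤ _ := Real.exp_le_exp.2 (by linarith)
  rw [le_div_iff₀ (by positivity)]
  calc 2 * (2 ^ n * Real.exp (-((c + 2) * n))) * n ^ c
      = 2 * 2 ^ n * Real.exp (-((c + 2) * n)) * n ^ c := by ring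
    _ ≤ Real.exp (2 * n) * Real.exp (-((c + 2) * n)) * Real.exp (c * n) := by gcongr
    _ = 1 := by rw [← Real.exp_add, ← Real.exp_add, ← Real.exp_zero]; ring_nf

theorem mainTheorem4 (r : ℕ) (hr : 2 ≤ r) (c : ℕ) :
    ∃ (P : RealRAM.Program) (A a B b : ℕ),
      ∀ (n m : ℕ) (H : QHam.Hamiltonian r n m) (C ε : ℝ),
        H.NullityLeOne → H.IsBounded C (2 * r) → 0 < ε →
        (∀ ω : ℕ → Bool, ∃ (s : RealRAM.State) (t : ℕ),
          RealRAM.Exec P (H.input C ε ω) s t ∧ t ≤ A * (n + m + 1) ^ a ∧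
          ∀ i, 0 ≤ QHam.output m s i) ∧
        1 - 1 / (n : ℝ) ^ c ≤
          RealRAM.coinLaw.real {ω | ∃ (s : RealRAM.State) (t : ℕ),
            RealRAM.Exec P (H.input C ε ω) s t ∧
            H.IsSparsifier ε (QHam.output m s) ∧
            (QHam.size (QHam.output m s) : ℝ) ≤
              B * Real.log n ^ b * (C ^ 2 * (n : ℝ) ^ 2 / ε ^ 2)} := by
  classical
  set K := 48 * (c + 2) with hK
  obtain ⟨P, A, a, hP⟩ := RealRAM.exists_program r K
  refine ⟨P, A, a, 2 * K, 0, fun n m H C ε hN hH hε => ?_⟩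
  have hr0 : 0 < r := by omega
  set E₀ := (H.input C ε fun _ => false).env.init with hE₀
  set E : (ℕ → Bool) → RealRAM.Env := fun ω => (H.input C ε ω).env.final r ω with hE
  have hE₀h : E₀.Holds H C ε := RealRAM.Env.holds_init H C ε _
  set X := RealRAM.marked m (E₀.marks r (E₀.natVar 2)) with hX
  have hholds : ∀ ω, (E ω).Holds H C ε := fun ω =>
    (hE₀h.setArr one_ne_zero _).setArr two_ne_zero _
  have hmarked : ∀ ω, RealRAM.marked m ((E ω).natArr 1) = X := fun ω => rfl
  have hcover : H.ConflictCover C X := hE₀h.conflictCover hH hr0 rfl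
  have hcoins : ∀ ω, ∀ p < (E ω).natVar 2 * (E ω).natVar 2,
      (E ω).natArr 2 p = if ω p then 1 else 0 := fun ω p hp => if_pos hp
  have hexec : ∀ ω, ∃ s t, RealRAM.Exec P (H.input C ε ω) s t ∧ t ≤ A * (n + m + 1) ^ a ∧
      QHam.output m s = fun i : Fin m => (E ω).weight r K i := fun ω => by
    obtain ⟨s, t, h1, h2, h3⟩ := hP (H.input C ε ω)
    exact ⟨s, t, h1, h2, funext fun i => h3 i i.2⟩
  refine ⟨fun ω => ?_, ?_⟩
  · obtain ⟨s, t, h1, h2, h3⟩ := hexec ω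
    exact ⟨s, t, h1, h2, fun i => h3 ▸ (hholds ω).weight_nonneg K ω (hcoins ω) i⟩
  set N := ⌈K * (n : ℝ) ^ 2 * C ^ 2 / ε ^ 2⌉₊ with hNdef
  set bad : Set (ℕ → Bool) := {ω | ε < 1 ∧ K * (n : ℝ) ^ 2 * C ^ 2 / ε ^ 2 < m ∧
    H.BadSamples X ε fun (k : Fin N) (b : Fin (RealRAM.Env.Holds.numBits H X)) =>
      ω ((10 + n + m) * k + b)} with hbad
  set good := {ω | ∃ (s : RealRAM.State) (t : ℕ), RealRAM.Exec P (H.input C ε ω) s t ∧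
    H.IsSparsifier ε (QHam.output m s) ∧ (QHam.size (QHam.output m s) : ℝ) ≤
      (2 * K : ℕ) * Real.log n ^ 0 * (C ^ 2 * (n : ℝ) ^ 2 / ε ^ 2)} with hgood
  have hcompl : ∀ ω, ω ∉ bad → ω ∈ good := by
    intro ω hω
    obtain ⟨s, t, h1, -, h3⟩ := hexec ω
    obtain ⟨k1, k2⟩ := (hholds ω).isSparsifier hH hr hε (by omega : 0 < K) (hcoins ω)
      fun e1 e2 e3 => hω ⟨e1, e2, e3⟩
    refine ⟨s, t, h1, h3 ▸ k1, ?_⟩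
    rw [h3, pow_zero, mul_one]
    push_cast
    exact k2
  have : MeasureTheory.IsProbabilityMeasure RealRAM.coinLaw := by
    unfold RealRAM.coinLaw; infer_instance
  have hprob : 1 - RealRAM.coinLaw.real bad ≤ RealRAM.coinLaw.real good := by
    have h1 : RealRAM.coinLaw.real (bad ∪ good) = 1 := by
      rw [show bad ∪ good = Set.univ from Set.eq_univ_of_forall fun ω =>
        or_iff_not_imp_left.2 (hcompl ω)]
      exact MeasureTheory.probReal_univ
    have h2 := MeasureTheory.measureReal_union_le (μ := RealRAM.coinLaw) bad good
    linarith
  refine le_trans (sub_le_sub_left ?_ 1) hprob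
  by_cases hcase : ε < 1 ∧ K * (n : ℝ) ^ 2 * C ^ 2 / ε ^ 2 < m
  swap
  · have : bad = ∅ := Set.eq_empty_of_forall_notMem fun ω hω => hcase ⟨hω.1, hω.2.1⟩
    rw [this, MeasureTheory.measureReal_empty]
    positivity
  obtain ⟨hε1, hm⟩ := hcase
  have hm0 : 0 < m := by
    have : (0 : ℝ) < m := lt_of_le_of_lt (by positivity) hm
    exact_mod_cast this
  have hn : 1 ≤ n := (H.tuple ⟨0, hm0⟩ ⟨0, hr0⟩).pos
  have hn' : (0 : ℝ) < n := by exact_mod_cast hn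
  have hC : 0 < C := hH.1
  set s := RealRAM.Env.Holds.numBits H X with hs
  have hsL : s ≤ 10 + n + m := RealRAM.Env.Holds.numBits_le H X
  set σ : Fin N × Fin s → ℕ := fun p => (10 + n + m) * p.1 + p.2 with hσ
  have hσi : Function.Injective σ := by
    rintro ⟨k, b⟩ ⟨k', b'⟩ h
    simp only [hσ] at h
    have hb : (b : ℕ) < 10 + n + m := b.2.trans_le hsL
    have hb' : (b' : ℕ) < 10 + n + m := b'.2.trans_le hsL
    have hk : (k : ℕ) = k' := by
      have := congrArg (· / (10 + n + m)) h
      simpa [Nat.mul_add_div (by omega : 0 < 10 + n + m), Nat.div_eq_of_lt hb,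
        Nat.div_eq_of_lt hb'] using this
    rw [hk] at h
    exact Prod.ext (Fin.ext hk) (Fin.ext (by simpa using h))
  have h1 := RealRAM.coinLaw_real_le hσi
    (Finset.univ.filter fun f : Fin N → Fin s → Bool => H.BadSamples X ε f)
  have h2 := RealRAM.Env.Holds.card_badSamples_le hH hr hN hcover hm0 hε hε1.le N
  have h3 : RealRAM.coinLaw.real bad ≤ RealRAM.coinLaw.real {ω | (fun k b => ω (σ (k, b))) ∈
      Finset.univ.filter fun f : Fin N → Fin s → Bool => H.BadSamples X ε f} :=
    MeasureTheory.measureReal_mono (fun ω hω => by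
      simpa using hω.2.2) (by finiteness)
  have hexp : ((c + 2) * n : ℝ) ≤ N * ε ^ 2 / (4 * (12 * n * C ^ 2)) := by
    rw [le_div_iff₀ (by positivity)]
    have h4 := Nat.le_ceil (K * (n : ℝ) ^ 2 * C ^ 2 / ε ^ 2)
    rw [div_le_iff₀ (by positivity)] at h4
    refine le_trans (le_of_eq ?_) h4
    rw [hK]
    push_cast
    ring
  calc RealRAM.coinLaw.real bad
      ≤ (2 * (2 ^ n * (2 ^ s) ^ N * Real.exp (-(N * ε ^ 2 / (4 * (12 * n * C ^ 2)))))) /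
        (2 ^ s) ^ N := h3.trans (h1.trans (div_le_div_of_nonneg_right h2 (by positivity)))
    _ = 2 * (2 ^ n * Real.exp (-(N * ε ^ 2 / (4 * (12 * n * C ^ 2))))) := by
      field_simp
    _ ≤ 2 * (2 ^ n * Real.exp (-((c + 2) * n))) := by
      gcongr
    _ ≤ _ := two_mul_two_pow_mul_exp_le c hn
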